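/- Let $k$ be an algebraically closed field of characteristic $0$, let $m\in k\setminus\mathbb Z$, and put $f=z(z+m)\in k[z]$. Let $A=A(f)$ be the $k$-algebra generated by $x,y,z$ with relations $$xz=(z+1)x,\qquad yz=(z-1)y,\qquad xy=f(z),\qquad yx=f(z-1),$$ $\mathbb Z$-graded by $\deg x=1$, $\deg y=-1$, $\deg z=0$. For an abelian group $\Gamma$ and a $\Gamma$-graded $k$-algebra $R$, $\mathrm{gr}(R,\Gamma)$ denotes the category of finitely generated $\Gamma$-graded right $R$-modules with degree-preserving homomorphisms, and $\mathrm{gr}\,A=\mathrm{gr}(A,\mathbb Z)$. Shifts are given by $M\langle n\rangle_i=M_{i-n}$. For $c\in\{0,m\}$ put $$X_c=A/(x,\,z+c)A,\qquad Y_c=\bigl(A/(y,\,z+c-1)A\bigr)\langle 1\rangle .$$ For $n\in\mathbb Z$ and a $\mathbb Z$-graded right $A$-module $P$ let $\iota_{(n,\emptyset)}P\subseteq P$ be the intersection of the kernels of all graded homomorphisms from $P$ to $X_0\langle n\rangle$ or to $Y_0\langle n\rangle$, and let $\iota_{(\emptyset,n)}P\subseteq P$ be defined in the same way with $X_m\langle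 n\rangle$ and $Y_m\langle n\rangle$; both are functorial in $P$, acting on morphisms by restriction. (If $P$ is a rank one graded projective module, this is the kernel of the surjection, unique up to scalars, of $P$ onto the one of the two simple modules that is a factor of $P$.) Let $\mathbb Z_{\mathrm{fin}}$ be the group of finite subsets of $\mathbb Z$ under symmetric difference, let $\Gamma=\mathbb Z_{\mathrm{fin}}\times\mathbb Z_{\mathrm{fin}}$, and for $\gamma=(J,J')\in\Gamma$ put $$\iota_\gamma=\prod_{j\in J}\iota_{(j,\emptyset)}\prod_{j\in J'}\iota_{(\emptyset,j)},\qquad h_\gamma=\prod_{j\in J}(z+j)\prod_{j\in J'}(z+j+m)$$ (composition of functors, in increasing order of $j$ in each product). Let $$D=\bigoplus_{\gamma\in\Gamma}D_\gamma,\qquad D_\gamma=\mathrm{Hom}_{\mathrm{gr}\,A}(A,\iota_\gamma A),$$ with the $\Gamma$-graded $k$-algebra structure in which the product of $\varphi\in D_\gamma$ and $\psi\in D_\delta$ is $$\varphi\cdot\psi=\Theta_{\delta,\gamma}\circ\iota_\delta(\varphi)\circ\psi\in D_{\gamma+\delta},$$ where $\Theta_{\delta,\gamma}\colon\iota_\delta\iota_\gamma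 A\to\iota_{\gamma+\delta}A$ is left multiplication by $h_{\gamma\cap\delta}^{-1}$ ($\gamma\cap\delta$ being the componentwise intersection); that is, $\varphi\cdot\psi$ is the unique $\chi\in D_{\gamma+\delta}$ with $h_{\gamma\cap\delta}\,\chi(a)=\varphi(\psi(a))$ for all $a\in A$, all modules being viewed inside $A$. Then there is a $k$-linear equivalence of categories $$\mathrm{gr}\,A(f)\;\equiv\;\mathrm{gr}(D,\mathbb Z_{\mathrm{fin}}\times\mathbb Z_{\mathrm{fin}}).$$ -/

import Mathlib

open CategoryTheory Polynomial

universe u w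

/-! ### Graded right modules -/

/-- A `Γ`-graded right module over a `k`-algebra `R` carrying the family of homogeneous pieces `𝒜`.
Right `R`-modules are modules over `Rᵐᵒᵖ`; the fields `indep` and `iSup_eq_top` together say that
the module is the internal direct sum of its pieces. -/
structure GrMod (k : Type u) [Field k] {R : Type u} [Ring R] [Algebra k R]
    {Γ : Type w} [AddCommGroup Γ] (𝒜 : Γ → Submodule k R) where
  carrier : Type u
  [addCommGroup : AddCommGroup carrier]
  [moduleBase : Module k carrier]
  [moduleRight : Module Rᵐᵒᵖ carrier]
  [isScalarTower : IsScalarTower k Rᵐᵒᵖ carrier]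
  piece : Γ → Submodule k carrier
  indep : iSupIndep piece
  iSup_eq_top : ⨆ γ, piece γ = ⊤
  smul_mem : ∀ {γ δ : Γ} {m : carrier} {r : R}, m ∈ piece γ → r ∈ 𝒜 δ →
    MulOpposite.op r • m ∈ piece (γ + δ)

attribute [instance] GrMod.addCommGroup GrMod.moduleBase GrMod.moduleRight GrMod.isScalarTower

namespace GrMod

section Basic

variable {k : Type u} [Field k] {R : Type u} [Ring R] [Algebra k R]
  {Γ : Type w} [AddCommGroup Γ] {𝒜 : Γ → Submodule k R}

/-- Graded homomorphisms: right `R`-linear maps that preserve degrees. -/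
def homSubmodule (M N : GrMod k 𝒜) : Submodule k (M.carrier →ₗ[Rᵐᵒᵖ] N.carrier) where
  carrier := {φ | ∀ γ, ∀ m ∈ M.piece γ, φ m ∈ N.piece γ}
  add_mem' := fun ha hb γ m hm => (N.piece γ).add_mem (ha γ m hm) (hb γ m hm)
  zero_mem' := fun γ _ _ => (N.piece γ).zero_mem
  smul_mem' := fun c _ ha γ m hm => (N.piece γ).smul_mem c (ha γ m hm)

/-- The category of all `Γ`-graded right `R`-modules, with the degree preserving homomorphisms. -/
instance category : Category.{u} (GrMod k 𝒜) where
  Hom M N := homSubmodule M N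
  id M := ⟨LinearMap.id, fun _ _ hm => hm⟩
  comp φ ψ := ⟨ψ.1.comp φ.1, fun γ m hm => ψ.2 γ _ (φ.2 γ m hm)⟩

/-- The linear map underlying a graded homomorphism. -/
def Hom.lin {M N : GrMod k 𝒜} (φ : M ⟶ N) : M.carrier →ₗ[Rᵐᵒᵖ] N.carrier :=
  Subtype.val (p := fun x => x ∈ homSubmodule M N) φ

/-- A degree preserving linear map, as a morphism. -/
def Hom.mk {M N : GrMod k 𝒜} (φ : M.carrier →ₗ[Rᵐᵒᵖ] N.carrier)
    (h : ∀ γ, ∀ m ∈ M.piece γ, φ m ∈ N.piece γ) : M ⟶ N :=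
  (⟨φ, h⟩ : homSubmodule M N)

theorem Hom.lin_mem {M N : GrMod k 𝒜} (φ : M ⟶ N) {γ : Γ} {m : M.carrier} (hm : m ∈ M.piece γ) :
    Hom.lin φ m ∈ N.piece γ :=
  Subtype.property (p := fun x => x ∈ homSubmodule M N) φ γ m hm

@[ext]
theorem hom_ext {M N : GrMod k 𝒜} {φ ψ : M ⟶ N} (h : ∀ m, Hom.lin φ m = Hom.lin ψ m) : φ = ψ :=
  Subtype.ext (p := fun x => x ∈ homSubmodule M N) (LinearMap.ext h)

instance preadditive : Preadditive (GrMod k 𝒜) where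
  homGroup M N := inferInstanceAs (AddCommGroup (homSubmodule M N))
  add_comp _ _ _ _ _ ψ := hom_ext fun _ => map_add (Hom.lin ψ) _ _
  comp_add _ _ _ _ _ _ := rfl

instance linear : Linear k (GrMod k 𝒜) where
  homModule M N := inferInstanceAs (Module k (homSubmodule M N))
  smul_comp _ _ _ c φ ψ := hom_ext fun m =>
    LinearMap.map_smul_of_tower (Hom.lin ψ) c (Hom.lin φ m)
  comp_smul _ _ _ _ _ _ := rfl

@[simp] theorem Hom.lin_mk {M N : GrMod k 𝒜} (φ : M.carrier →ₗ[Rᵐᵒᵖ] N.carrier)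
    (h : ∀ γ, ∀ m ∈ M.piece γ, φ m ∈ N.piece γ) : Hom.lin (Hom.mk φ h) = φ := rfl

@[simp] theorem Hom.lin_id (M : GrMod k 𝒜) (m : M.carrier) : Hom.lin (𝟙 M) m = m := rfl

@[simp] theorem Hom.lin_comp {M N P : GrMod k 𝒜} (φ : M ⟶ N) (ψ : N ⟶ P) (m : M.carrier) :
    Hom.lin (φ ≫ ψ) m = Hom.lin ψ (Hom.lin φ m) := rfl

@[simp] theorem Hom.lin_add {M N : GrMod k 𝒜} (φ ψ : M ⟶ N) (m : M.carrier) :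
    Hom.lin (φ + ψ) m = Hom.lin φ m + Hom.lin ψ m := rfl

@[simp] theorem Hom.lin_zero {M N : GrMod k 𝒜} (m : M.carrier) :
    Hom.lin (0 : M ⟶ N) m = 0 := rfl

@[simp] theorem Hom.lin_smul {M N : GrMod k 𝒜} (c : k) (φ : M ⟶ N) (m : M.carrier) :
    Hom.lin (c • φ) m = c • Hom.lin φ m := rfl

/-! ### Homogeneous submodules, quotients, shifts -/

/-- A submodule is homogeneous if it is spanned by its homogeneous elements. -/
def IsHomogeneous (M : GrMod k 𝒜) (N : Submodule Rᵐᵒᵖ M.carrier) : Prop :=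
  N.restrictScalars k ≤ ⨆ γ, (N.restrictScalars k ⊓ M.piece γ)

theorem exists_sum (M : GrMod k 𝒜) (m : M.carrier) :
    ∃ (s : Finset Γ) (v : Γ → M.carrier), (∀ γ, v γ ∈ M.piece γ) ∧ ∑ γ ∈ s, v γ = m := by
  have h : m ∈ ⨆ γ, M.piece γ := by rw [M.iSup_eq_top]; trivial
  obtain ⟨v, hv, hm⟩ := (Submodule.mem_iSup_iff_exists_finsupp _ _).1 h
  exact ⟨v.support, v, hv, hm⟩

theorem eq_zero_of_sum (M : GrMod k 𝒜) {s : Finset Γ} {v : Γ → M.carrier}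
    (hv : ∀ γ ∈ s, v γ ∈ M.piece γ) (h : ∑ γ ∈ s, v γ = 0) : ∀ γ ∈ s, v γ = 0 :=
  (iSupIndep_iff_finsetSum_eq_zero_imp_eq_zero _).1 M.indep s v hv h

theorem IsHomogeneous.mem_of_sum {M : GrMod k 𝒜} {N : Submodule Rᵐᵒᵖ M.carrier}
    (hN : M.IsHomogeneous N) {s : Finset Γ} {v : Γ → M.carrier}
    (hv : ∀ γ ∈ s, v γ ∈ M.piece γ) (h : ∑ γ ∈ s, v γ ∈ N) : ∀ γ ∈ s, v γ ∈ N := by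
  classical
  intro γ hγ
  obtain ⟨t, ht, hs⟩ := (Submodule.mem_iSup_iff_exists_finsupp _ _).1 (hN h)
  let v' : Γ → M.carrier := fun δ => if δ ∈ s then v δ else 0
  have key : ∑ δ ∈ s ∪ t.support, (v' δ - t δ) = 0 := by
    rw [Finset.sum_sub_distrib, sub_eq_zero]
    have h1 : ∑ δ ∈ s ∪ t.support, v' δ = ∑ δ ∈ s, v δ := by
      rw [← Finset.sum_subset Finset.subset_union_left]
      · exact Finset.sum_congr rfl fun δ hδ => by simp [v', hδ]
      · intro δ _ hδ; simp [v', hδ]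
    have h2 : ∑ δ ∈ s ∪ t.support, t δ = ∑ δ ∈ t.support, t δ := by
      symm
      apply Finset.sum_subset Finset.subset_union_right
      intro δ _ hδ; simpa using hδ
    rw [h1, h2, ← hs]; rfl
  have := M.eq_zero_of_sum (fun δ _ => (M.piece δ).sub_mem
    (by by_cases hδ : δ ∈ s <;> simp [v', hδ, hv]) (ht δ).2) key γ
    (Finset.mem_union_left _ hγ)
  have h3 : v γ = t γ := by simpa [v', hγ, sub_eq_zero] using this
  rw [h3]; exact (ht γ).1

/-- A homogeneous submodule, graded by its homogeneous elements. -/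
def sub (M : GrMod k 𝒜) (N : Submodule Rᵐᵒᵖ M.carrier) (hN : M.IsHomogeneous N) :
    GrMod k 𝒜 where
  carrier := N
  piece γ := (M.piece γ).comap (N.subtype.restrictScalars k)
  indep := by
    rw [iSupIndep_iff_finsetSum_eq_zero_imp_eq_zero]
    intro s v hv h γ hγ
    have := M.eq_zero_of_sum (s := s) (v := fun δ => (v δ : M.carrier)) (fun δ hδ => hv δ hδ)
      (by simpa using congrArg (fun x : N => (x : M.carrier)) h) γ hγ
    exact Subtype.ext this
  iSup_eq_top := by
    rw [eq_top_iff]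
    rintro ⟨m, hm⟩ -
    obtain ⟨t, ht, hs⟩ := (Submodule.mem_iSup_iff_exists_finsupp _ _).1 (hN hm)
    have : (⟨m, hm⟩ : N) = ∑ γ ∈ t.support, (⟨t γ, (ht γ).1⟩ : N) := by
      apply Subtype.ext
      simp only [← hs, Finsupp.sum, AddSubmonoidClass.coe_finsetSum]
    rw [this]
    exact Submodule.sum_mem _ fun γ _ => Submodule.mem_iSup_of_mem γ (ht γ).2
  smul_mem := fun hm hr => M.smul_mem hm hr

/-- The quotient by a homogeneous submodule, graded by the images of the pieces. -/
def quot (M : GrMod k 𝒜) (N : Submodule Rᵐᵒᵖ M.carrier) (hN : M.IsHomogeneous N) :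
    GrMod k 𝒜 where
  carrier := M.carrier ⧸ N
  piece γ := (M.piece γ).map (N.mkQ.restrictScalars k)
  indep := by
    rw [iSupIndep_iff_finsetSum_eq_zero_imp_eq_zero]
    intro s v hv h γ hγ
    choose! t ht htv using hv
    have hsum : ∑ δ ∈ s, t δ ∈ N := by
      rw [← Submodule.Quotient.mk_eq_zero, ← Submodule.mkQ_apply, map_sum, ← h]
      exact Finset.sum_congr rfl fun δ hδ => htv δ hδ
    rw [← htv γ hγ]
    exact (Submodule.Quotient.mk_eq_zero N).2 (hN.mem_of_sum ht hsum γ hγ)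
  iSup_eq_top := by
    rw [← Submodule.map_iSup, M.iSup_eq_top, Submodule.map_top, LinearMap.range_eq_top]
    exact N.mkQ_surjective
  smul_mem := by
    rintro γ δ _ r ⟨m, hm, rfl⟩ hr
    exact ⟨MulOpposite.op r • m, M.smul_mem hm hr, rfl⟩

/-- The shift `M⟨δ⟩`, with the convention `M⟨δ⟩_γ = M_{γ - δ}`. -/
def shift (M : GrMod k 𝒜) (δ : Γ) : GrMod k 𝒜 where
  carrier := M.carrier
  piece γ := M.piece (γ - δ)
  indep := M.indep.comp (sub_left_injective)
  iSup_eq_top := by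
    rw [← M.iSup_eq_top]
    exact (Equiv.subRight δ).iSup_comp (g := M.piece)
  smul_mem := by
    intro γ ε m r hm hr
    rw [add_sub_right_comm]
    exact M.smul_mem hm hr

/-! ### The subfunctor of common kernels -/

/-- The intersection of the kernels of all graded homomorphisms from `M` to members of `𝒯`. -/
def rejectSubmodule (𝒯 : Set (GrMod k 𝒜)) (M : GrMod k 𝒜) : Submodule Rᵐᵒᵖ M.carrier :=
  ⨅ (T ∈ 𝒯) (φ : M ⟶ T), LinearMap.ker (Hom.lin φ)

theorem mem_rejectSubmodule {𝒯 : Set (GrMod k 𝒜)} {M : GrMod k 𝒜} {m : M.carrier} :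
    m ∈ rejectSubmodule 𝒯 M ↔ ∀ T ∈ 𝒯, ∀ φ : M ⟶ T, Hom.lin φ m = 0 := by
  simp [rejectSubmodule]

theorem isHomogeneous_reject (𝒯 : Set (GrMod k 𝒜)) (M : GrMod k 𝒜) :
    M.IsHomogeneous (rejectSubmodule 𝒯 M) := by
  intro m hm
  obtain ⟨s, v, hv, rfl⟩ := M.exists_sum m
  refine Submodule.sum_mem _ fun γ hγ => Submodule.mem_iSup_of_mem γ ⟨?_, hv γ⟩
  refine mem_rejectSubmodule.2 fun T hT φ => ?_
  refine T.eq_zero_of_sum (s := s) (v := fun δ => Hom.lin φ (v δ))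
    (fun δ _ => Hom.lin_mem φ (hv δ)) ?_ γ hγ
  rw [← map_sum]
  exact mem_rejectSubmodule.1 hm T hT φ

/-- The subfunctor of the identity that sends `M` to the intersection of the kernels of all graded
homomorphisms from `M` to members of `𝒯`, and that acts on morphisms by restriction. -/
def reject (𝒯 : Set (GrMod k 𝒜)) : GrMod k 𝒜 ⥤ GrMod k 𝒜 where
  obj M := M.sub (rejectSubmodule 𝒯 M) (isHomogeneous_reject 𝒯 M)
  map {M N} φ := Hom.mk
    ((Hom.lin φ).restrict fun m hm => mem_rejectSubmodule.2 fun T hT ψ =>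
      mem_rejectSubmodule.1 hm T hT (φ ≫ ψ))
    (fun _ _ hm => Hom.lin_mem φ hm)

/-- The inclusion of the subfunctor `reject 𝒯` into the identity. -/
def rejectIncl (𝒯 : Set (GrMod k 𝒜)) : reject 𝒯 ⟶ 𝟭 (GrMod k 𝒜) where
  app M := Hom.mk (rejectSubmodule 𝒯 M).subtype (fun _ _ hm => hm)

end Basic

/-- The property of being finitely generated. -/
def fg (k : Type u) [Field k] {R : Type u} [Ring R] [Algebra k R]
    {Γ : Type w} [AddCommGroup Γ] (𝒜 : Γ → Submodule k R) : ObjectProperty (GrMod k 𝒜) :=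
  fun M => Module.Finite Rᵐᵒᵖ M.carrier

end GrMod

/-- The category `gr (R, Γ)` of finitely generated `Γ`-graded right `R`-modules. -/
abbrev gr (k : Type u) [Field k] {R : Type u} [Ring R] [Algebra k R]
    {Γ : Type w} [AddCommGroup Γ] (𝒜 : Γ → Submodule k R) : Type (max (u + 1) w) :=
  (GrMod.fg k 𝒜).FullSubcategory

/-! ### The generalized Weyl algebra -/

/-- The generators `x`, `y`, `z`. -/
inductive GWAGen : Type
  | x
  | y
  | z

/-- The degrees of the generators: `deg x = 1`, `deg y = -1`, `deg z = 0`. -/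
def GWAGen.deg : GWAGen → ℤ
  | x => 1
  | y => -1
  | z => 0

section GWA

variable {k : Type u} [Field k]

/-- The relations `x z = σ(z) x`, `y z = σ⁻¹(z) y`, `x y = f`, `y x = σ⁻¹(f)` where
`σ(z) = z + 1`. -/
inductive GWARel (f : k[X]) : FreeAlgebra k GWAGen → FreeAlgebra k GWAGen → Prop
  | xz : GWARel f (FreeAlgebra.ι k .x * FreeAlgebra.ι k .z)
      ((FreeAlgebra.ι k .z + 1) * FreeAlgebra.ι k .x)
  | yz : GWARel f (FreeAlgebra.ι k .y * FreeAlgebra.ι k .z)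
      ((FreeAlgebra.ι k .z - 1) * FreeAlgebra.ι k .y)
  | xy : GWARel f (FreeAlgebra.ι k .x * FreeAlgebra.ι k .y) (aeval (FreeAlgebra.ι k .z) f)
  | yx : GWARel f (FreeAlgebra.ι k .y * FreeAlgebra.ι k .x) (aeval (FreeAlgebra.ι k .z - 1) f)

/-- The generalized Weyl algebra `A(f)` with base ring `k[z]`, defining automorphism
`σ(z) = z + 1` and defining element `f`. -/
abbrev GWA (f : k[X]) : Type u := RingQuot (GWARel f)

namespace GWA

/-- The images of the generators in `A(f)`. -/
def gen (f : k[X]) (g : GWAGen) : GWA f := RingQuot.mkAlgHom k (GWARel f) (FreeAlgebra.ι k g)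

/-- The homogeneous piece of degree `n`: the span of all words of degree `n` in the generators. -/
def piece (f : k[X]) (n : ℤ) : Submodule k (GWA f) :=
  Submodule.span k {a | ∃ l : List GWAGen, (l.map GWAGen.deg).sum = n ∧ a = (l.map (gen f)).prod}

variable (f : k[X])

theorem word_mem (l : List GWAGen) : (l.map (gen f)).prod ∈ piece f (l.map GWAGen.deg).sum :=
  Submodule.subset_span ⟨l, rfl, rfl⟩

theorem gen_mem (g : GWAGen) : gen f g ∈ piece f g.deg := by
  simpa using word_mem f [g]

theorem x_mul_z : gen f .x * gen f .z = (gen f .z + 1) * gen f .x := by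
  simpa [gen] using RingQuot.mkAlgHom_rel k (GWARel.xz (f := f))

theorem y_mul_z : gen f .y * gen f .z = (gen f .z - 1) * gen f .y := by
  simpa [gen] using RingQuot.mkAlgHom_rel k (GWARel.yz (f := f))

theorem x_mul_y : gen f .x * gen f .y = aeval (gen f .z) f := by
  have := RingQuot.mkAlgHom_rel k (GWARel.xy (f := f))
  rwa [map_mul, ← aeval_algHom_apply] at this

theorem y_mul_x : gen f .y * gen f .x = aeval (gen f .z - 1) f := by
  have := RingQuot.mkAlgHom_rel k (GWARel.yx (f := f))
  rwa [map_mul, ← aeval_algHom_apply, map_sub, map_one] at this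

/-- Algebra homomorphisms out of `A(f)`. -/
def lift {B : Type*} [Ring B] [Algebra k B] (b : GWAGen → B)
    (hxz : b .x * b .z = (b .z + 1) * b .x) (hyz : b .y * b .z = (b .z - 1) * b .y)
    (hxy : b .x * b .y = aeval (b .z) f) (hyx : b .y * b .x = aeval (b .z - 1) f) :
    GWA f →ₐ[k] B :=
  RingQuot.liftAlgHom k ⟨FreeAlgebra.lift k b, by
    intro p q h
    cases h
    · simpa using hxz
    · simpa using hyz
    · rw [map_mul, ← aeval_algHom_apply]; simpa using hxy
    · rw [map_mul, ← aeval_algHom_apply]; simpa using hyx⟩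

@[simp]
theorem lift_gen {B : Type*} [Ring B] [Algebra k B] (b : GWAGen → B)
    (hxz : b .x * b .z = (b .z + 1) * b .x) (hyz : b .y * b .z = (b .z - 1) * b .y)
    (hxy : b .x * b .y = aeval (b .z) f) (hyx : b .y * b .x = aeval (b .z - 1) f) (g : GWAGen) :
    lift f b hxz hyz hxy hyx (gen f g) = b g := by
  rw [lift, gen, RingQuot.liftAlgHom_mkAlgHom_apply, FreeAlgebra.lift_ι_apply]

theorem one_mem : (1 : GWA f) ∈ piece f 0 := by simpa using word_mem f []

theorem mul_mem {i j : ℤ} {a b : GWA f} (ha : a ∈ piece f i) (hb : b ∈ piece f j) :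
    a * b ∈ piece f (i + j) := by
  have h : piece f i * piece f j ≤ piece f (i + j) := by
    rw [piece, piece, Submodule.span_mul_span, Submodule.span_le]
    rintro _ ⟨_, ⟨l, rfl, rfl⟩, _, ⟨l', rfl, rfl⟩, rfl⟩
    simpa using word_mem f (l ++ l')
  exact h (Submodule.mul_mem_mul ha hb)

instance gradedMonoid : SetLike.GradedMonoid (piece f) where
  one_mem := one_mem f
  mul_mem _ _ _ _ ha hb := mul_mem f ha hb

theorem algHom_ext {B : Type*} [Ring B] [Algebra k B] {φ ψ : GWA f →ₐ[k] B}
    (h : ∀ g, φ (gen f g) = ψ (gen f g)) : φ = ψ := by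
  apply RingQuot.ringQuot_ext'
  apply FreeAlgebra.hom_ext
  funext g
  exact h g

theorem aeval_mem {a : GWA f} (ha : a ∈ piece f 0) (p : k[X]) : aeval a p ∈ piece f 0 := by
  have := ((aeval (⟨a, ha⟩ : SetLike.GradeZero.subalgebra (piece f)) p)).2
  rwa [aeval_subalgebra_coe] at this

/-- The element `p(z)` of `A(f)`. -/
noncomputable def poly : k[X] →ₐ[k] GWA f := aeval (gen f .z)

theorem poly_mem (p : k[X]) : poly f p ∈ piece f 0 := aeval_mem f (gen_mem f .z) p

/-- The algebra homomorphism that multiplies an element of degree `n` by `T ^ n`. -/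
noncomputable def coact : GWA f →ₐ[k] AddMonoidAlgebra (GWA f) ℤ :=
  lift f (fun g => AddMonoidAlgebra.single g.deg (gen f g))
    (by
      rw [AddMonoidAlgebra.one_def, show GWAGen.z.deg = 0 from rfl, ← AddMonoidAlgebra.single_add,
        AddMonoidAlgebra.single_mul_single, AddMonoidAlgebra.single_mul_single, x_mul_z]
      rfl)
    (by
      rw [AddMonoidAlgebra.one_def, show GWAGen.z.deg = 0 from rfl, ← AddMonoidAlgebra.single_sub,
        AddMonoidAlgebra.single_mul_single, AddMonoidAlgebra.single_mul_single, y_mul_z]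
      rfl)
    (by
      have h := aeval_algHom_apply (AddMonoidAlgebra.singleZeroAlgHom (R := k) (A := GWA f)
        (M := ℤ)) (gen f .z) f
      rw [AddMonoidAlgebra.single_mul_single, x_mul_y]
      exact h.symm)
    (by
      have h := aeval_algHom_apply (AddMonoidAlgebra.singleZeroAlgHom (R := k) (A := GWA f)
        (M := ℤ)) (gen f .z - 1) f
      rw [AddMonoidAlgebra.single_mul_single, y_mul_x]
      rw [map_sub, map_one] at h
      exact h.symm)

theorem coact_word (l : List GWAGen) : coact f (l.map (gen f)).prod =
    AddMonoidAlgebra.single (l.map GWAGen.deg).sum (l.map (gen f)).prod := by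
  induction l with
  | nil => simp only [List.map_nil, List.prod_nil, map_one]; rfl
  | cons g l ih =>
    simp only [List.map_cons, List.prod_cons, map_mul, List.sum_cons]
    rw [ih, coact, lift_gen, AddMonoidAlgebra.single_mul_single]

theorem coact_of_mem {n : ℤ} {a : GWA f} (ha : a ∈ piece f n) :
    coact f a = AddMonoidAlgebra.single n a := by
  induction ha using Submodule.span_induction with
  | mem a h =>
    obtain ⟨l, rfl, rfl⟩ := h
    exact coact_word f l
  | zero => simp
  | add a b ha hb iha ihb => rw [map_add, iha, ihb, AddMonoidAlgebra.single_add]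
  | smul c a ha ih => rw [map_smul, ih, AddMonoidAlgebra.smul_single]

theorem piece_indep : iSupIndep (piece f) := by
  rw [iSupIndep_iff_finsetSum_eq_zero_imp_eq_zero]
  intro s v hv h n hn
  have h1 : ∑ i ∈ s, AddMonoidAlgebra.single i (v i) = 0 := by
    rw [← map_zero (coact f), ← h, map_sum]
    exact Finset.sum_congr rfl fun i hi => (coact_of_mem f (hv i hi)).symm
  have h2 := congrArg (fun p : AddMonoidAlgebra (GWA f) ℤ => p.coeff n) h1
  rw [AddMonoidAlgebra.coeff_sum, Finsupp.finsetSum_apply] at h2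
  simp only [AddMonoidAlgebra.coeff_single, Finsupp.single_apply, AddMonoidAlgebra.coeff_zero,
    Finset.sum_ite_eq', hn, if_true] at h2
  exact h2

theorem piece_iSup : ⨆ n, piece f n = ⊤ := by
  have hmul : (⨆ n, piece f n) * (⨆ n, piece f n) ≤ ⨆ n, piece f n := by
    simp only [Submodule.iSup_mul, Submodule.mul_iSup]
    refine iSup_le fun i => iSup_le fun j => ?_
    rw [Submodule.mul_le]
    exact fun a ha b hb => Submodule.mem_iSup_of_mem _ (mul_mem f ha hb)
  rw [eq_top_iff]
  intro a _
  obtain ⟨p, rfl⟩ := RingQuot.mkAlgHom_surjective k (GWARel f) a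
  induction p using FreeAlgebra.induction with
  | grade0 c =>
    rw [AlgHom.commutes, Algebra.algebraMap_eq_smul_one]
    exact Submodule.smul_mem _ _ (Submodule.mem_iSup_of_mem 0 (one_mem f))
  | grade1 g => exact Submodule.mem_iSup_of_mem g.deg (gen_mem f g)
  | mul p q hp hq =>
    rw [map_mul]
    exact hmul (Submodule.mul_mem_mul (hp trivial) (hq trivial))
  | add p q hp hq =>
    rw [map_add]
    exact Submodule.add_mem _ (hp trivial) (hq trivial)

/-- `A(f)` as a graded right module over itself. -/
abbrev self : GrMod k (piece f) where
  carrier := GWA f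
  piece := piece f
  indep := piece_indep f
  iSup_eq_top := piece_iSup f
  smul_mem := fun hm hr => mul_mem f hm hr

theorem smul_mem_of_isHomogeneous (M : GrMod k (piece f)) (N : Submodule (GWA f)ᵐᵒᵖ M.carrier)
    (r : GWA f) {a : M.carrier} (ha : a ∈ ⨆ γ, (N.restrictScalars k ⊓ M.piece γ)) :
    MulOpposite.op r • a ∈ ⨆ γ, (N.restrictScalars k ⊓ M.piece γ) := by
  classical
  have key : ∀ (s : Finset ℤ) (v : ℤ → GWA f), (∀ δ, v δ ∈ piece f δ) →
      MulOpposite.op (∑ δ ∈ s, v δ) • a ∈ ⨆ γ, (N.restrictScalars k ⊓ M.piece γ) := by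
    intro s v hv
    induction s using Finset.induction_on with
    | empty =>
      rw [Finset.sum_empty, MulOpposite.op_zero, zero_smul]
      exact Submodule.zero_mem _
    | insert δ s hδ ih =>
      rw [Finset.sum_insert hδ, MulOpposite.op_add, add_smul]
      refine Submodule.add_mem _ ?_ ih
      obtain ⟨t, ht, hs⟩ := (Submodule.mem_iSup_iff_exists_finsupp _ _).1 ha
      rw [← hs, Finsupp.sum, Finset.smul_sum]
      exact Submodule.sum_mem _ fun γ _ => Submodule.mem_iSup_of_mem (γ + δ)
        ⟨Submodule.smul_mem _ _ (ht γ).1, M.smul_mem (ht γ).2 (hv δ)⟩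
  obtain ⟨s, v, hv, hr⟩ := (self f).exists_sum r
  have := key s v hv
  rwa [show (∑ δ ∈ s, v δ : GWA f) = r from hr] at this

/-- Submodules generated by homogeneous elements are homogeneous. -/
theorem isHomogeneous_span (M : GrMod k (piece f)) {S : Set M.carrier}
    (hS : ∀ s ∈ S, ∃ n, s ∈ M.piece n) :
    M.IsHomogeneous (Submodule.span (GWA f)ᵐᵒᵖ S) := by
  intro m hm
  change m ∈ Submodule.span (GWA f)ᵐᵒᵖ S at hm
  induction hm using Submodule.span_induction with
  | mem s hs =>
    obtain ⟨n, hn⟩ := hS s hs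
    exact Submodule.mem_iSup_of_mem n ⟨Submodule.subset_span hs, hn⟩
  | zero => exact Submodule.zero_mem _
  | add a b _ _ ha hb => exact Submodule.add_mem _ ha hb
  | smul r a _ ha => exact smul_mem_of_isHomogeneous f M _ (MulOpposite.unop r) ha

/-! ### Commutation rules and the piece of degree zero -/

theorem gen_z_eq : gen f .z = poly f X := (aeval_X _).symm

theorem x_mul_poly (p : k[X]) : gen f .x * poly f p = poly f (p.comp (X + 1)) * gen f .x := by
  induction p using Polynomial.induction_on' with
  | add p q hp hq => rw [map_add, mul_add, hp, hq, add_comp, map_add, add_mul]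
  | monomial n c =>
    rw [← C_mul_X_pow_eq_monomial]
    simp only [poly, map_mul, map_pow, aeval_C, aeval_X, mul_comp, C_comp, pow_comp, X_comp,
      map_add, map_one, ← mul_assoc, ← Algebra.commutes c (gen f .x)]
    rw [mul_assoc, mul_assoc]
    congr 1
    exact (show SemiconjBy (gen f .x) (gen f .z) (gen f .z + 1) from x_mul_z f).pow_right n

theorem y_mul_poly (p : k[X]) : gen f .y * poly f p = poly f (p.comp (X - 1)) * gen f .y := by
  induction p using Polynomial.induction_on' with
  | add p q hp hq => rw [map_add, mul_add, hp, hq, add_comp, map_add, add_mul]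
  | monomial n c =>
    rw [← C_mul_X_pow_eq_monomial]
    simp only [poly, map_mul, map_pow, aeval_C, aeval_X, mul_comp, C_comp, pow_comp, X_comp,
      map_sub, map_one, ← mul_assoc, ← Algebra.commutes c (gen f .y)]
    rw [mul_assoc, mul_assoc]
    congr 1
    exact (show SemiconjBy (gen f .y) (gen f .z) (gen f .z - 1) from y_mul_z f).pow_right n

theorem y_mul_x' : gen f .y * gen f .x = poly f (f.comp (X - 1)) := by
  rw [y_mul_x, poly, aeval_comp]; simp

theorem word_form (l : List GWAGen) : ∃ (p : k[X]) (n : ℕ),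
    ((l.map GWAGen.deg).sum = n ∧ (l.map (gen f)).prod = poly f p * gen f .x ^ n) ∨
    ((l.map GWAGen.deg).sum = -n ∧ (l.map (gen f)).prod = poly f p * gen f .y ^ n) := by
  induction l with
  | nil => exact ⟨1, 0, Or.inl (by simp)⟩
  | cons g l ih =>
    simp only [List.map_cons, List.sum_cons, List.prod_cons]
    obtain ⟨p, n, ⟨hd, hp⟩ | ⟨hd, hp⟩⟩ := ih <;> rw [hd, hp] <;> cases g
    · exact ⟨_, n + 1, Or.inl ⟨by simp [GWAGen.deg, add_comm], by
        rw [← mul_assoc, x_mul_poly, mul_assoc, ← pow_succ']⟩⟩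
    · cases n with
      | zero => exact ⟨_, 1, Or.inr ⟨by simp [GWAGen.deg], by
          rw [← mul_assoc, y_mul_poly, pow_zero, mul_one, pow_one]⟩⟩
      | succ n => exact ⟨p.comp (X - 1) * f.comp (X - 1), n, Or.inl ⟨by simp [GWAGen.deg], by
          rw [← mul_assoc, y_mul_poly, mul_assoc, pow_succ', ← mul_assoc (gen f .y), y_mul_x',
            map_mul, mul_assoc]⟩⟩
    · exact ⟨X * p, n, Or.inl ⟨by simp [GWAGen.deg], by
        rw [← mul_assoc, gen_z_eq, ← map_mul]⟩⟩
    · cases n with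
      | zero => exact ⟨_, 1, Or.inl ⟨by simp [GWAGen.deg], by
          rw [← mul_assoc, x_mul_poly, pow_zero, mul_one, pow_one]⟩⟩
      | succ n => exact ⟨p.comp (X + 1) * f, n, Or.inr ⟨by simp [GWAGen.deg], by
          rw [← mul_assoc, x_mul_poly, mul_assoc, pow_succ', ← mul_assoc (gen f .x), x_mul_y,
            map_mul, mul_assoc, poly]⟩⟩
    · exact ⟨_, n + 1, Or.inr ⟨by simp [GWAGen.deg], by
        rw [← mul_assoc, y_mul_poly, mul_assoc, ← pow_succ']⟩⟩
    · exact ⟨X * p, n, Or.inr ⟨by simp [GWAGen.deg], by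
        rw [← mul_assoc, gen_z_eq, ← map_mul]⟩⟩

/-- The piece of degree `0` is `k[z]`. -/
theorem exists_poly_of_mem {a : GWA f} (ha : a ∈ piece f 0) : ∃ p, a = poly f p := by
  suffices piece f 0 ≤ LinearMap.range (poly f).toLinearMap by
    obtain ⟨p, hp⟩ := this ha
    exact ⟨p, hp.symm⟩
  rw [piece, Submodule.span_le]
  rintro _ ⟨l, hl, rfl⟩
  obtain ⟨p, n, ⟨hd, hp⟩ | ⟨hd, hp⟩⟩ := word_form f l
  · have : n = 0 := by omega
    subst this
    exact ⟨p, by simp [hp]⟩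
  · have : n = 0 := by omega
    subst this
    exact ⟨p, by simp [hp]⟩

theorem mul_z_of_mem {d : ℤ} {a : GWA f} (ha : a ∈ piece f d) :
    a * gen f .z = (gen f .z + d) * a := by
  induction ha using Submodule.span_induction with
  | mem a h =>
    obtain ⟨l, rfl, rfl⟩ := h
    induction l with
    | nil => simp
    | cons g l ih =>
      simp only [List.map_cons, List.sum_cons, List.prod_cons]
      rw [mul_assoc, ih]
      generalize (l.map GWAGen.deg).sum = e
      rw [← mul_assoc, ← mul_assoc]
      congr 1
      rw [mul_add, (Int.cast_commute e (gen f g)).symm.eq]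
      cases g
      · rw [x_mul_z]; simp [GWAGen.deg]; noncomm_ring
      · rw [y_mul_z]; simp [GWAGen.deg]; noncomm_ring
      · simp [GWAGen.deg]; noncomm_ring
  | zero => simp
  | add a b ha hb iha ihb => rw [add_mul, iha, ihb, mul_add]
  | smul c a ha ih => rw [smul_mul_assoc, ih, mul_smul_comm]

/-! ### A family of representations -/

section Rep

variable (u v : ℤ → k) (t : k)

/-- Three operators on functions `ℤ → k`, written so that they define a right action. -/
def repGen : GWAGen → (Module.End k (ℤ → k))ᵐᵒᵖ
  | .x => MulOpposite.op
      { toFun := fun F j => u (j - 1) * F (j - 1)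
        map_add' := fun _ _ => by ext; simp [mul_add]
        map_smul' := fun _ _ => by ext; simp [mul_left_comm] }
  | .y => MulOpposite.op
      { toFun := fun F j => v (j + 1) * F (j + 1)
        map_add' := fun _ _ => by ext; simp [mul_add]
        map_smul' := fun _ _ => by ext; simp [mul_left_comm] }
  | .z => MulOpposite.op
      { toFun := fun F j => (t + j) * F j
        map_add' := fun _ _ => by ext; simp [mul_add]
        map_smul' := fun _ _ => by ext; simp [mul_left_comm] }

theorem aeval_diag (e : ℤ → k) (D : (Module.End k (ℤ → k))ᵐᵒᵖ)
    (hD : ∀ F j, MulOpposite.unop D F j = e j * F j) (p : k[X]) (F : ℤ → k) (j : ℤ) :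
    MulOpposite.unop (aeval D p) F j = p.eval (e j) * F j := by
  induction p using Polynomial.induction_on generalizing F with
  | C c => simp [MulOpposite.algebraMap_apply]
  | add p q hp hq => simp [hp, hq, add_mul]
  | monomial n c h =>
    rw [pow_succ, ← mul_assoc, map_mul, aeval_X, MulOpposite.unop_mul, Module.End.mul_apply, hD, h]
    simp; ring

/-- A right action of `A(f)` on functions `ℤ → k`. -/
noncomputable def rep (h : ∀ j, u j * v (j + 1) = f.eval (t + j)) :
    GWA f →ₐ[k] (Module.End k (ℤ → k))ᵐᵒᵖ :=
  lift f (repGen u v t)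
    (by
      apply MulOpposite.unop_injective; ext F j
      simp [repGen]; ring)
    (by
      apply MulOpposite.unop_injective; ext F j
      simp [repGen]; ring)
    (by
      apply MulOpposite.unop_injective
      refine LinearMap.ext fun F => funext fun j => ?_
      rw [aeval_diag (fun j => t + j) _ (fun _ _ => rfl), ← h]
      simp [repGen]; ring)
    (by
      apply MulOpposite.unop_injective
      refine LinearMap.ext fun F => funext fun j => ?_
      rw [aeval_diag (fun j => t + (j - 1 : ℤ)) _ (fun _ _ => by simp [repGen]; ring), ← h]
      simp [repGen]; ring)

end Rep

end GWA

end GWA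

/-! ### The simple modules and the involutions -/

section Involutions

open GWA GrMod

variable {k : Type u} [Field k] (f : k[X])

/-- The graded module `X_c⟨n⟩`, where `X_c = A / (x, z + c)A`. -/
def simpleX (c : k) (n : ℤ) : GrMod k (GWA.piece f) :=
  ((self f).quot (Submodule.span (GWA f)ᵐᵒᵖ
    ({gen f .x, gen f .z + algebraMap k (GWA f) c} : Set (GWA f)))
    (isHomogeneous_span f (self f) (by
      rintro s (rfl | rfl)
      · exact ⟨1, gen_mem f .x⟩
      · exact ⟨0, (piece f 0).add_mem (gen_mem f .z) (SetLike.algebraMap_mem_graded _ c)⟩))).shift n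

/-- The graded module `Y_c⟨n⟩`, where `Y_c = (A / (y, z + c - 1)A)⟨1⟩`. -/
def simpleY (c : k) (n : ℤ) : GrMod k (GWA.piece f) :=
  (((self f).quot (Submodule.span (GWA f)ᵐᵒᵖ
    ({gen f .y, gen f .z + algebraMap k (GWA f) c - 1} : Set (GWA f)))
    (isHomogeneous_span f (self f) (by
      rintro s (rfl | rfl)
      · exact ⟨-1, gen_mem f .y⟩
      · exact ⟨0, (piece f 0).sub_mem ((piece f 0).add_mem (gen_mem f .z)
          (SetLike.algebraMap_mem_graded _ c)) (GWA.one_mem f)⟩))).shift 1).shift n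

/-- The involution at `X_c⟨n⟩`, `Y_c⟨n⟩`, as the subfunctor of the identity that sends `P` to the
common kernel of all graded homomorphisms from `P` to `X_c⟨n⟩` or to `Y_c⟨n⟩`. A rank one
projective `P` surjects onto exactly one of these two simple modules (for `f = z(z + m)` with `m`
not an integer and `c` equal to `0` or `m`), and then this is the kernel of the surjection, which is
unique up to scalars. Only the values at such `P`, among them `A` and its images under composites
of these functors, enter the ring `D` below. -/
def invol (c : k) (n : ℤ) : GrMod k (GWA.piece f) ⥤ GrMod k (GWA.piece f) :=
  reject {simpleX f c n, simpleY f c n}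

/-- The inclusion of the involution into the identity functor. -/
def involIncl (c : k) (n : ℤ) : invol f c n ⟶ 𝟭 (GrMod k (GWA.piece f)) :=
  rejectIncl {simpleX f c n, simpleY f c n}

/-- The composite of the involutions in a list of pairs `(c, n)`. -/
def involList : List (k × ℤ) → (GrMod k (GWA.piece f) ⥤ GrMod k (GWA.piece f))
  | [] => 𝟭 _
  | s :: l => involList l ⋙ invol f s.1 s.2

/-- The inclusion of a composite of involutions into the identity functor. -/
def involListIncl : (l : List (k × ℤ)) → (involList f l ⟶ 𝟭 (GrMod k (GWA.piece f)))
  | [] => 𝟙 _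
  | s :: l => Functor.whiskerLeft (involList f l) (involIncl f s.1 s.2) ≫ involListIncl l

theorem involIncl_injective (c : k) (n : ℤ) (M : GrMod k (GWA.piece f)) :
    Function.Injective (Hom.lin ((involIncl f c n).app M)) :=
  Subtype.val_injective

theorem involListIncl_cons (s : k × ℤ) (l : List (k × ℤ)) (M : GrMod k (GWA.piece f))
    (m : ((involList f (s :: l)).obj M).carrier) :
    Hom.lin ((involListIncl f (s :: l)).app M) m = Hom.lin ((involListIncl f l).app M)
      (Hom.lin ((involIncl f s.1 s.2).app ((involList f l).obj M)) m) := rfl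

theorem involListIncl_injective (l : List (k × ℤ)) (M : GrMod k (GWA.piece f)) :
    Function.Injective (Hom.lin ((involListIncl f l).app M)) := by
  induction l with
  | nil => exact fun _ _ h => h
  | cons s l ih => exact ih.comp (involIncl_injective f s.1 s.2 _)

theorem involListIncl_naturality (l : List (k × ℤ)) {M N : GrMod k (GWA.piece f)} (φ : M ⟶ N)
    (m : ((involList f l).obj M).carrier) :
    Hom.lin ((involListIncl f l).app N) (Hom.lin ((involList f l).map φ) m) =
      Hom.lin φ (Hom.lin ((involListIncl f l).app M) m) :=
  congrArg (fun ψ => Hom.lin ψ m) ((involListIncl f l).naturality φ)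

theorem involListIncl_mem (l : List (k × ℤ)) (M : GrMod k (GWA.piece f)) (γ : ℤ)
    (m : ((involList f l).obj M).carrier) :
    m ∈ ((involList f l).obj M).piece γ ↔ Hom.lin ((involListIncl f l).app M) m ∈ M.piece γ := by
  induction l with
  | nil => exact Iff.rfl
  | cons s l ih => exact ih _

theorem involListIncl_factors (l : List (k × ℤ)) (M : GrMod k (GWA.piece f)) {s : k × ℤ}
    (hs : s ∈ l) (m : ((involList f l).obj M).carrier) :
    Hom.lin ((involListIncl f l).app M) m ∈
      rejectSubmodule {simpleX f s.1 s.2, simpleY f s.1 s.2} M := by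
  induction l with
  | nil => simp at hs
  | cons t l ih =>
    rw [involListIncl_cons]
    rcases List.mem_cons.1 hs with rfl | hs
    · exact mem_rejectSubmodule.2 fun T hT φ =>
        mem_rejectSubmodule.1 (Subtype.property (p := fun x => x ∈ rejectSubmodule _ _) m) T hT
          ((involListIncl f l).app M ≫ φ)
    · exact ih hs _

theorem mul_poly_linear {a : GWA f} {e : ℤ} (ha : a ∈ GWA.piece f e) (c : k) (n : ℤ) :
    a * poly f (X + C (n + c)) = (gen f .z + algebraMap k (GWA f) c + ((e + n : ℤ) : GWA f)) * a := by
  have h := mul_z_of_mem f ha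
  have h1 := Algebra.commutes c a
  have h2 := (Int.cast_commute n a).eq
  simp only [poly, map_add, aeval_X, aeval_C, mul_add, add_mul, h, map_intCast, ← h1, ← h2,
    Int.cast_add]
  abel

/-- Multiplication by `z + c + n` maps the degree zero part into the subfunctor. -/
theorem smul_mem_reject (c : k) (n : ℤ) (M : GrMod k (GWA.piece f)) {m : M.carrier}
    (hm : m ∈ M.piece 0) : MulOpposite.op (poly f (X + C (n + c))) • m ∈
      rejectSubmodule {simpleX f c n, simpleY f c n} M := by
  refine mem_rejectSubmodule.2 ?_
  rintro T (rfl | rfl) φ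
  · obtain ⟨a, ha, hφ⟩ := Hom.lin_mem φ hm
    rw [map_smul, ← hφ]
    refine (Submodule.Quotient.mk_eq_zero _).2 ?_
    change (a : GWA f) * poly f (X + C (n + c)) ∈ Submodule.span (GWA f)ᵐᵒᵖ _
    have : (a : GWA f) * poly f (X + C (n + c)) =
        (gen f .z + algebraMap k (GWA f) c) * a := by
      rw [mul_poly_linear f ha]; simp
    rw [this]
    exact Submodule.smul_mem _ (MulOpposite.op (a : GWA f)) (Submodule.subset_span (by simp))
  · obtain ⟨a, ha, hφ⟩ := Hom.lin_mem φ hm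
    rw [map_smul, ← hφ]
    refine (Submodule.Quotient.mk_eq_zero _).2 ?_
    change (a : GWA f) * poly f (X + C (n + c)) ∈ Submodule.span (GWA f)ᵐᵒᵖ _
    have : (a : GWA f) * poly f (X + C (n + c)) =
        (gen f .z + algebraMap k (GWA f) c - 1) * a := by
      rw [mul_poly_linear f ha, show (0 - n - 1 + n : ℤ) = -1 by ring]; simp [sub_eq_add_neg]
    rw [this]
    exact Submodule.smul_mem _ (MulOpposite.op (a : GWA f)) (Submodule.subset_span (by simp))

theorem exists_involListIncl (l : List (k × ℤ)) (M : GrMod k (GWA.piece f)) {m : M.carrier}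
    (hm : m ∈ M.piece 0) : ∃ m' : ((involList f l).obj M).carrier,
      Hom.lin ((involListIncl f l).app M) m' =
        MulOpposite.op (poly f (l.map fun s => X + C ((s.2 : k) + s.1)).prod) • m := by
  induction l with
  | nil => exact ⟨m, by
    rw [List.map_nil, List.prod_nil, map_one, MulOpposite.op_one, one_smul]; rfl⟩
  | cons s l ih =>
    obtain ⟨m', hm'⟩ := ih
    have h0 : m' ∈ ((involList f l).obj M).piece 0 := by
      rw [involListIncl_mem, hm']
      simpa using M.smul_mem hm (poly_mem f _)
    refine ⟨⟨_, smul_mem_reject f s.1 s.2 _ h0⟩, ?_⟩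
    change Hom.lin ((involListIncl f l).app M)
      (MulOpposite.op (poly f (X + C ((s.2 : k) + s.1))) • m') = _
    rw [map_smul, hm', smul_smul, ← MulOpposite.op_mul, ← map_mul, List.map_cons, List.prod_cons,
      mul_comm]

/-- The graded homomorphism `A → M` that sends `1` to a given element of degree zero. -/
def homOf (M : GrMod k (GWA.piece f)) (m : M.carrier) (hm : m ∈ M.piece 0) : self f ⟶ M :=
  Hom.mk
    { toFun := fun a => MulOpposite.op (a : GWA f) • m
      map_add' := fun a b => by rw [← add_smul]; rfl
      map_smul' := fun r a => by rw [RingHom.id_apply, smul_smul]; rfl }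
    (fun γ a ha => by
      have := M.smul_mem hm ha
      rwa [zero_add] at this)

theorem lin_eq_smul {M : GrMod k (GWA.piece f)} (φ : self f ⟶ M) (a : GWA f) :
    Hom.lin φ a = MulOpposite.op a • Hom.lin φ (1 : GWA f) := by
  have h := map_smul (Hom.lin φ) (MulOpposite.op a) (1 : GWA f)
  rw [← h]
  congr 1
  exact (one_mul a).symm

theorem rep_span {u v : ℤ → k} {t : k} (h : ∀ j, u j * v (j + 1) = f.eval (t + j)) (F : ℤ → k)
    {S : Set (GWA f)} (hS : ∀ s ∈ S, MulOpposite.unop (rep f u v t h s) F = 0) {a : GWA f}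
    (ha : a ∈ Submodule.span (GWA f)ᵐᵒᵖ S) : MulOpposite.unop (rep f u v t h a) F = 0 := by
  induction ha using Submodule.span_induction with
  | mem s hs => exact hS s hs
  | zero => simp
  | add a b _ _ ha hb => rw [map_add, MulOpposite.unop_add, LinearMap.add_apply, ha, hb, add_zero]
  | smul r a _ ha =>
    change MulOpposite.unop (rep f u v t h (a * MulOpposite.unop r)) F = 0
    rw [map_mul, MulOpposite.unop_mul, Module.End.mul_apply, ha, map_zero]

theorem rep_poly {u v : ℤ → k} {t : k} (h : ∀ j, u j * v (j + 1) = f.eval (t + j)) (F : ℤ → k)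
    (p : k[X]) (j : ℤ) :
    MulOpposite.unop (rep f u v t h (poly f p)) F j = p.eval (t + j) * F j := by
  rw [poly, ← aeval_algHom_apply]
  exact aeval_diag (fun j => t + j) _ (fun F j => by rw [rep, lift_gen]; rfl) p F j

theorem eval_eq_zero_of_mem_X {c : k} (hc : f.eval (-c) = 0) (n : ℕ) (p : k[X])
    (hp : gen f .y ^ n * poly f p ∈ Submodule.span (GWA f)ᵐᵒᵖ
      ({gen f .x, gen f .z + algebraMap k (GWA f) c} : Set (GWA f))) :
    p.eval (-(n + c)) = 0 := by
  have h : ∀ j : ℤ, (fun j : ℤ => f.eval (-c + j)) j * (fun _ : ℤ => (1 : k)) (j + 1) =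
      f.eval (-c + j) := by simp
  have h0 := rep_span f (u := fun j => f.eval (-c + j)) (v := fun _ => 1) (t := -c) h
    (Pi.single 0 1) (by
    rintro s (rfl | rfl)
    · ext j
      rw [rep, lift_gen]
      by_cases hj : j = 1
      · subst hj; simp [repGen, hc]
      · have : j - 1 ≠ 0 := by omega
        simp [repGen, this]
    · ext j
      rw [map_add, rep, lift_gen, AlgHom.commutes]
      by_cases hj : j = 0
      · subst hj; simp [repGen, MulOpposite.algebraMap_apply]
      · simp [repGen, MulOpposite.algebraMap_apply, Pi.single_apply, hj]) hp
  have hy : ∀ (n : ℕ) (F : ℤ → k) (j : ℤ),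
      MulOpposite.unop (rep f (fun j => f.eval (-c + j)) (fun _ => 1) (-c) h (gen f .y ^ n)) F j = F (j + n) := by
    intro n
    induction n with
    | zero => simp
    | succ n ih =>
      intro F j
      rw [pow_succ', map_mul, MulOpposite.unop_mul, Module.End.mul_apply, ih, rep, lift_gen]
      simp [repGen, add_assoc]
  have h1 := congrFun h0 (-n)
  rw [map_mul, MulOpposite.unop_mul, Module.End.mul_apply, rep_poly, hy] at h1
  simpa [add_comm] using h1

theorem eval_eq_zero_of_mem_Y {c : k} (hc : f.eval (-c) = 0) (n : ℕ) (p : k[X])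
    (hp : gen f .x ^ n * poly f p ∈ Submodule.span (GWA f)ᵐᵒᵖ
      ({gen f .y, gen f .z + algebraMap k (GWA f) c - 1} : Set (GWA f))) :
    p.eval (-c + (n + 1)) = 0 := by
  have h : ∀ j : ℤ, (fun _ : ℤ => (1 : k)) j * (fun j : ℤ => f.eval (-c + (j - 1 : ℤ))) (j + 1) =
      f.eval (-c + j) := by simp
  have h0 := rep_span f (u := fun _ => 1) (v := fun j => f.eval (-c + (j - 1 : ℤ))) (t := -c) h
    (Pi.single 1 1) (by
    rintro s (rfl | rfl)
    · ext j
      rw [rep, lift_gen]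
      by_cases hj : j = 0
      · subst hj; simp [repGen, hc]
      · simp [repGen, hj]
    · ext j
      rw [map_sub, map_add, rep, lift_gen, AlgHom.commutes, map_one]
      by_cases hj : j = 1
      · subst hj; simp [repGen, MulOpposite.algebraMap_apply]
      · simp [repGen, MulOpposite.algebraMap_apply, Pi.single_apply, hj]) hp
  have hx : ∀ (n : ℕ) (F : ℤ → k) (j : ℤ),
      MulOpposite.unop (rep f (fun _ => 1) (fun j => f.eval (-c + (j - 1 : ℤ))) (-c) h
        (gen f .x ^ n)) F j = F (j - n) := by
    intro n
    induction n with
    | zero => simp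
    | succ n ih =>
      intro F j
      rw [pow_succ', map_mul, MulOpposite.unop_mul, Module.End.mul_apply, ih, rep, lift_gen]
      simp [repGen, sub_sub]
  have h1 := congrFun h0 (n + 1)
  rw [map_mul, MulOpposite.unop_mul, Module.End.mul_apply, rep_poly, hx] at h1
  simpa [add_comm] using h1

theorem pow_gen_mem (g : GWAGen) (n : ℕ) : gen f g ^ n ∈ GWA.piece f (n * g.deg) := by
  simpa using word_mem f (List.replicate n g)

theorem eval_eq_zero_of_mem_reject {c : k} (hc : f.eval (-c) = 0) (n : ℤ) (p : k[X])
    (hp : poly f p ∈ rejectSubmodule {simpleX f c n, simpleY f c n} (self f)) :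
    p.eval (-(n + c)) = 0 := by
  rcases le_or_gt 0 n with hn | hn
  · obtain ⟨i, rfl⟩ := Int.eq_ofNat_of_zero_le hn
    have h := mem_rejectSubmodule.1 hp (simpleX f c i) (by simp)
      (homOf f (simpleX f c i) (Submodule.Quotient.mk (gen f .y ^ i)) ⟨gen f .y ^ i, by
        have := pow_gen_mem f .y i
        rw [show (0 : ℤ) - i = i * GWAGen.y.deg by simp [GWAGen.deg]]
        exact this, rfl⟩)
    have h' := (Submodule.Quotient.mk_eq_zero _).1
      (show Submodule.Quotient.mk (gen f .y ^ i * poly f p) = _ from h)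
    simpa using eval_eq_zero_of_mem_X f hc i p h'
  · obtain ⟨i, hi⟩ := Int.eq_ofNat_of_zero_le (show 0 ≤ -n - 1 by omega)
    have h := mem_rejectSubmodule.1 hp (simpleY f c n) (by simp)
      (homOf f (simpleY f c n) (Submodule.Quotient.mk (gen f .x ^ i)) ⟨gen f .x ^ i, by
        have := pow_gen_mem f .x i
        rw [show (0 : ℤ) - n - 1 = i * GWAGen.x.deg by simp [GWAGen.deg]; omega]
        exact this, rfl⟩)
    have h' := (Submodule.Quotient.mk_eq_zero _).1
      (show Submodule.Quotient.mk (gen f .x ^ i * poly f p) = _ from h)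
    have h2 := eval_eq_zero_of_mem_Y f hc i p h'
    have hi' : (i : k) + 1 = -n := by
      have : (i : ℤ) + 1 = -n := by omega
      exact_mod_cast congrArg (Int.cast : ℤ → k) this
    rw [hi'] at h2
    rw [← h2]; congr 1; ring

theorem poly_injective [CharZero k] : Function.Injective (poly f) := by
  rw [injective_iff_map_eq_zero]
  intro p hp
  have h : ∀ j : ℤ, (fun _ : ℤ => (1 : k)) j * (fun j : ℤ => f.eval ((0 : k) + (j - 1 : ℤ))) (j + 1) =
      f.eval (0 + (j : k)) := by simp
  refine Polynomial.eq_zero_of_infinite_isRoot p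
    ((Set.infinite_range_of_injective (Int.cast_injective (α := k))).mono ?_)
  rintro _ ⟨j, rfl⟩
  have h1 := rep_poly f (u := fun _ => 1) (v := fun j => f.eval ((0 : k) + (j - 1 : ℤ))) (t := 0) h
    (fun _ => 1) p j
  rw [hp, map_zero] at h1
  simpa using h1.symm

end Involutions

/-! ### The ring `D` -/

/-- The group `ℤ_fin` of finite subsets of `ℤ` with symmetric difference as addition. -/
abbrev ZFin : Type := AsBoolRing (Finset ℤ)

instance ZFin.decidableEq : DecidableEq ZFin := inferInstanceAs (DecidableEq (Finset ℤ))

/-- The finite set of integers underlying an element of `ℤ_fin`. -/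
def ZFin.toFinset (J : ZFin) : Finset ℤ := ofBoolRing J

/-- Componentwise intersection on `ℤ_fin × ℤ_fin`. -/
def ZFin.inter (γ δ : ZFin × ZFin) : ZFin × ZFin :=
  (toBoolRing (γ.1.toFinset ∩ δ.1.toFinset), toBoolRing (γ.2.toFinset ∩ δ.2.toFinset))

section RingD

open GWA GrMod

variable {k : Type u} [Field k] (m : k)

/-- The quadratic polynomial `z(z + m)`. -/
noncomputable def quad : k[X] := X * (X + C m)

/-- The pairs `(0, j)` for `j ∈ J` and `(m, j)` for `j ∈ J'`, where `γ = (J, J')`. -/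
def iotaIndices (γ : ZFin × ZFin) : List (k × ℤ) :=
  γ.1.toFinset.sort.map (fun j => (0, j)) ++ γ.2.toFinset.sort.map (fun j => (m, j))

/-- The composite `ι_(J,J')`, in increasing order of `j`, of the involutions at `X_0⟨j⟩`, `Y_0⟨j⟩` for `j ∈ J` and of those at
`X_m⟨j⟩`, `Y_m⟨j⟩` for `j ∈ J'`. -/
noncomputable def iota (γ : ZFin × ZFin) :
    GrMod k (GWA.piece (quad m)) ⥤ GrMod k (GWA.piece (quad m)) :=
  involList (quad m) (iotaIndices m γ)

/-- The inclusion of `ι_(J,J')` into the identity functor. -/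
noncomputable def iotaIncl (γ : ZFin × ZFin) : iota m γ ⟶ 𝟭 (GrMod k (GWA.piece (quad m))) :=
  involListIncl (quad m) (iotaIndices m γ)

/-- The polynomial `h_(J,J') = ∏_{j ∈ J} (z + j) ∏_{j ∈ J'} (z + j + m)`. -/
noncomputable def hPoly (γ : ZFin × ZFin) : k[X] :=
  (∏ j ∈ γ.1.toFinset, (X + C (j : k))) * ∏ j ∈ γ.2.toFinset, (X + C ((j : k) + m))

/-- The component `D_γ = Hom_{gr A}(A, ι_γ A)`. -/
abbrev DPiece (_hm : m ∉ Set.range (Int.cast : ℤ → k)) (γ : ZFin × ZFin) : Type u :=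
  self (quad m) ⟶ (iota m γ).obj (self (quad m))

/-- The map `A → A` underlying a graded endomorphism of the right module `A`. -/
noncomputable def endApply (φ : self (quad m) ⟶ self (quad m)) (a : GWA (quad m)) : GWA (quad m) :=
  Hom.lin φ a

/-- `χ = Θ ∘ ι_δ(φ) ∘ ψ`, where `Θ : ι_δ ι_γ A → ι_{γ + δ} A` is left multiplication by
`h_{γ ∩ δ}⁻¹`; all three modules are regarded as submodules of `A`. -/
def IsDMul {γ δ : ZFin × ZFin} (φ : self (quad m) ⟶ (iota m γ).obj (self (quad m)))
    (ψ : self (quad m) ⟶ (iota m δ).obj (self (quad m)))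
    (χ : self (quad m) ⟶ (iota m (γ + δ)).obj (self (quad m))) : Prop :=
  ∀ a : GWA (quad m),
    poly (quad m) (hPoly m (ZFin.inter γ δ)) *
      endApply m (χ ≫ (iotaIncl m (γ + δ)).app (self (quad m))) a =
    endApply m (ψ ≫ (iota m δ).map φ ≫ (iotaIncl m δ).app ((iota m γ).obj (self (quad m))) ≫
      (iotaIncl m γ).app (self (quad m))) a

/-- The element of `A` that describes a homomorphism `A → ι_γ A ⊆ A`. -/
noncomputable def ev {γ : ZFin × ZFin} (φ : self (quad m) ⟶ (iota m γ).obj (self (quad m))) :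
    GWA (quad m) :=
  endApply m (φ ≫ (iotaIncl m γ).app (self (quad m))) 1

theorem lin_incl {γ : ZFin × ZFin} (φ : self (quad m) ⟶ (iota m γ).obj (self (quad m)))
    (a : GWA (quad m)) :
    endApply m (φ ≫ (iotaIncl m γ).app (self (quad m))) a = ev m φ * a :=
  lin_eq_smul (quad m) _ a

theorem isDMul_iff {γ δ : ZFin × ZFin} (φ : self (quad m) ⟶ (iota m γ).obj (self (quad m)))
    (ψ : self (quad m) ⟶ (iota m δ).obj (self (quad m)))
    (χ : self (quad m) ⟶ (iota m (γ + δ)).obj (self (quad m))) :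
    IsDMul m φ ψ χ ↔ poly (quad m) (hPoly m (ZFin.inter γ δ)) * ev m χ = ev m φ * ev m ψ := by
  have h : ψ ≫ (iota m δ).map φ ≫ (iotaIncl m δ).app ((iota m γ).obj (self (quad m))) ≫
      (iotaIncl m γ).app (self (quad m)) = (ψ ≫ (iotaIncl m δ).app (self (quad m))) ≫
        (φ ≫ (iotaIncl m γ).app (self (quad m))) := by
    rw [← Category.assoc ((iota m δ).map φ), (iotaIncl m δ).naturality]
    simp
  have h2 : ∀ a : GWA (quad m), endApply m (ψ ≫ (iota m δ).map φ ≫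
      (iotaIncl m δ).app ((iota m γ).obj (self (quad m))) ≫
      (iotaIncl m γ).app (self (quad m))) a = ev m φ * (ev m ψ * a) := by
    intro a
    rw [h, ← lin_incl m ψ a]
    exact lin_incl m φ _
  constructor
  · intro H
    have := H 1
    rw [h2, lin_incl, mul_one, mul_one] at this
    exact this
  · intro H a
    rw [h2, lin_incl, ← mul_assoc, H, mul_assoc]

theorem ev_injective {γ : ZFin × ZFin} :
    Function.Injective (ev m : (self (quad m) ⟶ (iota m γ).obj (self (quad m))) → _) := by
  intro φ ψ h
  apply hom_ext
  intro a
  apply involListIncl_injective (quad m) (iotaIndices m γ)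
  exact (lin_incl m φ a).trans ((congrArg (· * (a : GWA (quad m))) h).trans (lin_incl m ψ a).symm)

theorem prod_sort (J : Finset ℤ) (g : ℤ → k[X]) : (J.sort.map g).prod = ∏ j ∈ J, g j := by
  rw [← List.prod_toFinset _ (Finset.sort_nodup _ _), Finset.sort_toFinset]

theorem prod_iotaIndices (γ : ZFin × ZFin) :
    ((iotaIndices m γ).map fun s => X + C ((s.2 : k) + s.1)).prod = hPoly m γ := by
  rw [iotaIndices, List.map_append, List.prod_append, List.map_map, List.map_map, prod_sort,
    prod_sort]
  simp [hPoly]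

theorem exists_hom (γ : ZFin × ZFin) (p : k[X]) :
    ∃ φ : self (quad m) ⟶ (iota m γ).obj (self (quad m)),
      ev m φ = poly (quad m) (hPoly m γ * p) := by
  obtain ⟨m', hm'⟩ := exists_involListIncl (quad m) (iotaIndices m γ) (self (quad m))
    (m := poly (quad m) p) (poly_mem (quad m) p)
  have h : Hom.lin ((iotaIncl m γ).app (self (quad m))) m' =
      poly (quad m) (hPoly m γ * p) := by
    refine hm'.trans ?_
    rw [prod_iotaIndices, mul_comm, map_mul]
    rfl
  have h0 : m' ∈ ((iota m γ).obj (self (quad m))).piece 0 :=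
    (involListIncl_mem (quad m) (iotaIndices m γ) (self (quad m)) 0 m').2
      (h ▸ poly_mem (quad m) _)
  refine ⟨homOf (quad m) _ m' h0, ?_⟩
  rw [← h]
  change Hom.lin ((iotaIncl m γ).app (self (quad m))) ((1 : (GWA (quad m))ᵐᵒᵖ) • m') = _
  rw [one_smul]

variable {m}

theorem isCoprime_X_add_C {a b : k} (h : a ≠ b) : IsCoprime (X + C a) (X + C b) := by
  have := isCoprime_X_sub_C_of_isUnit_sub (a := -a) (b := -b)
    (by rw [isUnit_iff_ne_zero]; intro h'; apply h; linear_combination -h')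
  simpa using this

theorem ZFin.prod_mul_prod (g : ℤ → k[X]) (J K : ZFin) :
    (∏ j ∈ J.toFinset, g j) * ∏ j ∈ K.toFinset, g j =
      (∏ j ∈ J.toFinset ∩ K.toFinset, g j) * ((∏ j ∈ J.toFinset ∩ K.toFinset, g j) *
        ∏ j ∈ (J + K).toFinset, g j) := by
  have h1 : (∏ j ∈ J.toFinset ∩ K.toFinset, g j) * ∏ j ∈ (J + K).toFinset, g j =
      ∏ j ∈ J.toFinset ∪ K.toFinset, g j := by
    rw [← Finset.prod_union]
    · congr 1
      ext j
      change j ∈ _ ∪ symmDiff J.toFinset K.toFinset ↔ _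
      simp only [Finset.mem_union, Finset.mem_inter, Finset.mem_symmDiff]
      tauto
    · change Disjoint _ (symmDiff J.toFinset K.toFinset)
      rw [Finset.disjoint_left]
      intro j
      simp only [Finset.mem_inter, Finset.mem_symmDiff]
      tauto
  rw [h1, mul_comm (∏ j ∈ J.toFinset ∩ K.toFinset, g j), Finset.prod_union_inter]

theorem ZFin.prod_cocycle (g : ℤ → k[X]) (J K L : ZFin) :
    (∏ j ∈ J.toFinset ∩ K.toFinset, g j) * ∏ j ∈ (J + K).toFinset ∩ L.toFinset, g j =
      (∏ j ∈ K.toFinset ∩ L.toFinset, g j) * ∏ j ∈ J.toFinset ∩ (K + L).toFinset, g j := by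
  rw [← Finset.prod_union, ← Finset.prod_union]
  · congr 1
    ext j
    change j ∈ _ ∪ symmDiff J.toFinset K.toFinset ∩ _ ↔
      j ∈ _ ∪ _ ∩ symmDiff K.toFinset L.toFinset
    simp only [Finset.mem_union, Finset.mem_inter, Finset.mem_symmDiff]
    tauto
  · change Disjoint _ (_ ∩ symmDiff K.toFinset L.toFinset)
    rw [Finset.disjoint_left]
    intro j
    simp only [Finset.mem_inter, Finset.mem_symmDiff]
    tauto
  · change Disjoint _ (symmDiff J.toFinset K.toFinset ∩ _)
    rw [Finset.disjoint_left]
    intro j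
    simp only [Finset.mem_inter, Finset.mem_symmDiff]
    tauto

theorem hPoly_mul (γ δ : ZFin × ZFin) : hPoly m γ * hPoly m δ =
    hPoly m (ZFin.inter γ δ) * (hPoly m (ZFin.inter γ δ) * hPoly m (γ + δ)) := by
  have h1 := ZFin.prod_mul_prod (fun j : ℤ => (X + C (j : k))) γ.1 δ.1
  have h2 := ZFin.prod_mul_prod (fun j : ℤ => (X + C ((j : k) + m))) γ.2 δ.2
  calc hPoly m γ * hPoly m δ = _ := mul_mul_mul_comm _ _ _ _
    _ = _ := by rw [h1, h2]
    _ = _ := by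
      simp only [hPoly, ZFin.inter, Prod.fst_add, Prod.snd_add]
      change _ = ((∏ j ∈ γ.1.toFinset ∩ δ.1.toFinset, _) * ∏ j ∈ γ.2.toFinset ∩ δ.2.toFinset, _) *
        (((∏ j ∈ γ.1.toFinset ∩ δ.1.toFinset, _) * ∏ j ∈ γ.2.toFinset ∩ δ.2.toFinset, _) * _)
      ring

theorem hPoly_mul_aux (γ δ : ZFin × ZFin) (p q : k[X]) :
    hPoly m (ZFin.inter γ δ) * (hPoly m (γ + δ) * (hPoly m (ZFin.inter γ δ) * (p * q))) =
      (hPoly m γ * p) * (hPoly m δ * q) := by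
  rw [mul_mul_mul_comm, hPoly_mul]
  generalize hPoly m (ZFin.inter γ δ) = a
  generalize hPoly m (γ + δ) = b
  ring

theorem hPoly_cocycle (γ δ ε : ZFin × ZFin) :
    hPoly m (ZFin.inter γ δ) * hPoly m (ZFin.inter (γ + δ) ε) =
      hPoly m (ZFin.inter δ ε) * hPoly m (ZFin.inter γ (δ + ε)) := by
  have h1 := ZFin.prod_cocycle (fun j : ℤ => (X + C (j : k))) γ.1 δ.1 ε.1
  have h2 := ZFin.prod_cocycle (fun j : ℤ => (X + C ((j : k) + m))) γ.2 δ.2 ε.2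
  calc _ = _ := mul_mul_mul_comm _ _ _ _
    _ = _ := congrArg₂ (· * ·) h1 h2
    _ = _ := (mul_mul_mul_comm _ _ _ _).symm

theorem hPoly_ne_zero (γ : ZFin × ZFin) : hPoly m γ ≠ 0 :=
  mul_ne_zero (Finset.prod_ne_zero_iff.2 fun _ _ => X_add_C_ne_zero _)
    (Finset.prod_ne_zero_iff.2 fun _ _ => X_add_C_ne_zero _)

theorem hPoly_zero : hPoly m 0 = 1 := by
  simp only [hPoly, Prod.fst_zero, Prod.snd_zero]
  change (∏ j ∈ (∅ : Finset ℤ), _) * ∏ j ∈ (∅ : Finset ℤ), _ = _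
  simp

theorem inter_zero_left (γ : ZFin × ZFin) : ZFin.inter 0 γ = 0 :=
  Prod.ext (Finset.empty_inter _) (Finset.empty_inter _)

theorem inter_zero_right (γ : ZFin × ZFin) : ZFin.inter γ 0 = 0 :=
  Prod.ext (Finset.inter_empty _) (Finset.inter_empty _)

theorem ev_add {γ : ZFin × ZFin} (φ ψ : self (quad m) ⟶ (iota m γ).obj (self (quad m))) :
    ev m (φ + ψ) = ev m φ + ev m ψ := by
  rw [ev, Preadditive.add_comp]; rfl

theorem ev_zero {γ : ZFin × ZFin} :
    ev m (0 : self (quad m) ⟶ (iota m γ).obj (self (quad m))) = 0 := by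
  rw [ev, Limits.zero_comp]; rfl

theorem ev_smul {γ : ZFin × ZFin} (c : k)
    (φ : self (quad m) ⟶ (iota m γ).obj (self (quad m))) :
    ev m (c • φ) = c • ev m φ := by
  rw [ev, Linear.smul_comp]; rfl

theorem mk_eq (hm : m ∉ Set.range (Int.cast : ℤ → k)) {γ δ : ZFin × ZFin} {φ : DPiece m hm γ}
    {ψ : DPiece m hm δ} (h : γ = δ) (h' : ev m φ = ev m ψ) :
    (GradedMonoid.mk γ φ : GradedMonoid (DPiece m hm)) = GradedMonoid.mk δ ψ := by
  subst h
  rw [ev_injective m h']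

theorem existsUnique_one (hm : m ∉ Set.range (Int.cast : ℤ → k)) : ∃! χ : DPiece m hm 0,
    ∀ a, endApply m (χ ≫ (iotaIncl m 0).app (self (quad m))) a = a := by
  obtain ⟨χ, hχ⟩ := exists_hom m 0 1
  rw [mul_one, hPoly_zero, map_one] at hχ
  refine ⟨χ, fun a => ?_, fun χ' h' => ?_⟩
  · rw [lin_incl, hχ, one_mul]
  · apply ev_injective m
    rw [hχ]
    exact h' 1

/-- The identity element of `D`: the identity map `A → ι_{(∅,∅)} A = A`. -/
noncomputable def dOne (hm : m ∉ Set.range (Int.cast : ℤ → k)) : DPiece m hm 0 :=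
  (existsUnique_one hm).choose

theorem ev_dOne (hm : m ∉ Set.range (Int.cast : ℤ → k)) : ev m (dOne hm) = 1 :=
  (existsUnique_one hm).choose_spec.1 1

variable [CharZero k]

theorem hPoly_dvd (hm : m ∉ Set.range (Int.cast : ℤ → k)) {γ : ZFin × ZFin} {q : k[X]}
    (h1 : ∀ j ∈ γ.1.toFinset, q.eval (-(j : k)) = 0)
    (h2 : ∀ j ∈ γ.2.toFinset, q.eval (-((j : k) + m)) = 0) : hPoly m γ ∣ q := by
  have hd : ∀ a : k, q.eval (-a) = 0 → X + C a ∣ q := fun a ha => by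
    have := dvd_iff_isRoot.2 (show q.IsRoot (-a) from ha)
    simpa using this
  refine IsCoprime.mul_dvd ?_ ?_ ?_
  · refine IsCoprime.prod_left fun i _ => IsCoprime.prod_right fun j _ => isCoprime_X_add_C ?_
    intro h
    exact hm ⟨i - j, by push_cast; linear_combination h⟩
  · refine Finset.prod_dvd_of_coprime ?_ fun j hj => hd _ (h1 j hj)
    intro i _ j _ hij
    exact isCoprime_X_add_C fun h => hij (Int.cast_injective h)
  · refine Finset.prod_dvd_of_coprime ?_ fun j hj => hd _ (h2 j hj)
    intro i _ j _ hij
    exact isCoprime_X_add_C fun h => hij (Int.cast_injective (add_right_cancel h))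

theorem exists_ev (hm : m ∉ Set.range (Int.cast : ℤ → k)) {γ : ZFin × ZFin}
    (φ : self (quad m) ⟶ (iota m γ).obj (self (quad m))) :
    ∃ p, ev m φ = poly (quad m) (hPoly m γ * p) := by
  obtain ⟨q, hq⟩ := exists_poly_of_mem (quad m)
    (show ev m φ ∈ GWA.piece (quad m) 0 from
      Hom.lin_mem (φ ≫ (iotaIncl m γ).app (self (quad m))) (GWA.one_mem (quad m)))
  have hmem : ∀ s ∈ iotaIndices m γ, ev m φ ∈
      rejectSubmodule {simpleX (quad m) s.1 s.2, simpleY (quad m) s.1 s.2} (self (quad m)) :=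
    fun s hs => involListIncl_factors (quad m) _ _ hs _
  have hdvd : hPoly m γ ∣ q := by
    refine hPoly_dvd hm (fun j hj => ?_) (fun j hj => ?_)
    · have := hmem (0, j) (List.mem_append_left _ (List.mem_map.2
        ⟨j, (Finset.mem_sort _).2 hj, rfl⟩))
      rw [hq] at this
      simpa using eval_eq_zero_of_mem_reject (quad m) (by simp [quad]) j q this
    · have := hmem (m, j) (List.mem_append_right _ (List.mem_map.2
        ⟨j, (Finset.mem_sort _).2 hj, rfl⟩))
      rw [hq] at this
      exact eval_eq_zero_of_mem_reject (quad m) (by simp [quad]) j q this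
  obtain ⟨p, rfl⟩ := hdvd
  exact ⟨p, hq⟩


/-! The multiplication of `D` -/

theorem poly_mul_cancel {p : k[X]} (hp : p ≠ 0) {q r : k[X]}
    (h : poly (quad m) p * poly (quad m) q = poly (quad m) p * poly (quad m) r) :
    poly (quad m) q = poly (quad m) r := by
  rw [← map_mul, ← map_mul] at h
  rw [mul_left_cancel₀ hp (poly_injective (quad m) h)]

theorem existsUnique_isDMul (hm : m ∉ Set.range (Int.cast : ℤ → k)) {γ δ : ZFin × ZFin}
    (φ : DPiece m hm γ) (ψ : DPiece m hm δ) : ∃! χ : DPiece m hm (γ + δ), IsDMul m φ ψ χ := by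
  obtain ⟨p, hp⟩ := exists_ev hm φ
  obtain ⟨q, hq⟩ := exists_ev hm ψ
  obtain ⟨χ, hχ⟩ := exists_hom m (γ + δ) (hPoly m (ZFin.inter γ δ) * (p * q))
  have key : poly (quad m) (hPoly m (ZFin.inter γ δ)) * ev m χ = ev m φ * ev m ψ := by
    rw [hχ, hp, hq, ← map_mul, ← map_mul, hPoly_mul_aux]
  refine ⟨χ, (isDMul_iff m φ ψ χ).2 key, fun χ' h' => ev_injective m ?_⟩
  obtain ⟨r, hr⟩ := exists_ev hm χ'
  have h'' := ((isDMul_iff m φ ψ χ').1 h').trans key.symm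
  rw [hχ, hr] at h'' ⊢
  exact poly_mul_cancel (hPoly_ne_zero (ZFin.inter γ δ)) h''

/-- The product `φ · ψ = Θ ∘ ι_δ(φ) ∘ ψ` of `φ ∈ D_γ` and `ψ ∈ D_δ`. -/
noncomputable def dMul (hm : m ∉ Set.range (Int.cast : ℤ → k)) {γ δ : ZFin × ZFin}
    (φ : DPiece m hm γ) (ψ : DPiece m hm δ) : DPiece m hm (γ + δ) :=
  (existsUnique_isDMul hm φ ψ).choose

theorem dMul_spec (hm : m ∉ Set.range (Int.cast : ℤ → k)) {γ δ : ZFin × ZFin}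
    (φ : DPiece m hm γ) (ψ : DPiece m hm δ) : IsDMul m φ ψ (dMul hm φ ψ) :=
  (existsUnique_isDMul hm φ ψ).choose_spec.1

theorem dMul_unique (hm : m ∉ Set.range (Int.cast : ℤ → k)) {γ δ : ZFin × ZFin}
    {φ : DPiece m hm γ} {ψ : DPiece m hm δ} {χ : DPiece m hm (γ + δ)} (h : IsDMul m φ ψ χ) :
    dMul hm φ ψ = χ :=
  ((existsUnique_isDMul hm φ ψ).choose_spec.2 χ h).symm

theorem ev_dMul_zero_left (hm : m ∉ Set.range (Int.cast : ℤ → k)) {γ : ZFin × ZFin}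
    (φ : DPiece m hm 0) (ψ : DPiece m hm γ) : ev m (dMul hm φ ψ) = ev m φ * ev m ψ := by
  have := (isDMul_iff m _ _ _).1 (dMul_spec hm φ ψ)
  rwa [inter_zero_left, hPoly_zero, map_one, one_mul] at this

theorem ev_dMul_zero_right (hm : m ∉ Set.range (Int.cast : ℤ → k)) {γ : ZFin × ZFin}
    (φ : DPiece m hm γ) (ψ : DPiece m hm 0) : ev m (dMul hm φ ψ) = ev m φ * ev m ψ := by
  have := (isDMul_iff m _ _ _).1 (dMul_spec hm φ ψ)
  rwa [inter_zero_right, hPoly_zero, map_one, one_mul] at this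

theorem ev_dMul_assoc (hm : m ∉ Set.range (Int.cast : ℤ → k)) {γ δ ε : ZFin × ZFin}
    (φ : DPiece m hm γ) (ψ : DPiece m hm δ) (ξ : DPiece m hm ε) :
    ev m (dMul hm (dMul hm φ ψ) ξ) = ev m (dMul hm φ (dMul hm ψ ξ)) := by
  have h1 := (isDMul_iff m _ _ _).1 (dMul_spec hm φ ψ)
  have h2 := (isDMul_iff m _ _ _).1 (dMul_spec hm (dMul hm φ ψ) ξ)
  have h3 := (isDMul_iff m _ _ _).1 (dMul_spec hm ψ ξ)
  have h4 := (isDMul_iff m _ _ _).1 (dMul_spec hm φ (dMul hm ψ ξ))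
  obtain ⟨a, ha⟩ := exists_ev hm (dMul hm (dMul hm φ ψ) ξ)
  obtain ⟨b, hb⟩ := exists_ev hm (dMul hm φ (dMul hm ψ ξ))
  obtain ⟨p, hp⟩ := exists_ev hm φ
  rw [ha, hb]
  refine poly_mul_cancel (m := m) (mul_ne_zero (hPoly_ne_zero (m := m) (ZFin.inter γ δ))
    (hPoly_ne_zero (m := m) (ZFin.inter (γ + δ) ε))) ?_
  rw [← ha, ← hb]
  calc _ = poly (quad m) (hPoly m (ZFin.inter γ δ)) * (ev m (dMul hm φ ψ) * ev m ξ) := by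
        rw [map_mul, mul_assoc, h2]
    _ = ev m φ * (ev m ψ * ev m ξ) := by rw [← mul_assoc, h1, mul_assoc]
    _ = ev m φ * (poly (quad m) (hPoly m (ZFin.inter δ ε)) * ev m (dMul hm ψ ξ)) := by rw [h3]
    _ = poly (quad m) (hPoly m (ZFin.inter δ ε)) * (ev m φ * ev m (dMul hm ψ ξ)) := by
        rw [hp, ← mul_assoc, ← mul_assoc, ← map_mul, ← map_mul, mul_comm (hPoly m γ * p)]
    _ = _ := by rw [hPoly_cocycle, map_mul, mul_assoc, h4]

theorem ev_dMul_comm (hm : m ∉ Set.range (Int.cast : ℤ → k)) {γ δ : ZFin × ZFin}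
    (φ φ' : DPiece m hm γ) (ψ ψ' : DPiece m hm δ) :
    dMul hm (φ + φ') ψ = dMul hm φ ψ + dMul hm φ' ψ ∧
      dMul hm φ (ψ + ψ') = dMul hm φ ψ + dMul hm φ ψ' := by
  have h1 := (isDMul_iff m _ _ _).1 (dMul_spec hm φ ψ)
  have h2 := (isDMul_iff m _ _ _).1 (dMul_spec hm φ' ψ)
  have h3 := (isDMul_iff m _ _ _).1 (dMul_spec hm φ ψ')
  constructor <;> refine dMul_unique hm ((isDMul_iff m _ _ _).2 ?_)
  · rw [ev_add, ev_add, mul_add, add_mul, h1, h2]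
  · rw [ev_add, ev_add, mul_add, mul_add, h1, h3]

noncomputable instance dGMul (hm : m ∉ Set.range (Int.cast : ℤ → k)) :
    GradedMonoid.GMul (DPiece m hm) where
  mul := dMul hm

noncomputable instance dGOne (hm : m ∉ Set.range (Int.cast : ℤ → k)) :
    GradedMonoid.GOne (DPiece m hm) where
  one := dOne hm

noncomputable instance dGRing (hm : m ∉ Set.range (Int.cast : ℤ → k)) :
    DirectSum.GRing (DPiece m hm) where
  mul_zero φ := dMul_unique hm ((isDMul_iff m _ _ _).2 (by rw [ev_zero, ev_zero]; simp))
  zero_mul φ := dMul_unique hm ((isDMul_iff m _ _ _).2 (by rw [ev_zero, ev_zero]; simp))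
  mul_add φ ψ ψ' := (ev_dMul_comm hm φ φ ψ ψ').2
  add_mul φ φ' ψ := (ev_dMul_comm hm φ φ' ψ ψ).1
  one_mul := fun ⟨γ, φ⟩ => mk_eq hm (zero_add γ)
    ((ev_dMul_zero_left hm (dOne hm) φ).trans (by rw [ev_dOne, one_mul]))
  mul_one := fun ⟨γ, φ⟩ => mk_eq hm (add_zero γ)
    ((ev_dMul_zero_right hm φ (dOne hm)).trans (by rw [ev_dOne, mul_one]))
  mul_assoc := fun ⟨γ, φ⟩ ⟨δ, ψ⟩ ⟨ε, ξ⟩ => mk_eq hm (add_assoc γ δ ε) (ev_dMul_assoc hm φ ψ ξ)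
  natCast n := n • dOne hm
  natCast_zero := zero_smul _ _
  natCast_succ n := succ_nsmul _ _
  intCast n := n • dOne hm
  intCast_ofNat n := natCast_zsmul _ _
  intCast_negSucc_ofNat n := negSucc_zsmul _ _

noncomputable instance dGAlgebra (hm : m ∉ Set.range (Int.cast : ℤ → k)) :
    DirectSum.GAlgebra k (DPiece m hm) where
  toFun := (LinearMap.toSpanSingleton k (DPiece m hm 0) (dOne hm)).toAddMonoidHom
  map_one := one_smul k (dOne hm)
  map_mul r s := mk_eq hm (zero_add _).symm (by
    refine Eq.trans ?_ (ev_dMul_zero_left hm _ _).symm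
    change ev m ((r * s) • dOne hm) = ev m (r • dOne hm) * ev m (s • dOne hm)
    simp [ev_smul, ev_dOne, smul_smul, mul_comm])
  commutes := fun r ⟨γ, φ⟩ => mk_eq hm ((zero_add γ).trans (add_zero γ).symm) (by
    refine (ev_dMul_zero_left hm _ _).trans (Eq.trans ?_ (ev_dMul_zero_right hm _ _).symm)
    change ev m (r • dOne hm) * ev m φ = ev m φ * ev m (r • dOne hm)
    simp [ev_smul, ev_dOne])
  smul_def := fun r ⟨γ, φ⟩ => mk_eq hm (zero_add γ).symm (by
    refine Eq.trans ?_ (ev_dMul_zero_left hm _ _).symm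
    change ev m (r • φ) = ev m (r • dOne hm) * ev m φ
    simp [ev_smul, ev_dOne])

/-- The ring `D = ⨁_γ Hom_{gr A}(A, ι_γ A)`. -/
abbrev DRing (m : k) (hm : m ∉ Set.range (Int.cast : ℤ → k)) : Type u :=
  DirectSum (ZFin × ZFin) (DPiece m hm)

/-- The homogeneous pieces of `D`. -/
noncomputable def dGrading (m : k) (hm : m ∉ Set.range (Int.cast : ℤ → k)) (γ : ZFin × ZFin) :
    Submodule k (DRing m hm) :=
  LinearMap.range (DirectSum.lof k (ZFin × ZFin) (DPiece m hm) γ)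

end RingD

/-! The ring `D` is explicit. Since `m` is not an integer, the linear factors of `h_γ` are distinct,
so `D_γ` is free of rank one over `k[z]`, on a basis element `e_γ` that corresponds to `h_γ`. Every
root of `h_γ h_δ` in the intersection is double, whence `h_γ h_δ = h_{γ∩δ}² h_{γ+δ}`, and the twist
`Θ` removes one factor `h_{γ∩δ}`. Thus `e_γ e_δ = h_{γ∩δ} e_{γ+δ}` (`dMul_dCoef`). As `γ + γ = 0`,
this gives `e_γ² = h_γ`.

Inside the grading group lies a copy of `ℤ`, the ladder: `ladder i` consists twice of the interval
between `0` and `i`, and consecutive ladder degrees differ by `rung i = ({i}, {i})`. For a graded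
`D`-module `N` the sum of the `N_{ladder i}` is a graded `A`-module: `x` and `y` both act by
`e_{rung i}`, up and down between the degrees `i` and `i + 1`, and the `z` of `A` acts in degree `i`
as the `z` of `D` plus `i`. The relations hold because `e_{rung i}² = h_{rung i} = f(z + i)`. This
is `ladderFunctor`.

The functor loses nothing because, for fixed `γ`, the polynomials `h_{γ + ladder i}` generate the
unit ideal (`exists_sum_hPoly_eq_one`): crossing the rung `n` toggles the membership of `n`, so no
root is common to all of them. From `1 = ∑ c_i h_{γ + ladder i} = ∑ c_i e_{γ + ladder i}²` each `v ∈
N_γ` is recovered from the elements `e_{γ + ladder i} v` of ladder degree (`sum_act_act`). Moreover,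
every map that `D` induces between two ladder degrees is induced by `A` (`exists_path`). Hence the
functor is faithful and full, and it preserves and reflects finite generation (`finite_ladderMod`,
`finite_of_ladderMod`).

For essential surjectivity, an element `v` of degree `γ` is encoded by the sequence `s_j = e_{γ +
ladder j} v`. The relations that such a sequence satisfies under `x` and `y` make sense in any
graded `A`-module `M`, and the sequences satisfying them form a graded `D`-module `climbMod` (by the
cocycle identity `hPoly_cocycle`). Its ladder part is `M` (`exists_ladder_iso`), since in degree
`ladder i` a sequence is determined by an arbitrary value at `i`. -/

namespace GrMod

/-! ### Graded modules over an arbitrary graded algebra. -/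

section General

variable {k : Type u} [Field k] {R : Type u} [Ring R] [Algebra k R]
  {Γ : Type w} [AddCommGroup Γ] {𝒜 : Γ → Submodule k R}

/-- Elements of a graded module are determined by a property that is additive and holds for
homogeneous elements. -/
theorem induction_on (M : GrMod k 𝒜) {p : M.carrier → Prop} (zero : p 0)
    (add : ∀ a b, p a → p b → p (a + b)) (hom : ∀ γ, ∀ m ∈ M.piece γ, p m) (m : M.carrier) :
    p m := by
  have h : m ∈ ⨆ γ, M.piece γ := by rw [M.iSup_eq_top]; trivial
  induction h using Submodule.iSup_induction' with
  | mem γ m hm => exact hom γ m hm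
  | zero => exact zero
  | add a b _ _ ha hb => exact add a b ha hb

theorem hom_ext_of_piece {M N : GrMod k 𝒜} {φ ψ : M ⟶ N}
    (h : ∀ γ, ∀ m ∈ M.piece γ, Hom.lin φ m = Hom.lin ψ m) : φ = ψ := by
  refine hom_ext fun m => ?_
  induction m using M.induction_on with
  | zero => rw [map_zero, map_zero]
  | add a b ha hb => rw [map_add, map_add, ha, hb]
  | hom γ m hm => exact h γ m hm

/-- A degree preserving `k`-linear map that commutes with the action of homogeneous elements, as a
morphism. -/
def homOfHomogeneous (h𝒜 : ⨆ γ, 𝒜 γ = ⊤) {M N : GrMod k 𝒜} (φ : M.carrier →ₗ[k] N.carrier)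
    (hdeg : ∀ γ, ∀ m ∈ M.piece γ, φ m ∈ N.piece γ)
    (hφ : ∀ γ δ m r, m ∈ M.piece γ → r ∈ 𝒜 δ →
      φ (MulOpposite.op r • m) = MulOpposite.op r • φ m) : M ⟶ N :=
  Hom.mk
    { toFun := φ
      map_add' := map_add φ
      map_smul' := by
        intro r m
        induction m using M.induction_on with
        | zero => simp
        | add a b ha hb => rw [smul_add, map_add, ha, hb, map_add, smul_add]
        | hom γ m hm =>
          obtain ⟨r, rfl⟩ := MulOpposite.op_surjective r
          rw [RingHom.id_apply]
          have h : r ∈ ⨆ γ, 𝒜 γ := by rw [h𝒜]; trivial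
          induction h using Submodule.iSup_induction' with
          | mem δ r hr => exact hφ γ δ m r hm hr
          | zero => simp
          | add a b _ _ ha hb =>
            rw [MulOpposite.op_add, add_smul, map_add, ha, hb, add_smul] }
    hdeg

/-- The linear map with given restrictions to the homogeneous pieces. -/
theorem exists_glue (M : GrMod k 𝒜) {V : Type*} [AddCommGroup V] [Module k V]
    (g : ∀ γ, M.piece γ →ₗ[k] V) :
    ∃ φ : M.carrier →ₗ[k] V, ∀ γ, ∀ m : M.piece γ, φ m = g γ m := by
  classical
  have hi : DirectSum.IsInternal M.piece :=
    DirectSum.isInternal_submodule_of_iSupIndep_of_iSup_eq_top M.indep M.iSup_eq_top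
  let e := LinearEquiv.ofBijective (DirectSum.coeLinearMap M.piece) hi
  refine ⟨DirectSum.toModule k Γ V g ∘ₗ e.symm.toLinearMap, fun γ m => ?_⟩
  have h : e.symm (m : M.carrier) = DirectSum.lof k Γ (fun γ => M.piece γ) γ m := by
    rw [LinearEquiv.symm_apply_eq]
    exact (DirectSum.coeLinearMap_lof M.piece γ m).symm
  rw [LinearMap.comp_apply, LinearEquiv.coe_coe, h, DirectSum.toModule_lof]

/-- A morphism that is bijective in each degree is an isomorphism. -/
theorem isIso_of_piece {M N : GrMod k 𝒜} (φ : M ⟶ N)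
    (hinj : ∀ γ, ∀ m ∈ M.piece γ, Hom.lin φ m = 0 → m = 0)
    (hsurj : ∀ γ, ∀ n ∈ N.piece γ, ∃ m ∈ M.piece γ, Hom.lin φ m = n) : IsIso φ := by
  have hi : Function.Injective (Hom.lin φ) := by
    rw [injective_iff_map_eq_zero]
    intro m hm
    obtain ⟨s, v, hv, rfl⟩ := M.exists_sum m
    rw [map_sum] at hm
    have := N.eq_zero_of_sum (fun γ _ => Hom.lin_mem φ (hv γ)) hm
    exact Finset.sum_eq_zero fun γ hγ => hinj γ _ (hv γ) (this γ hγ)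
  have hs : Function.Surjective (Hom.lin φ) := by
    intro n
    induction n using N.induction_on with
    | zero => exact ⟨0, map_zero _⟩
    | add a b ha hb =>
      obtain ⟨a, rfl⟩ := ha
      obtain ⟨b, rfl⟩ := hb
      exact ⟨a + b, map_add _ _ _⟩
    | hom γ n hn =>
      obtain ⟨m, -, h⟩ := hsurj γ n hn
      exact ⟨m, h⟩
  let e := LinearEquiv.ofBijective (Hom.lin φ) ⟨hi, hs⟩
  refine ⟨Hom.mk e.symm.toLinearMap fun γ n hn => ?_, hom_ext fun m => ?_, hom_ext fun n => ?_⟩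
  · obtain ⟨m, hm, rfl⟩ := hsurj γ n hn
    have : e.symm (Hom.lin φ m) = m := e.symm_apply_apply m
    change e.symm (Hom.lin φ m) ∈ _
    rwa [this]
  · exact e.symm_apply_apply m
  · exact e.apply_symm_apply n

/-- The homogeneous components of a finite generating set are finitely many and generate. -/
theorem exists_homogeneous_generators {M : GrMod k 𝒜} (h : Module.Finite Rᵐᵒᵖ M.carrier) :
    ∃ S : Set M.carrier, S.Finite ∧ (∀ s ∈ S, ∃ γ, s ∈ M.piece γ) ∧
      Submodule.span Rᵐᵒᵖ S = ⊤ := by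
  classical
  obtain ⟨T, hT⟩ := h.fg_top
  choose s v hv hs using M.exists_sum
  refine ⟨⋃ t ∈ T, v t '' (s t : Set Γ), ?_, ?_, ?_⟩
  · exact T.finite_toSet.biUnion fun t _ => (s t).finite_toSet.image _
  · intro a ha
    simp only [Set.mem_iUnion, Set.mem_image] at ha
    obtain ⟨t, -, γ, -, rfl⟩ := ha
    exact ⟨γ, hv t γ⟩
  · rw [eq_top_iff, ← hT, Submodule.span_le]
    intro t ht
    rw [SetLike.mem_coe, ← hs t]
    refine Submodule.sum_mem _ fun γ hγ => Submodule.subset_span ?_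
    simp only [Set.mem_iUnion, Set.mem_image]
    exact ⟨t, ht, γ, hγ, rfl⟩

/-- A family of subspaces of the homogeneous pieces that is stable under the action and contains
generators is everything. -/
theorem mem_of_generators (h𝒜 : ⨆ γ, 𝒜 γ = ⊤) (M : GrMod k 𝒜) (K : Γ → Submodule k M.carrier)
    (hK : ∀ γ, K γ ≤ M.piece γ)
    (hsmul : ∀ γ δ m r, m ∈ K γ → r ∈ 𝒜 δ → MulOpposite.op r • m ∈ K (γ + δ))
    {S : Set M.carrier} (hS : ∀ s ∈ S, ∃ γ, s ∈ K γ) (hspan : Submodule.span Rᵐᵒᵖ S = ⊤)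
    {γ : Γ} {m : M.carrier} (hm : m ∈ M.piece γ) : m ∈ K γ := by
  classical
  have key : ∀ m : M.carrier, m ∈ ⨆ γ, K γ := by
    intro m
    have h : m ∈ Submodule.span Rᵐᵒᵖ S := by rw [hspan]; trivial
    induction h using Submodule.span_induction with
    | mem s hs =>
      obtain ⟨γ, h⟩ := hS s hs
      exact Submodule.mem_iSup_of_mem γ h
    | zero => exact Submodule.zero_mem _
    | add a b _ _ ha hb => exact Submodule.add_mem _ ha hb
    | smul r a hmem ha =>
      clear hmem
      induction ha using Submodule.iSup_induction' with
      | zero => rw [smul_zero]; exact Submodule.zero_mem _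
      | add a b _ _ ha hb => rw [smul_add]; exact Submodule.add_mem _ ha hb
      | mem γ a ha =>
        obtain ⟨r, rfl⟩ := MulOpposite.op_surjective r
        have h : r ∈ ⨆ γ, 𝒜 γ := by rw [h𝒜]; trivial
        induction h using Submodule.iSup_induction' with
        | mem δ r hr => exact Submodule.mem_iSup_of_mem _ (hsmul γ δ a r ha hr)
        | zero => rw [MulOpposite.op_zero, zero_smul]; exact Submodule.zero_mem _
        | add a b _ _ ha hb =>
          rw [MulOpposite.op_add, add_smul]; exact Submodule.add_mem _ ha hb
  obtain ⟨t, ht, hs⟩ := (Submodule.mem_iSup_iff_exists_finsupp _ _).1 (key m)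
  -- Two homogeneous decompositions of `m` are compared: the one with parts in `K`, and `m` itself
  -- placed in degree `γ`. Independence of the pieces identifies `m` with the part in `K γ`.
  have h0 : ∑ δ ∈ insert γ t.support, (t δ - if δ = γ then m else 0) = 0 := by
    rw [Finset.sum_sub_distrib, Finset.sum_ite_eq', if_pos (Finset.mem_insert_self _ _),
      sub_eq_zero, ← hs]
    symm
    refine Finset.sum_subset (Finset.subset_insert _ _) fun δ _ hδ => ?_
    simpa using hδ
  have h1 := M.eq_zero_of_sum (fun δ _ => (M.piece δ).sub_mem (hK δ (ht δ)) (by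
    split_ifs with h
    · rwa [h]
    · exact zero_mem _)) h0 γ (Finset.mem_insert_self _ _)
  rw [if_pos rfl, sub_eq_zero] at h1
  exact h1 ▸ ht γ

end General

/-! ### Finitely supported functions -/

section FinFun

variable {k : Type*} [Field k] {Γ : Type*} {W : Type*} [AddCommGroup W] [Module k W]

/-- Finitely supported functions whose values lie in given subspaces. -/
def finFun (P : Γ → Submodule k W) : Submodule k (Γ → W) where
  carrier := {F | (Function.support F).Finite ∧ ∀ γ, F γ ∈ P γ}
  add_mem' := fun ha hb => ⟨(ha.1.union hb.1).subset (Function.support_add _ _),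
    fun γ => (P γ).add_mem (ha.2 γ) (hb.2 γ)⟩
  zero_mem' := ⟨by simp, fun γ => (P γ).zero_mem⟩
  smul_mem' := fun c _ ha => ⟨ha.1.subset (Function.support_const_smul_subset c _),
    fun γ => (P γ).smul_mem c (ha.2 γ)⟩

/-- The functions supported at one point. -/
def finFunPiece (P : Γ → Submodule k W) (γ : Γ) : Submodule k (finFun P) where
  carrier := {F | ∀ δ ≠ γ, F.1 δ = 0}
  add_mem' := fun {a b} ha hb δ hδ => by
    change a.1 δ + b.1 δ = 0
    rw [ha δ hδ, hb δ hδ, add_zero]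
  zero_mem' := fun _ _ => rfl
  smul_mem' := fun c a ha δ hδ => by
    change c • a.1 δ = 0
    rw [ha δ hδ, smul_zero]

variable [DecidableEq Γ] (P : Γ → Submodule k W)

/-- The function supported at one point with a given value. -/
def finSingle (γ : Γ) : P γ →ₗ[k] finFun P where
  toFun w := ⟨Pi.single γ (w : W), (Set.finite_singleton γ).subset Pi.support_single_subset,
    fun δ => by
      by_cases h : δ = γ
      · subst h; simp
      · simp [h]⟩
  map_add' a b := Subtype.ext (Pi.single_add γ _ _)
  map_smul' c a := Subtype.ext (Pi.single_smul γ c _)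

theorem finSingle_mem (γ : Γ) (w : P γ) : finSingle P γ w ∈ finFunPiece P γ :=
  fun _ hδ => Pi.single_eq_of_ne hδ _

theorem finFunPiece_indep : iSupIndep (finFunPiece P) := by
  rw [iSupIndep_iff_finsetSum_eq_zero_imp_eq_zero]
  intro s v hv h γ hγ
  apply Subtype.ext
  funext δ
  by_cases hδ : δ = γ
  · subst hδ
    have h1 := congrArg (fun F : finFun P => F.1 δ) h
    simp only [AddSubmonoidClass.coe_finsetSum, Finset.sum_apply] at h1
    rw [Finset.sum_eq_single_of_mem δ hγ fun ε hε hne => hv ε hε δ hne.symm] at h1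
    exact h1
  · exact hv γ hγ δ hδ

theorem finFunPiece_iSup : ⨆ γ, finFunPiece P γ = ⊤ := by
  rw [eq_top_iff]
  intro F _
  have : F = ∑ γ ∈ F.2.1.toFinset, finSingle P γ ⟨F.1 γ, F.2.2 γ⟩ := by
    apply Subtype.ext
    funext δ
    simp only [AddSubmonoidClass.coe_finsetSum, Finset.sum_apply, finSingle, LinearMap.coe_mk,
      AddHom.coe_mk]
    rw [Finset.sum_pi_single]
    split_ifs with h
    · rfl
    · simpa using h
  rw [this]
  exact Submodule.sum_mem _ fun γ _ => Submodule.mem_iSup_of_mem γ (finSingle_mem P γ _)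

end FinFun

end GrMod

/-! ### Right representations of `A`. -/

namespace GWA

open GrMod

variable {k : Type u} [Field k] (f : k[X])

/-- Three operators satisfying the relations of `A(f)`, as a representation on the right. -/
noncomputable def rightRep {W : Type u} [AddCommGroup W] [Module k W] (a b c : Module.End k W)
    (hxz : c * a = a * (c + 1)) (hyz : c * b = b * (c - 1))
    (hxy : b * a = aeval c f) (hyx : a * b = aeval (c - 1) f) :
    GWA f →ₐ[k] (Module.End k W)ᵐᵒᵖ :=
  -- On a right module the product `x * y` applies `x` before `y`, so each relation of `A` appears
  -- among the operators with its factors reversed.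
  lift f (fun | .x => .op a | .y => .op b | .z => .op c)
    (by rw [← MulOpposite.op_mul, hxz]; rfl)
    (by rw [← MulOpposite.op_mul, hyz]; rfl)
    (by
      change MulOpposite.op (b * a) = _
      rw [hxy, aeval_op_apply])
    (by
      change MulOpposite.op (a * b) = aeval (MulOpposite.op (c - 1)) f
      rw [hyx, aeval_op_apply])

end GWA

/-! ### The ring `D` by generators and structure constants. -/

section
variable {k : Type u} [Field k] {m : k} (hm : m ∉ Set.range (Int.cast : ℤ → k))
open GWA GrMod

/-- The element of `D_γ` with a given coefficient at `h_γ`, as a linear map. -/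
noncomputable def dCoefHom (γ : ZFin × ZFin) : k[X] →ₗ[k] DPiece m hm γ where
  toFun p := (exists_hom m γ p).choose
  map_add' p q := ev_injective m (by
    rw [ev_add, (exists_hom m γ p).choose_spec, (exists_hom m γ q).choose_spec,
      (exists_hom m γ (p + q)).choose_spec, mul_add, map_add])
  map_smul' c p := ev_injective m (by
    rw [RingHom.id_apply, ev_smul, (exists_hom m γ p).choose_spec,
      (exists_hom m γ (c • p)).choose_spec, mul_smul_comm, map_smul])

theorem ev_dCoefHom (γ : ZFin × ZFin) (p : k[X]) :
    ev m (dCoefHom hm γ p) = poly (quad m) (hPoly m γ * p) :=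
  (exists_hom m γ p).choose_spec

theorem dGrading_iSup : ⨆ γ, dGrading m hm γ = ⊤ := by
  rw [eq_top_iff]
  intro r _
  induction r using DirectSum.induction_on with
  | zero => exact Submodule.zero_mem _
  | of γ φ => exact Submodule.mem_iSup_of_mem γ ⟨φ, rfl⟩
  | add a b ha hb => exact Submodule.add_mem _ (ha trivial) (hb trivial)

variable [CharZero k]

/-- The element of `D_γ` with a given coefficient at `h_γ`. -/
noncomputable def dCoef (γ : ZFin × ZFin) : k[X] ≃ₗ[k] DPiece m hm γ :=
  LinearEquiv.ofBijective (dCoefHom hm γ) (by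
    constructor
    · rw [injective_iff_map_eq_zero]
      intro p hp
      have h := ev_dCoefHom hm γ p
      rw [hp, ev_zero, ← map_zero (poly (quad m))] at h
      exact (mul_eq_zero.1 (poly_injective (quad m) h).symm).resolve_left (hPoly_ne_zero γ)
    · intro φ
      obtain ⟨p, hp⟩ := exists_ev hm φ
      exact ⟨p, ev_injective m ((ev_dCoefHom hm γ p).trans hp.symm)⟩)

theorem ev_dCoef (γ : ZFin × ZFin) (p : k[X]) :
    ev m (dCoef hm γ p) = poly (quad m) (hPoly m γ * p) :=
  ev_dCoefHom hm γ p

/-- The multiplication table of `D`: over `k[z]`, `e_γ e_δ = h_{γ∩δ} e_{γ+δ}`. It follows from `h_γ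
h_δ = h_{γ∩δ}² h_{γ+δ}` after one factor `h_{γ∩δ}` is cancelled by `Θ`. -/
theorem dMul_dCoef (γ δ : ZFin × ZFin) (p q : k[X]) :
    dMul hm (dCoef hm γ p) (dCoef hm δ q) =
      dCoef hm (γ + δ) (hPoly m (ZFin.inter γ δ) * (p * q)) :=
  dMul_unique hm ((isDMul_iff m _ _ _).2 (by
    rw [ev_dCoef, ev_dCoef, ev_dCoef, ← map_mul, ← map_mul, hPoly_mul_aux]))

/-- The homogeneous element of `D` of degree `γ` with a given coefficient at `h_γ`. -/
noncomputable def dElem (γ : ZFin × ZFin) : k[X] →ₗ[k] DRing m hm :=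
  DirectSum.lof k (ZFin × ZFin) (DPiece m hm) γ ∘ₗ (dCoef hm γ).toLinearMap

theorem dElem_mem (γ : ZFin × ZFin) (p : k[X]) : dElem hm γ p ∈ dGrading m hm γ := ⟨_, rfl⟩

theorem mem_dGrading {γ : ZFin × ZFin} {r : DRing m hm} (hr : r ∈ dGrading m hm γ) :
    ∃ p, dElem hm γ p = r := by
  obtain ⟨φ, rfl⟩ := hr
  exact ⟨(dCoef hm γ).symm φ, by simp [dElem]⟩

theorem dElem_mul (γ δ : ZFin × ZFin) (p q : k[X]) :
    dElem hm γ p * dElem hm δ q = dElem hm (γ + δ) (hPoly m (ZFin.inter γ δ) * (p * q)) := by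
  refine (DirectSum.of_mul_of (A := DPiece m hm) _ _).trans ?_
  exact congrArg (DirectSum.of (DPiece m hm) (γ + δ)) (dMul_dCoef hm γ δ p q)

theorem dElem_zero_one : dElem hm 0 1 = 1 := by
  change DirectSum.of (DPiece m hm) 0 (dCoef hm 0 1) = DirectSum.of (DPiece m hm) 0 (dOne hm)
  congr 1
  apply ev_injective m
  rw [ev_dCoef, ev_dOne, mul_one, hPoly_zero, map_one]

section DRep

variable {W : Type u} [AddCommGroup W] [Module k W]
  (a : ZFin × ZFin → k[X] →ₗ[k] Module.End k W)

/-- Operators indexed by coefficients, as operators indexed by the elements of `D_γ`. -/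
noncomputable def dRepPiece (γ : ZFin × ZFin) : DPiece m hm γ →ₗ[k] (Module.End k W)ᵐᵒᵖ :=
  (MulOpposite.opLinearEquiv k).toLinearMap ∘ₗ a γ ∘ₗ (dCoef hm γ).symm.toLinearMap

theorem dRepPiece_dCoef (γ : ZFin × ZFin) (p : k[X]) :
    dRepPiece hm a γ (dCoef hm γ p) = MulOpposite.op (a γ p) := by
  change MulOpposite.op (a γ ((dCoef hm γ).symm (dCoef hm γ p))) = _
  rw [LinearEquiv.symm_apply_apply]

theorem dRepPiece_one (h1 : a 0 1 = 1) : dRepPiece hm a 0 (dOne hm) = 1 := by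
  have : dOne hm = dCoef hm 0 1 := by
    apply ev_injective m
    rw [ev_dCoef, ev_dOne, mul_one, hPoly_zero, map_one]
  rw [this, dRepPiece_dCoef, h1, MulOpposite.op_one]

/-- The multiplication table is the only relation to verify for an action of `D`, so a family of
operators obeying it is enough to build a module. -/
theorem dRepPiece_mul
    (hmul : ∀ γ δ p q, a δ q * a γ p = a (γ + δ) (hPoly m (ZFin.inter γ δ) * (p * q)))
    {γ δ : ZFin × ZFin} (φ : DPiece m hm γ) (ψ : DPiece m hm δ) :
    dRepPiece hm a (γ + δ) (dMul hm φ ψ) = dRepPiece hm a γ φ * dRepPiece hm a δ ψ := by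
  obtain ⟨p, rfl⟩ := (dCoef hm γ).surjective φ
  obtain ⟨q, rfl⟩ := (dCoef hm δ).surjective ψ
  rw [dMul_dCoef, dRepPiece_dCoef, dRepPiece_dCoef, dRepPiece_dCoef, ← MulOpposite.op_mul, hmul]

variable (h1 : a 0 1 = 1)
  (hmul : ∀ γ δ p q, a δ q * a γ p = a (γ + δ) (hPoly m (ZFin.inter γ δ) * (p * q)))

/-- Operators satisfying the relations of the homogeneous elements of `D`, as a representation. -/
noncomputable def dRep : DRing m hm →ₐ[k] (Module.End k W)ᵐᵒᵖ :=
  DirectSum.toAlgebra k (DPiece m hm) (dRepPiece hm a) (dRepPiece_one hm a h1)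
    (dRepPiece_mul hm a hmul)

theorem dRep_dElem (γ : ZFin × ZFin) (p : k[X]) :
    dRep hm a h1 hmul (dElem hm γ p) = MulOpposite.op (a γ p) := by
  rw [← dRepPiece_dCoef hm]
  exact DirectSum.toSemiring_of (fun γ => (dRepPiece hm a γ).toAddMonoidHom)
    (dRepPiece_one hm a h1) (dRepPiece_mul hm a hmul) γ (dCoef hm γ p)

end DRep

end

/-! ### Graded modules built from representations. -/

namespace GrMod

section OfRep

variable {k : Type u} [Field k] {R : Type u} [Ring R] [Algebra k R]
  {Γ : Type w} [AddCommGroup Γ] {𝒜 : Γ → Submodule k R}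

/-- The right module given by a representation on the right. -/
abbrev rightModule {W : Type u} [AddCommGroup W] [Module k W]
    (ρ : R →ₐ[k] (Module.End k W)ᵐᵒᵖ) : Module Rᵐᵒᵖ W where
  smul r w := MulOpposite.unop (ρ (MulOpposite.unop r)) w
  one_smul w := by
    change MulOpposite.unop (ρ (1 : R)) w = w
    rw [map_one]; rfl
  mul_smul r s w := by
    change MulOpposite.unop (ρ (MulOpposite.unop s * MulOpposite.unop r)) w = _
    rw [map_mul]; rfl
  smul_zero r := map_zero (MulOpposite.unop (ρ (MulOpposite.unop r)))
  smul_add r := map_add (MulOpposite.unop (ρ (MulOpposite.unop r)))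
  add_smul r s w := by
    change MulOpposite.unop (ρ (MulOpposite.unop r + MulOpposite.unop s)) w = _
    rw [map_add]; rfl
  zero_smul w := by
    change MulOpposite.unop (ρ (0 : R)) w = 0
    rw [map_zero]; rfl

/-- The graded module given by a representation on the right and a grading. -/
abbrev ofRep {W : Type u} [AddCommGroup W] [Module k W] (ρ : R →ₐ[k] (Module.End k W)ᵐᵒᵖ)
    (P : Γ → Submodule k W) (hindep : iSupIndep P) (htop : ⨆ γ, P γ = ⊤)
    (hsmul : ∀ γ δ w r, w ∈ P γ → r ∈ 𝒜 δ → MulOpposite.unop (ρ r) w ∈ P (γ + δ)) :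
    GrMod k 𝒜 where
  carrier := W
  moduleRight := rightModule ρ
  isScalarTower := letI := rightModule ρ; ⟨fun c r w => by
    change MulOpposite.unop (ρ (c • MulOpposite.unop r)) w =
      c • MulOpposite.unop (ρ (MulOpposite.unop r)) w
    rw [map_smul]; rfl⟩
  piece := P
  indep := hindep
  iSup_eq_top := htop
  smul_mem := fun hm hr => hsmul _ _ _ _ hm hr

/-- The action of an element of the algebra, as a `k`-linear map. -/
def rightMul (M : GrMod k 𝒜) (r : R) : Module.End k M.carrier :=
  Algebra.lsmul k k M.carrier (MulOpposite.op r)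

theorem rightMul_apply (M : GrMod k 𝒜) (r : R) (v : M.carrier) :
    M.rightMul r v = MulOpposite.op r • v := rfl

theorem rightMul_mul (M : GrMod k 𝒜) (r s : R) (v : M.carrier) :
    M.rightMul (r * s) v = M.rightMul s (M.rightMul r v) := by
  simp only [rightMul_apply, MulOpposite.op_mul, mul_smul]

theorem rightMul_mem {R : Type u} [Ring R] [Algebra k R] {Γ : Type w} [AddCommGroup Γ]
    {𝒜 : Γ → Submodule k R} (M : GrMod k 𝒜) {γ δ ε : Γ} {r : R} {v : M.carrier}
    (hv : v ∈ M.piece γ) (hr : r ∈ 𝒜 δ) (h : γ + δ = ε) : M.rightMul r v ∈ M.piece ε :=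
  h ▸ M.smul_mem hv hr

theorem lin_rightMul {M N : GrMod k 𝒜} (φ : M ⟶ N) (r : R) (v : M.carrier) :
    Hom.lin φ (M.rightMul r v) = N.rightMul r (Hom.lin φ v) := map_smul _ _ _

end OfRep

/-- Used with `φ` the evaluation in one degree, it computes a polynomial in the operator `z` one
degree at a time. -/
theorem aeval_intertwine {k : Type*} [Field k] {V W : Type*} [AddCommGroup V] [Module k V]
    [AddCommGroup W] [Module k W] (φ : V →ₗ[k] W) (E : Module.End k V) (e : Module.End k W)
    (h : ∀ v, φ (E v) = e (φ v)) (p : k[X]) (v : V) : φ (aeval E p v) = aeval e p (φ v) := by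
  induction p using Polynomial.induction_on generalizing v with
  | C c => rw [aeval_C, aeval_C, Module.algebraMap_end_apply, Module.algebraMap_end_apply, map_smul]
  | add p q hp hq =>
    rw [map_add, map_add, LinearMap.add_apply, LinearMap.add_apply, map_add, hp, hq]
  | monomial n c ih =>
    rw [pow_succ, ← mul_assoc, map_mul (aeval E) _ X, map_mul (aeval e) _ X, aeval_X, aeval_X,
      Module.End.mul_apply, Module.End.mul_apply, ih, h]

section FinFunMap

variable {k : Type*} [Field k] {Γ : Type*} {W W' : Type*} [AddCommGroup W] [Module k W]
  [AddCommGroup W'] [Module k W'] {P : Γ → Submodule k W} {Q : Γ → Submodule k W'}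

/-- The map of finitely supported functions induced by maps of the values and a permutation of the
arguments. -/
def finFunMap (e : Γ ≃ Γ) (a : Γ → W →ₗ[k] W') (h : ∀ γ, ∀ w ∈ P (e γ), a γ w ∈ Q γ) :
    finFun P →ₗ[k] finFun Q where
  toFun F := ⟨fun γ => a γ (F.1 (e γ)), (F.2.1.preimage e.injective.injOn).subset fun γ hγ h0 =>
    hγ (by change a γ (F.1 (e γ)) = 0; rw [show F.1 (e γ) = 0 from h0, map_zero]),
    fun γ => h γ _ (F.2.2 _)⟩
  map_add' F G := Subtype.ext (funext fun γ => map_add (a γ) _ _)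
  map_smul' c F := Subtype.ext (funext fun γ => map_smul (a γ) c _)

/-- The value at one point. -/
def finVal (P : Γ → Submodule k W) (γ : Γ) : finFun P →ₗ[k] W :=
  LinearMap.proj γ ∘ₗ (finFun P).subtype

theorem finVal_ext {F G : finFun P} (h : ∀ γ, finVal P γ F = finVal P γ G) : F = G :=
  Subtype.ext (funext h)

theorem finVal_mem (F : finFun P) (γ : Γ) : finVal P γ F ∈ P γ := F.2.2 γ

theorem finVal_finSingle [DecidableEq Γ] (γ : Γ) (w : P γ) : finVal P γ (finSingle P γ w) = w :=
  Pi.single_eq_same (M := fun _ : Γ => W) γ (w : W)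

theorem finFunMap_apply (e : Γ ≃ Γ) (a : Γ → W →ₗ[k] W')
    (h : ∀ γ, ∀ w ∈ P (e γ), a γ w ∈ Q γ) (F : finFun P) (γ : Γ) :
    (finFunMap e a h F).1 γ = a γ (F.1 (e γ)) := rfl

theorem finFunMap_mem (e : Γ ≃ Γ) (a : Γ → W →ₗ[k] W')
    (h : ∀ γ, ∀ w ∈ P (e γ), a γ w ∈ Q γ) {F : finFun P} {γ : Γ}
    (hF : F ∈ finFunPiece P (e γ)) : finFunMap e a h F ∈ finFunPiece Q γ := fun δ hδ => by
  rw [finFunMap_apply, hF _ (fun h => hδ (e.injective h)), map_zero]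

end FinFunMap

end GrMod

/-! ### Reduction of degree and linearity conditions over `A` to the generators. -/

namespace GWA

open GrMod

variable {k : Type u} [Field k] (f : k[X])

theorem rightRep_mem {W : Type u} [AddCommGroup W] [Module k W]
    (ρ : GWA f →ₐ[k] (Module.End k W)ᵐᵒᵖ) (P : ℤ → Submodule k W)
    (hρ : ∀ (g : GWAGen) (i j : ℤ) (w : W), w ∈ P i → i + g.deg = j →
      MulOpposite.unop (ρ (gen f g)) w ∈ P j)
    (i j : ℤ) (w : W) (r : GWA f) (hw : w ∈ P i) (hr : r ∈ piece f j) :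
    MulOpposite.unop (ρ r) w ∈ P (i + j) := by
  induction hr using Submodule.span_induction with
  | mem r h =>
    obtain ⟨l, rfl, rfl⟩ := h
    -- The first letter of a word acts first on a right module, so the induction moves the vector
    -- and its degree along.
    induction l generalizing i w with
    | nil => simpa using hw
    | cons g l ih =>
      simp only [List.map_cons, List.prod_cons, List.sum_cons]
      rw [map_mul, MulOpposite.unop_mul, Module.End.mul_apply, ← add_assoc]
      exact ih _ _ (hρ g i _ w hw rfl)
  | zero => rw [map_zero, MulOpposite.unop_zero, LinearMap.zero_apply]; exact zero_mem _
  | add a b _ _ ha hb =>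
    rw [map_add, MulOpposite.unop_add, LinearMap.add_apply]; exact add_mem ha hb
  | smul c a _ ha =>
    rw [map_smul, MulOpposite.unop_smul, LinearMap.smul_apply]; exact Submodule.smul_mem _ _ ha

theorem rightMul_poly (M : GrMod k (piece f)) (p : k[X]) :
    M.rightMul (poly f p) = aeval (M.rightMul (gen f .z)) p := by
  change Algebra.lsmul k k M.carrier (MulOpposite.op (aeval _ p)) =
    aeval (Algebra.lsmul k k M.carrier (MulOpposite.op _)) p
  rw [aeval_algHom_apply, aeval_op_apply]

/-- Degree preserving linear maps that commute with the generators are morphisms. -/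
def homOfGen {M N : GrMod k (piece f)} (φ : M.carrier →ₗ[k] N.carrier)
    (hdeg : ∀ γ, ∀ m ∈ M.piece γ, φ m ∈ N.piece γ)
    (hφ : ∀ g γ m, m ∈ M.piece γ → φ (M.rightMul (gen f g) m) = N.rightMul (gen f g) (φ m)) :
    M ⟶ N :=
  homOfHomogeneous (piece_iSup f) φ hdeg (by
    intro i j m r hm hr
    change φ (M.rightMul r m) = N.rightMul r (φ m)
    induction hr using Submodule.span_induction with
    | mem r h =>
      obtain ⟨l, rfl, rfl⟩ := h
      induction l generalizing i m with
      | nil => simp [rightMul]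
      | cons g l ih =>
        simp only [List.map_cons, List.prod_cons]
        rw [rightMul_mul, rightMul_mul, ← hφ g i m hm]
        exact ih _ _ (M.smul_mem hm (gen_mem f g))
    | zero => simp [rightMul]
    | add a b _ _ ha hb =>
      simp only [rightMul_apply, MulOpposite.op_add, add_smul, map_add] at ha hb ⊢
      rw [ha, hb]
    | smul c a _ ha =>
      simp only [rightMul_apply, MulOpposite.op_smul, smul_assoc, map_smul] at ha ⊢
      rw [ha])

end GWA

/-! ### Combinatorics of the grading group -/

theorem ZFin.mem_add {J K : ZFin} {n : ℤ} :
    n ∈ (J + K).toFinset ↔ ¬(n ∈ J.toFinset ↔ n ∈ K.toFinset) := by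
  change n ∈ symmDiff J.toFinset K.toFinset ↔ _
  rw [Finset.mem_symmDiff]
  tauto

theorem ZFin.add_self (γ : ZFin × ZFin) : γ + γ = 0 :=
  Prod.ext (symmDiff_self γ.1.toFinset) (symmDiff_self γ.2.toFinset)

theorem ZFin.add_add_cancel (γ δ : ZFin × ZFin) : γ + δ + δ = γ := by
  rw [add_assoc, ZFin.add_self, add_zero]

theorem ZFin.add_cancel_add (γ δ ε : ZFin × ZFin) : γ + δ + (γ + ε) = δ + ε := by
  rw [add_comm γ δ, add_assoc, ← add_assoc γ γ, ZFin.add_self, zero_add]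

theorem ZFin.inter_comm (γ δ : ZFin × ZFin) : ZFin.inter γ δ = ZFin.inter δ γ :=
  Prod.ext (Finset.inter_comm _ _) (Finset.inter_comm _ _)

theorem ZFin.inter_self (γ : ZFin × ZFin) : ZFin.inter γ γ = γ :=
  Prod.ext (Finset.inter_self _) (Finset.inter_self _)

/-- The integers between `0` and `i`, twice. -/
noncomputable def ladder (i : ℤ) : ZFin × ZFin :=
  (toBoolRing (Finset.Ico 0 i ∪ Finset.Ico i 0), toBoolRing (Finset.Ico 0 i ∪ Finset.Ico i 0))

/-- The pair of sets `({i}, {i})`. -/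
def rung (i : ℤ) : ZFin × ZFin := (toBoolRing {i}, toBoolRing {i})

theorem mem_ladder_fst {i n : ℤ} :
    n ∈ (ladder i).1.toFinset ↔ (0 ≤ n ∧ n < i) ∨ (i ≤ n ∧ n < 0) := by
  change n ∈ Finset.Ico 0 i ∪ Finset.Ico i 0 ↔ _
  simp

theorem mem_ladder_snd {i n : ℤ} :
    n ∈ (ladder i).2.toFinset ↔ (0 ≤ n ∧ n < i) ∨ (i ≤ n ∧ n < 0) :=
  mem_ladder_fst

theorem mem_rung_fst {i n : ℤ} : n ∈ (rung i).1.toFinset ↔ n = i := by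
  change n ∈ ({i} : Finset ℤ) ↔ _
  simp

/-- For `i ≥ 0` the integer `i` is added to the interval, for `i < 0` it is removed; symmetric
difference treats both cases alike. -/
theorem ladder_succ_fst (i : ℤ) : (ladder (i + 1)).1 = (ladder i).1 + (rung i).1 := by
  refine Finset.ext fun n => ?_
  change n ∈ (ladder (i + 1)).1.toFinset ↔ n ∈ ((ladder i).1 + (rung i).1).toFinset
  rw [ZFin.mem_add, mem_ladder_fst, mem_ladder_fst, mem_rung_fst]
  omega

theorem ladder_succ (i : ℤ) : ladder (i + 1) = ladder i + rung i :=
  Prod.ext (ladder_succ_fst i) (ladder_succ_fst i)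

theorem ladder_sub_one (i : ℤ) : ladder (i - 1) = ladder i + rung (i - 1) := by
  rw [show ladder i = ladder (i - 1) + rung (i - 1) by rw [← ladder_succ, sub_add_cancel],
    ZFin.add_add_cancel]

theorem inter_rung_of_notMem {γ : ZFin × ZFin} {j : ℤ} (h1 : j ∉ γ.1.toFinset)
    (h2 : j ∉ γ.2.toFinset) : ZFin.inter γ (rung j) = 0 :=
  Prod.ext (Finset.inter_singleton_of_notMem h1) (Finset.inter_singleton_of_notMem h2)

theorem inter_rung_of_mem {γ : ZFin × ZFin} {j : ℤ} (h1 : j ∈ γ.1.toFinset)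
    (h2 : j ∈ γ.2.toFinset) : ZFin.inter γ (rung j) = rung j :=
  Prod.ext (Finset.inter_singleton_of_mem h1) (Finset.inter_singleton_of_mem h2)

/-- The common part between `0` and the nearer end cancels when `i` and `j` have the same sign. What
remains is the interval with ends `i` and `j`, that is, the rungs crossed on the way. -/
theorem mem_ladder_add_ladder {i j n : ℤ} :
    n ∈ (ladder i + ladder j).1.toFinset ↔ (i ≤ n ∧ n < j) ∨ (j ≤ n ∧ n < i) := by
  change n ∈ ((ladder i).1 + (ladder j).1).toFinset ↔ _
  rw [ZFin.mem_add, mem_ladder_fst, mem_ladder_fst]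
  omega

/-- Crossing a new rung produces no factor `h`, whereas recrossing a rung produces the quadratic
factor `h_{rung n}`. -/
theorem inter_ladder_rung {i j n : ℤ} (h : ¬((i ≤ n ∧ n < j) ∨ (j ≤ n ∧ n < i))) :
    ZFin.inter (ladder i + ladder j) (rung n) = 0 :=
  inter_rung_of_notMem (fun h' => h (mem_ladder_add_ladder.1 h'))
    (fun h' => h (mem_ladder_add_ladder.1 h'))

theorem inter_ladder_rung' {i j n : ℤ} (h : (i ≤ n ∧ n < j) ∨ (j ≤ n ∧ n < i)) :
    ZFin.inter (ladder i + ladder j) (rung n) = rung n :=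
  inter_rung_of_mem (mem_ladder_add_ladder.2 h) (mem_ladder_add_ladder.2 h)

section

variable {k : Type u} [Field k] {m : k}

/-- The link between the two rings: `e_{rung i}² = h_{rung i}` is the defining polynomial `f` of
`A`, translated by the degree. -/
theorem hPoly_rung (i : ℤ) : hPoly m (rung i) = (quad m).comp (X + C (i : k)) := by
  have : hPoly m (rung i) = (X + C (i : k)) * (X + C ((i : k) + m)) := by
    change (∏ j ∈ ({i} : Finset ℤ), _) * ∏ j ∈ ({i} : Finset ℤ), _ = _
    rw [Finset.prod_singleton, Finset.prod_singleton]
  rw [this, quad]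
  simp [add_assoc]

theorem hPoly_eval_eq_zero {γ : ZFin × ZFin} {a : k} (h : (hPoly m γ).eval a = 0) :
    (∃ n ∈ γ.1.toFinset, a = -(n : k)) ∨ ∃ n ∈ γ.2.toFinset, a = -((n : k) + m) := by
  rw [hPoly, eval_mul, mul_eq_zero, eval_prod, eval_prod, Finset.prod_eq_zero_iff,
    Finset.prod_eq_zero_iff] at h
  refine h.imp ?_ ?_ <;>
  · rintro ⟨n, hn, h⟩
    refine ⟨n, hn, ?_⟩
    simp only [eval_add, eval_X, eval_C] at h
    linear_combination h

/-- The polynomials `h` at the sums of a given degree with the ladder have no common zero. -/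
theorem exists_sum_hPoly_eq_one [CharZero k] [IsAlgClosed k]
    (hm : m ∉ Set.range (Int.cast : ℤ → k)) (γ : ZFin × ZFin) :
    ∃ (s : Finset ℤ) (c : ℤ → k[X]), ∑ i ∈ s, c i * hPoly m (γ + ladder i) = 1 := by
  -- Otherwise the polynomials lie in a maximal ideal, generated by some `g` that has a root `a`,
  -- and `a` is a root of all of them.
  have htop : Ideal.span (Set.range fun i => hPoly m (γ + ladder i)) = ⊤ := by
    by_contra hne
    obtain ⟨M, hM, hle⟩ := Ideal.exists_le_maximal _ hne
    obtain ⟨g, rfl⟩ : ∃ g, M = Ideal.span {g} := ⟨_, (Ideal.span_singleton_generator M).symm⟩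
    have hg0 : g ≠ 0 := by
      rintro rfl
      have := hle (Ideal.subset_span ⟨0, rfl⟩)
      rw [Ideal.mem_span_singleton, zero_dvd_iff] at this
      exact hPoly_ne_zero _ this
    have hgu : ¬IsUnit g := fun h => hM.ne_top (Ideal.span_singleton_eq_top.2 h)
    obtain ⟨a, ha⟩ := IsAlgClosed.exists_root g fun h => hgu (by
      rw [eq_C_of_degree_eq_zero h] at hg0 ⊢
      exact isUnit_C.2 (isUnit_iff_ne_zero.2 fun h => hg0 (by rw [h, C_0])))
    have hroot : ∀ i, (hPoly m (γ + ladder i)).eval a = 0 := fun i => by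
      obtain ⟨q, hq⟩ := Ideal.mem_span_singleton.1 (hle (Ideal.subset_span ⟨i, rfl⟩))
      change hPoly m (γ + ladder i) = g * q at hq
      rw [hq, eval_mul, ha.eq_zero, zero_mul]
    -- The roots `-n` and `-(n' + m)` never coincide because `m` is not an integer, so a root fixes
    -- both the component and the index.
    have h1 : ∀ n : ℤ, a = -(n : k) → ∀ i, n ∈ (γ.1 + (ladder i).1).toFinset := by
      rintro n rfl i
      rcases hPoly_eval_eq_zero (hroot i) with ⟨n', h, h'⟩ | ⟨n', -, h'⟩
      · rwa [Int.cast_injective (neg_injective h')]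
      · exact absurd ⟨n - n', by push_cast; linear_combination -h'⟩ hm
    have h2 : ∀ n : ℤ, a = -((n : k) + m) → ∀ i, n ∈ (γ.2 + (ladder i).2).toFinset := by
      rintro n rfl i
      rcases hPoly_eval_eq_zero (hroot i) with ⟨n', -, h'⟩ | ⟨n', h, h'⟩
      · exact absurd ⟨n' - n, by push_cast; linear_combination h'⟩ hm
      · rwa [Int.cast_injective (add_right_cancel (neg_injective h'))]
    rcases hPoly_eval_eq_zero (hroot 0) with ⟨n, -, h⟩ | ⟨n, -, h⟩
    · have ha := h1 n h 0
      -- The sets `ladder n` and `ladder (n + 1)` differ exactly at `n`, so `n` lies in only one of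
      -- their sums with `γ`.
      have hb := h1 n h (n + 1)
      have hc := h1 n h n
      rw [ZFin.mem_add, mem_ladder_fst] at ha hb hc
      by_cases n ∈ γ.1.toFinset <;> simp only [*, true_iff, false_iff] at ha hb hc <;> omega
    · have ha := h2 n h 0
      have hb := h2 n h (n + 1)
      have hc := h2 n h n
      rw [ZFin.mem_add, mem_ladder_snd] at ha hb hc
      by_cases n ∈ γ.2.toFinset <;> simp only [*, true_iff, false_iff] at ha hb hc <;> omega
  obtain ⟨c, hc⟩ := Finsupp.mem_ideal_span_range_iff_exists_finsupp.1
    ((Ideal.eq_top_iff_one _).1 htop)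
  exact ⟨c.support, c, hc⟩

end

/-! ### Graded modules over `D` -/

namespace GrMod

variable {k : Type u} [Field k] [CharZero k] {m : k} {hm : m ∉ Set.range (Int.cast : ℤ → k)}

/-- The action of a homogeneous element of `D`. -/
noncomputable def act (N : GrMod k (dGrading m hm)) (γ : ZFin × ZFin) :
    k[X] →ₗ[k] Module.End k N.carrier :=
  (Algebra.lsmul k k N.carrier).toLinearMap ∘ₗ (MulOpposite.opLinearEquiv k).toLinearMap ∘ₗ
    dElem hm γ

theorem act_apply (N : GrMod k (dGrading m hm)) (γ : ZFin × ZFin) (p : k[X]) (v : N.carrier) :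
    N.act γ p v = MulOpposite.op (dElem hm γ p) • v := rfl

theorem act_add_act (N : GrMod k (dGrading m hm)) (γ : ZFin × ZFin) (p q : k[X])
    (v : N.carrier) : N.act γ p v + N.act γ q v = N.act γ (p + q) v := by
  rw [map_add]; rfl

theorem act_sub_act (N : GrMod k (dGrading m hm)) (γ : ZFin × ZFin) (p q : k[X])
    (v : N.carrier) : N.act γ p v - N.act γ q v = N.act γ (p - q) v := by
  rw [map_sub]; rfl

/-- The degree and the coefficient of the product are free variables with equations, so that
identities in the grading group can be supplied separately at each use. -/
theorem act_act (N : GrMod k (dGrading m hm)) {γ δ ε : ZFin × ZFin} {p q r : k[X]}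
    (hε : γ + δ = ε) (hr : hPoly m (ZFin.inter γ δ) * (p * q) = r) (v : N.carrier) :
    N.act δ q (N.act γ p v) = N.act ε r v := by
  rw [act_apply, act_apply, act_apply, ← mul_smul, ← MulOpposite.op_mul, dElem_mul, hε, hr]

theorem act_zero_act (N : GrMod k (dGrading m hm)) (γ : ZFin × ZFin) (p q : k[X])
    (v : N.carrier) : N.act 0 q (N.act γ p v) = N.act γ (p * q) v :=
  N.act_act (add_zero γ) (by rw [inter_zero_right, hPoly_zero, one_mul]) v

theorem act_act_zero (N : GrMod k (dGrading m hm)) (γ : ZFin × ZFin) (p q : k[X])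
    (v : N.carrier) : N.act γ q (N.act 0 p v) = N.act γ (p * q) v :=
  N.act_act (zero_add γ) (by rw [inter_zero_left, hPoly_zero, one_mul]) v

theorem act_act_self (N : GrMod k (dGrading m hm)) (γ : ZFin × ZFin) (p q : k[X])
    (v : N.carrier) : N.act γ q (N.act γ p v) = N.act 0 (hPoly m γ * (p * q)) v :=
  N.act_act (ZFin.add_self γ) (by rw [ZFin.inter_self]) v

theorem act_zero_one (N : GrMod k (dGrading m hm)) (v : N.carrier) : N.act 0 1 v = v := by
  rw [act_apply, dElem_zero_one, MulOpposite.op_one, one_smul]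

/-- The action of the polynomials in `z`. -/
noncomputable def zAct (N : GrMod k (dGrading m hm)) : k[X] →ₐ[k] Module.End k N.carrier :=
  AlgHom.ofLinearMap (N.act 0) (LinearMap.ext N.act_zero_one) fun p q => LinearMap.ext fun v => by
    rw [mul_comm]
    exact (N.act_zero_act 0 q p v).symm

theorem aeval_act_zero (N : GrMod k (dGrading m hm)) (p q : k[X]) :
    aeval (N.act 0 q) p = N.act 0 (p.comp q) := by
  change aeval (N.zAct q) p = N.zAct (p.comp q)
  rw [aeval_algHom_apply, ← comp_eq_aeval]

theorem act_mem (N : GrMod k (dGrading m hm)) {γ δ ε : ZFin × ZFin} {v : N.carrier}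
    (hv : v ∈ N.piece γ) (hε : γ + δ = ε) (p : k[X]) : N.act δ p v ∈ N.piece ε :=
  hε ▸ N.smul_mem hv (dElem_mem hm δ p)

theorem lin_act {N N' : GrMod k (dGrading m hm)} (φ : N ⟶ N') (γ : ZFin × ZFin) (p : k[X])
    (v : N.carrier) : Hom.lin φ (N.act γ p v) = N'.act γ p (Hom.lin φ v) := map_smul _ _ _

/-- Every element of a graded `D`-module is a combination of elements of ladder degrees. -/
theorem sum_act_act (N : GrMod k (dGrading m hm)) {γ : ZFin × ZFin} {s : Finset ℤ}
    {c : ℤ → k[X]} (h : ∑ i ∈ s, c i * hPoly m (γ + ladder i) = 1) (v : N.carrier) :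
    ∑ i ∈ s, N.act (γ + ladder i) (c i) (N.act (γ + ladder i) 1 v) = v := by
  -- Here `e_δ² = h_δ` for `δ = γ + ladder i` turns the sum into the given partition of unity.
  calc _ = ∑ i ∈ s, N.act 0 (c i * hPoly m (γ + ladder i)) v :=
        Finset.sum_congr rfl fun i _ => by rw [act_act_self, one_mul, mul_comm]
    _ = v := by rw [← LinearMap.sum_apply, ← map_sum, h, act_zero_one]

end GrMod

/-! ### The functor from graded `D`-modules to graded `A`-modules. -/

namespace GrMod

variable {k : Type u} [Field k] [CharZero k] {m : k} {hm : m ∉ Set.range (Int.cast : ℤ → k)}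

/-- The homogeneous pieces in the degrees of the ladder. -/
noncomputable abbrev ladderPiece (N : GrMod k (dGrading m hm)) (i : ℤ) :
    Submodule k N.carrier :=
  N.piece (ladder i)

/-- The action of `x`, `y` and `z` on the ladder part of a graded `D`-module. -/
noncomputable def ladderGen (N : GrMod k (dGrading m hm)) :
    GWAGen → Module.End k (finFun N.ladderPiece)
  -- The value in degree `j` is read off from degree `j - 1`; the rung between these two degrees is
  -- `j - 1`.
  | .x => finFunMap (Equiv.subRight 1) (fun j => N.act (rung (j - 1)) 1) fun j _ hw =>
      N.act_mem hw (by
        rw [Equiv.subRight_apply, ← ladder_succ, sub_add_cancel]) 1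
  | .y => finFunMap (Equiv.addRight 1) (fun j => N.act (rung j) 1) fun j _ hw =>
      N.act_mem hw (by
        rw [Equiv.coe_addRight, ladder_succ, ZFin.add_add_cancel]) 1
  -- Elements of `D` commute with `z`; the added `j` is what makes `z` jump by one when `x` or `y`
  -- changes the degree.
  | .z => finFunMap (Equiv.refl ℤ) (fun j => N.act 0 (X + C (j : k))) fun j _ hw =>
      N.act_mem hw (add_zero _) _

theorem ladderGen_x (N : GrMod k (dGrading m hm)) (F : finFun N.ladderPiece) (j : ℤ) :
    finVal _ j (N.ladderGen .x F) = N.act (rung (j - 1)) 1 (finVal _ (j - 1) F) := rfl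

theorem ladderGen_y (N : GrMod k (dGrading m hm)) (F : finFun N.ladderPiece) (j : ℤ) :
    finVal _ j (N.ladderGen .y F) = N.act (rung j) 1 (finVal _ (j + 1) F) := rfl

theorem ladderGen_z (N : GrMod k (dGrading m hm)) (F : finFun N.ladderPiece) (j : ℤ) :
    finVal _ j (N.ladderGen .z F) = N.act 0 (X + C (j : k)) (finVal _ j F) := rfl

theorem finVal_aeval (N : GrMod k (dGrading m hm)) {E : Module.End k (finFun N.ladderPiece)}
    {j : ℤ} {q : k[X]} (hE : ∀ F, finVal _ j (E F) = N.act 0 q (finVal _ j F)) (p : k[X])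
    (F : finFun N.ladderPiece) :
    finVal _ j (aeval E p F) = N.act 0 (p.comp q) (finVal _ j F) := by
  rw [aeval_intertwine (finVal N.ladderPiece j) E (N.act 0 q) hE, aeval_act_zero]

theorem ladderGen_z_mul_x (N : GrMod k (dGrading m hm)) :
    N.ladderGen .z * N.ladderGen .x = N.ladderGen .x * (N.ladderGen .z + 1) := by
  refine LinearMap.ext fun F => finVal_ext fun j => ?_
  change finVal _ j (N.ladderGen .z (N.ladderGen .x F)) =
    finVal _ j (N.ladderGen .x (N.ladderGen .z F + F))
  rw [ladderGen_z, ladderGen_x, ladderGen_x, map_add (finVal _ _), ladderGen_z, map_add (N.act _ 1),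
    act_zero_act, act_act_zero, act_add_act]
  congr 2
  push_cast
  rw [C_sub, C_1]
  ring

theorem ladderGen_z_mul_y (N : GrMod k (dGrading m hm)) :
    N.ladderGen .z * N.ladderGen .y = N.ladderGen .y * (N.ladderGen .z - 1) := by
  refine LinearMap.ext fun F => finVal_ext fun j => ?_
  change finVal _ j (N.ladderGen .z (N.ladderGen .y F)) =
    finVal _ j (N.ladderGen .y (N.ladderGen .z F - F))
  rw [ladderGen_z, ladderGen_y, ladderGen_y, map_sub (finVal _ _), ladderGen_z, map_sub (N.act _ 1),
    act_zero_act, act_act_zero, act_sub_act]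
  congr 2
  push_cast
  rw [C_add, C_1]
  ring

/-- For right modules this is the relation `xy = f`: in degree `j` the rung `j` is crossed up and
down, which gives `e_{rung j}² = f(z + j)`. -/
theorem ladderGen_y_mul_x (N : GrMod k (dGrading m hm)) :
    N.ladderGen .y * N.ladderGen .x = aeval (N.ladderGen .z) (quad m) := by
  refine LinearMap.ext fun F => finVal_ext fun j => ?_
  rw [N.finVal_aeval (fun F => N.ladderGen_z F j), ← hPoly_rung, Module.End.mul_apply,
    ladderGen_y, ladderGen_x, add_sub_cancel_right, act_act_self, mul_one, mul_one]

/-- The rung crossed here is `j - 1`, below degree `j`, which accounts for the argument `z - 1` in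
`yx = f(z - 1)`. -/
theorem ladderGen_x_mul_y (N : GrMod k (dGrading m hm)) :
    N.ladderGen .x * N.ladderGen .y = aeval (N.ladderGen .z - 1) (quad m) := by
  refine LinearMap.ext fun F => finVal_ext fun j => ?_
  rw [N.finVal_aeval (q := X + C ((j - 1 : ℤ) : k)), ← hPoly_rung, Module.End.mul_apply,
    ladderGen_x, ladderGen_y, act_act_self, mul_one, mul_one, sub_add_cancel]
  intro F
  change finVal _ j (N.ladderGen .z F - F) = _
  rw [map_sub, ladderGen_z]
  -- The bare value is written as the action of `1`, so that the two terms combine into the action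
  -- of one polynomial.
  conv_lhs => rw [← N.act_zero_one (finVal _ j F), act_zero_act, one_mul, act_sub_act]
  congr 2
  push_cast
  rw [C_sub, C_1]
  ring

/-- The right action of `A` on the ladder part of a graded `D`-module. -/
noncomputable def ladderRep (N : GrMod k (dGrading m hm)) :
    GWA (quad m) →ₐ[k] (Module.End k (finFun N.ladderPiece))ᵐᵒᵖ :=
  GWA.rightRep (quad m) (N.ladderGen .x) (N.ladderGen .y) (N.ladderGen .z)
    N.ladderGen_z_mul_x N.ladderGen_z_mul_y N.ladderGen_y_mul_x N.ladderGen_x_mul_y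

theorem ladderRep_gen (N : GrMod k (dGrading m hm)) (g : GWAGen) :
    N.ladderRep (GWA.gen (quad m) g) = MulOpposite.op (N.ladderGen g) := by
  rw [ladderRep, GWA.rightRep, GWA.lift_gen]
  cases g <;> rfl

/-- The ladder part of a graded `D`-module, as a graded `A`-module. -/
noncomputable def ladderMod (N : GrMod k (dGrading m hm)) : GrMod k (GWA.piece (quad m)) :=
  ofRep N.ladderRep (finFunPiece N.ladderPiece)
    (finFunPiece_indep _) (finFunPiece_iSup _) (by
      refine GWA.rightRep_mem _ _ _ fun g i j F hF hj => ?_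
      subst hj
      rw [ladderRep_gen]
      intro δ hδ
      have key : ∀ (E : Module.End k N.carrier) (l : ℤ), l ≠ i →
          E (finVal N.ladderPiece l F) = 0 := fun E l hl => by
        rw [show finVal N.ladderPiece l F = 0 from hF l hl, map_zero]
      cases g
      · exact key _ (δ - 1) fun h => hδ (by rw [← h]; simp [GWAGen.deg])
      · exact key _ (δ + 1) fun h => hδ (by rw [← h]; simp [GWAGen.deg])
      · exact key _ δ fun h => hδ (by rw [← h]; simp [GWAGen.deg]))

/-- The value of an element of the ladder part. -/
noncomputable def ladderVal (N : GrMod k (dGrading m hm)) (j : ℤ) :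
    N.ladderMod.carrier →ₗ[k] N.carrier :=
  finVal N.ladderPiece j

theorem ladderVal_ext {N : GrMod k (dGrading m hm)} {F G : N.ladderMod.carrier}
    (h : ∀ j, N.ladderVal j F = N.ladderVal j G) : F = G := finVal_ext h

theorem ladderVal_mem (N : GrMod k (dGrading m hm)) (F : N.ladderMod.carrier) (j : ℤ) :
    N.ladderVal j F ∈ N.piece (ladder j) := finVal_mem F j

theorem ladderVal_eq_zero (N : GrMod k (dGrading m hm)) {F : N.ladderMod.carrier} {i j : ℤ}
    (hF : F ∈ N.ladderMod.piece i) (hj : j ≠ i) : N.ladderVal j F = 0 := hF j hj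

theorem rightMul_gen (N : GrMod k (dGrading m hm)) (g : GWAGen) (F : N.ladderMod.carrier) :
    N.ladderMod.rightMul (GWA.gen (quad m) g) F = N.ladderGen g F := by
  change MulOpposite.unop (N.ladderRep (GWA.gen (quad m) g)) F = _
  rw [ladderRep_gen]; rfl

theorem ladderVal_rightMul_x (N : GrMod k (dGrading m hm)) (F : N.ladderMod.carrier) (j : ℤ) :
    N.ladderVal j (N.ladderMod.rightMul (GWA.gen (quad m) .x) F) =
      N.act (rung (j - 1)) 1 (N.ladderVal (j - 1) F) :=
  congrArg (N.ladderVal j) (N.rightMul_gen .x F)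

theorem ladderVal_rightMul_y (N : GrMod k (dGrading m hm)) (F : N.ladderMod.carrier) (j : ℤ) :
    N.ladderVal j (N.ladderMod.rightMul (GWA.gen (quad m) .y) F) =
      N.act (rung j) 1 (N.ladderVal (j + 1) F) :=
  congrArg (N.ladderVal j) (N.rightMul_gen .y F)

theorem ladderVal_rightMul_z (N : GrMod k (dGrading m hm)) (F : N.ladderMod.carrier) (j : ℤ) :
    N.ladderVal j (N.ladderMod.rightMul (GWA.gen (quad m) .z) F) =
      N.act 0 (X + C (j : k)) (N.ladderVal j F) :=
  congrArg (N.ladderVal j) (N.rightMul_gen .z F)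

theorem ladderVal_rightMul_poly (N : GrMod k (dGrading m hm)) (F : N.ladderMod.carrier) (j : ℤ)
    (p : k[X]) : N.ladderVal j (N.ladderMod.rightMul (GWA.poly (quad m) p) F) =
      N.act 0 (p.comp (X + C (j : k))) (N.ladderVal j F) := by
  rw [GWA.rightMul_poly, aeval_intertwine (N.ladderVal j) _ _ (fun F => N.ladderVal_rightMul_z F j),
    aeval_act_zero]

/-- An element of ladder degree, as an element of the ladder part. -/
noncomputable def rungElem (N : GrMod k (dGrading m hm)) (i : ℤ) :
    N.piece (ladder i) →ₗ[k] N.ladderMod.carrier :=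
  finSingle N.ladderPiece i

theorem rungElem_mem (N : GrMod k (dGrading m hm)) (i : ℤ) (v : N.piece (ladder i)) :
    N.rungElem i v ∈ N.ladderMod.piece i := finSingle_mem N.ladderPiece i v

theorem ladderVal_rungElem (N : GrMod k (dGrading m hm)) (i : ℤ) (v : N.piece (ladder i)) :
    N.ladderVal i (N.rungElem i v) = v := finVal_finSingle (P := N.ladderPiece) i v

theorem eq_rungElem (N : GrMod k (dGrading m hm)) {i : ℤ} {F : N.ladderMod.carrier}
    (hF : F ∈ N.ladderMod.piece i) (v : N.piece (ladder i)) (hv : N.ladderVal i F = v) :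
    F = N.rungElem i v := by
  refine ladderVal_ext fun j => ?_
  by_cases h : j = i
  · subst h; rw [hv, ladderVal_rungElem]
  · rw [N.ladderVal_eq_zero hF h, N.ladderVal_eq_zero (N.rungElem_mem i v) h]

theorem exists_rungElem (N : GrMod k (dGrading m hm)) {i : ℤ} {F : N.ladderMod.carrier}
    (hF : F ∈ N.ladderMod.piece i) : ∃ v, F = N.rungElem i v :=
  ⟨⟨_, N.ladderVal_mem F i⟩, N.eq_rungElem hF _ rfl⟩

theorem rungElem_poly (N : GrMod k (dGrading m hm)) (i : ℤ) (v : N.piece (ladder i)) (p : k[X]) :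
    N.ladderMod.rightMul (GWA.poly (quad m) p) (N.rungElem i v) =
      N.rungElem i ⟨N.act 0 (p.comp (X + C (i : k))) v, N.act_mem v.2 (add_zero _) _⟩ := by
  refine N.eq_rungElem (N.ladderMod.rightMul_mem (N.rungElem_mem i v) (GWA.poly_mem _ p)
    (add_zero i)) _ ?_
  rw [ladderVal_rightMul_poly, ladderVal_rungElem]

theorem rungElem_x (N : GrMod k (dGrading m hm)) (i : ℤ) (v : N.piece (ladder i)) :
    N.ladderMod.rightMul (GWA.gen (quad m) .x) (N.rungElem i v) =
      N.rungElem (i + 1) ⟨N.act (rung i) 1 v, N.act_mem v.2 (ladder_succ i).symm _⟩ := by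
  refine N.eq_rungElem (N.ladderMod.rightMul_mem (N.rungElem_mem i v) (GWA.gen_mem _ .x)
    (ε := i + 1) rfl) _ ?_
  rw [ladderVal_rightMul_x, add_sub_cancel_right, ladderVal_rungElem]

theorem rungElem_y (N : GrMod k (dGrading m hm)) {i j : ℤ} (hij : i + 1 = j)
    (v : N.piece (ladder j)) :
    N.ladderMod.rightMul (GWA.gen (quad m) .y) (N.rungElem j v) =
      N.rungElem i ⟨N.act (rung i) 1 v, N.act_mem v.2
        (by rw [← hij, ladder_succ, ZFin.add_add_cancel]) _⟩ := by
  subst hij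
  refine N.eq_rungElem (N.ladderMod.rightMul_mem (N.rungElem_mem _ v) (GWA.gen_mem _ .y)
    (by simp [GWAGen.deg])) _ ?_
  rw [ladderVal_rightMul_y, ladderVal_rungElem]

/-- The functor that takes a graded `D`-module to its ladder part. -/
noncomputable def ladderFunctor (m : k) (hm : m ∉ Set.range (Int.cast : ℤ → k)) :
    GrMod k (dGrading m hm) ⥤ GrMod k (GWA.piece (quad m)) where
  obj N := N.ladderMod
  map {N N'} φ := GWA.homOfGen (quad m) (M := N.ladderMod) (N := N'.ladderMod)
    (finFunMap (P := N.ladderPiece) (Q := N'.ladderPiece) (Equiv.refl ℤ)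
      (fun _ => (Hom.lin φ).restrictScalars k) fun _ _ hw => Hom.lin_mem φ hw)
    (fun γ F hF => finFunMap_mem (P := N.ladderPiece) (Q := N'.ladderPiece) (Equiv.refl ℤ) _ _ hF)
    (by
      intro g _ F _
      refine ladderVal_ext fun j => ?_
      change Hom.lin φ (N.ladderVal j (N.ladderMod.rightMul (GWA.gen (quad m) g) F)) = _
      cases g
      · rw [ladderVal_rightMul_x, ladderVal_rightMul_x, lin_act]; rfl
      · rw [ladderVal_rightMul_y, ladderVal_rightMul_y, lin_act]; rfl
      · rw [ladderVal_rightMul_z, ladderVal_rightMul_z, lin_act]; rfl)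

theorem ladderVal_map {N N' : GrMod k (dGrading m hm)} (φ : N ⟶ N') (F : N.ladderMod.carrier)
    (j : ℤ) : N'.ladderVal j (Hom.lin ((ladderFunctor m hm).map φ) F) =
      Hom.lin φ (N.ladderVal j F) := rfl

theorem ladderFunctor_map_rungElem {N N' : GrMod k (dGrading m hm)} (φ : N ⟶ N') (i : ℤ)
    (v : N.piece (ladder i)) : Hom.lin ((ladderFunctor m hm).map φ) (N.rungElem i v) =
      N'.rungElem i ⟨Hom.lin φ v, Hom.lin_mem φ v.2⟩ := by
  refine N'.eq_rungElem (Hom.lin_mem ((ladderFunctor m hm).map φ) (N.rungElem_mem i v)) _ ?_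
  rw [ladderVal_map, ladderVal_rungElem]

end GrMod

theorem ZFin.add_add_cancel_left (γ δ : ZFin × ZFin) : γ + (γ + δ) = δ := by
  rw [← add_assoc, ZFin.add_self, zero_add]

/-! ### The ladder functor is fully faithful. -/

namespace GrMod

variable {k : Type u} [Field k] [CharZero k] {m : k} {hm : m ∉ Set.range (Int.cast : ℤ → k)}

/-- An element of `A` that moves one rung of the ladder to another. -/
theorem exists_path (m : k) (hm : m ∉ Set.range (Int.cast : ℤ → k)) (i j : ℤ) :
    ∃ a ∈ GWA.piece (quad m) (j - i), ∀ (N : GrMod k (dGrading m hm))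
      (v : N.piece (ladder i)) (w : N.piece (ladder j)),
      (w : N.carrier) = N.act (ladder i + ladder j) 1 v →
        N.ladderMod.rightMul a (N.rungElem i v) = N.rungElem j w := by
  have base : ∃ a ∈ GWA.piece (quad m) (i - i), ∀ (N : GrMod k (dGrading m hm))
      (v : N.piece (ladder i)) (w : N.piece (ladder i)),
      (w : N.carrier) = N.act (ladder i + ladder i) 1 v →
        N.ladderMod.rightMul a (N.rungElem i v) = N.rungElem i w := by
    refine ⟨1, by rw [sub_self]; exact GWA.one_mem _, fun N v w h => ?_⟩
    rw [ZFin.add_self, act_zero_one] at h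
    rw [rightMul_apply, MulOpposite.op_one, one_smul, Subtype.ext h]
  -- The element is a power of `x` for `i ≤ j` and a power of `y` for `j ≤ i`; it is the same for
  -- all `N`, so it can be applied in the source and the target of a morphism.
  rcases le_total i j with h | h
  · induction j, h using Int.leInduction with
    | base => exact base
    | succ j hij ih =>
      obtain ⟨a, ha, ih⟩ := ih
      refine ⟨a * GWA.gen _ .x, ?_, fun N v w h => ?_⟩
      · have := GWA.mul_mem _ ha (GWA.gen_mem (quad m) .x)
        rwa [show j - i + GWAGen.x.deg = j + 1 - i by simp [GWAGen.deg]; ring] at this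
      · rw [rightMul_mul, ih N v ⟨_, N.act_mem v.2 (ZFin.add_add_cancel_left _ _) 1⟩ rfl,
          rungElem_x]
        congr 1
        refine Subtype.ext (Eq.trans ?_ h.symm)
        refine N.act_act (by rw [ladder_succ, add_assoc]) ?_ v
        -- The rung `j` has not yet been crossed between `i` and `j`, so no factor `h` appears.
        rw [inter_ladder_rung (by omega), hPoly_zero, mul_one, mul_one]
  · induction j, h using Int.leInductionDown with
    | base => exact base
    | pred j hij ih =>
      obtain ⟨a, ha, ih⟩ := ih
      refine ⟨a * GWA.gen _ .y, ?_, fun N v w h => ?_⟩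
      · have := GWA.mul_mem _ ha (GWA.gen_mem (quad m) .y)
        rwa [show j - i + GWAGen.y.deg = j - 1 - i by simp [GWAGen.deg]; ring] at this
      · rw [rightMul_mul, ih N v ⟨_, N.act_mem v.2 (ZFin.add_add_cancel_left _ _) 1⟩ rfl,
          N.rungElem_y (sub_add_cancel j 1)]
        congr 1
        refine Subtype.ext (Eq.trans ?_ h.symm)
        refine N.act_act (by rw [ladder_sub_one, add_assoc]) ?_ v
        rw [inter_ladder_rung (by omega), hPoly_zero, mul_one, mul_one]

/-- By `sum_act_act` a vector is a combination of its images under the `e_{γ + ladder i}`. For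
homogeneous vectors of degree `γ` these images have ladder degree, so equalities can be tested
there. -/
theorem eq_of_act_ladder [IsAlgClosed k] (N : GrMod k (dGrading m hm)) (γ : ZFin × ZFin)
    {v w : N.carrier}
    (h : ∀ i, N.act (γ + ladder i) 1 v = N.act (γ + ladder i) 1 w) : v = w := by
  obtain ⟨s, c, hc⟩ := exists_sum_hPoly_eq_one hm γ
  rw [← N.sum_act_act hc v, ← N.sum_act_act hc w]
  exact Finset.sum_congr rfl fun i _ => by rw [h]

theorem lin_eq_of_ladderFunctor {N N' : GrMod k (dGrading m hm)} {φ φ' : N ⟶ N'}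
    (h : (ladderFunctor m hm).map φ = (ladderFunctor m hm).map φ') {i : ℤ} {v : N.carrier}
    (hv : v ∈ N.piece (ladder i)) : Hom.lin φ v = Hom.lin φ' v := by
  have h1 : Hom.lin ((ladderFunctor m hm).map φ) (N.rungElem i ⟨v, hv⟩) =
      Hom.lin ((ladderFunctor m hm).map φ') (N.rungElem i ⟨v, hv⟩) := by rw [h]
  rw [ladderFunctor_map_rungElem, ladderFunctor_map_rungElem] at h1
  have h2 := congrArg (N'.ladderVal i) h1
  rwa [ladderVal_rungElem, ladderVal_rungElem] at h2

instance ladderFunctor_faithful [IsAlgClosed k] : (ladderFunctor m hm).Faithful where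
  map_injective {N N'} φ φ' h := by
    refine hom_ext_of_piece fun γ v hv => N'.eq_of_act_ladder γ fun i => ?_
    rw [← lin_act, ← lin_act]
    exact lin_eq_of_ladderFunctor h (N.act_mem hv (ZFin.add_add_cancel_left _ _) 1)

section Full

variable {N N' : GrMod k (dGrading m hm)} (ψ : N.ladderMod ⟶ N'.ladderMod)

/-- A morphism of ladder parts, on one rung. -/
theorem exists_rungMap (i : ℤ) : ∃ g : N.carrier →ₗ[k] N'.carrier, ∀ v : N.piece (ladder i),
    g v ∈ N'.piece (ladder i) ∧
      ∀ w : N'.piece (ladder i), g v = w → Hom.lin ψ (N.rungElem i v) = N'.rungElem i w := by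
  -- The map is defined only on `N_{ladder i}`. An arbitrary linear extension lets it be composed
  -- with the action of `D`; its values elsewhere play no role.
  obtain ⟨g, hg⟩ := LinearMap.exists_extend
    (N'.ladderVal i ∘ₗ (Hom.lin ψ).restrictScalars k ∘ₗ N.rungElem i)
  have hg' : ∀ v : N.piece (ladder i), g v = N'.ladderVal i (Hom.lin ψ (N.rungElem i v)) :=
    fun v => LinearMap.congr_fun hg v
  refine ⟨g, fun v => ⟨?_, fun w hw => ?_⟩⟩
  · rw [hg']; exact N'.ladderVal_mem _ i
  · exact N'.eq_rungElem (Hom.lin_mem ψ (N.rungElem_mem i v)) w ((hg' v).symm.trans hw)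

/-- A morphism of ladder parts on one rung, extended to a linear map. -/
noncomputable def rungMap (i : ℤ) : N.carrier →ₗ[k] N'.carrier := (exists_rungMap ψ i).choose

theorem rungMap_mem {i : ℤ} {v : N.carrier} (hv : v ∈ N.piece (ladder i)) :
    rungMap ψ i v ∈ N'.piece (ladder i) := ((exists_rungMap ψ i).choose_spec ⟨v, hv⟩).1

theorem lin_rungElem {i : ℤ} (v : N.piece (ladder i)) :
    Hom.lin ψ (N.rungElem i v) = N'.rungElem i ⟨rungMap ψ i v, rungMap_mem ψ v.2⟩ :=
  ((exists_rungMap ψ i).choose_spec v).2 _ rfl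

theorem rungMap_eq {i : ℤ} {v : N.piece (ladder i)} {w : N'.piece (ladder i)}
    (h : Hom.lin ψ (N.rungElem i v) = N'.rungElem i w) : rungMap ψ i v = w := by
  rw [lin_rungElem] at h
  have := congrArg (N'.ladderVal i) h
  rwa [ladderVal_rungElem, ladderVal_rungElem] at this

/-- In degree `i` the polynomial `p(z)` of `D` acts as `p(z - i)` of `A`, with which `ψ` commutes.
-/
theorem rungMap_act_zero {i : ℤ} {v : N.carrier} (hv : v ∈ N.piece (ladder i)) (p : k[X]) :
    rungMap ψ i (N.act 0 p v) = N'.act 0 p (rungMap ψ i v) := by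
  have hp : (p.comp (X - C (i : k))).comp (X + C (i : k)) = p := by
    rw [comp_assoc]; simp
  have h := lin_rightMul ψ (GWA.poly (quad m) (p.comp (X - C (i : k)))) (N.rungElem i ⟨v, hv⟩)
  rw [rungElem_poly, lin_rungElem ψ ⟨v, hv⟩, rungElem_poly] at h
  have := rungMap_eq ψ h
  simpa only [hp] using this

/-- The element `e_{ladder i + ladder j}` acts on rung `i` as an element of `A` (`exists_path`), and
so do the polynomial coefficients. -/
theorem rungMap_act {i j : ℤ} {v : N.carrier} (hv : v ∈ N.piece (ladder i)) (p : k[X]) :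
    rungMap ψ j (N.act (ladder i + ladder j) p v) =
      N'.act (ladder i + ladder j) p (rungMap ψ i v) := by
  obtain ⟨a, -, ha⟩ := exists_path m hm i j
  have hw := N.act_mem hv (ZFin.add_add_cancel_left (ladder i) (ladder j)) 1
  have hw' := N'.act_mem (rungMap_mem ψ hv) (ZFin.add_add_cancel_left (ladder i) (ladder j)) 1
  have h := lin_rightMul ψ a (N.rungElem i ⟨v, hv⟩)
  rw [ha N ⟨v, hv⟩ ⟨_, hw⟩ rfl, lin_rungElem ψ ⟨v, hv⟩, ha N' _ ⟨_, hw'⟩ rfl] at h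
  have h1 : rungMap ψ j (N.act (ladder i + ladder j) 1 v) =
      N'.act (ladder i + ladder j) 1 (rungMap ψ i v) := rungMap_eq ψ h
  have h2 := rungMap_act_zero ψ hw p
  rwa [act_zero_act, one_mul, h1, act_zero_act, one_mul] at h2

/-- The formula for `g` is forced by writing `v = ∑ c_i e_{γ + ladder i}² v` and using `ψ` on the
ladder. The condition over all `j` determines `g v` by `eq_of_act_ladder`, so the choice of the
`c_i` is harmless. -/
theorem exists_pieceMap [IsAlgClosed k] (γ : ZFin × ZFin) :
    ∃ g : N.carrier →ₗ[k] N'.carrier, ∀ v ∈ N.piece γ, g v ∈ N'.piece γ ∧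
      ∀ j, N'.act (γ + ladder j) 1 (g v) = rungMap ψ j (N.act (γ + ladder j) 1 v) := by
  obtain ⟨s, c, hc⟩ := exists_sum_hPoly_eq_one hm γ
  let g : N.carrier →ₗ[k] N'.carrier :=
    ∑ i ∈ s, N'.act (γ + ladder i) (c i) ∘ₗ rungMap ψ i ∘ₗ N.act (γ + ladder i) 1
  have hg : ∀ v, g v =
      ∑ i ∈ s, N'.act (γ + ladder i) (c i) (rungMap ψ i (N.act (γ + ladder i) 1 v)) :=
    fun v => LinearMap.sum_apply _ _ _
  have hmem : ∀ v ∈ N.piece γ, ∀ i, N.act (γ + ladder i) 1 v ∈ N.piece (ladder i) :=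
    fun v hv i => N.act_mem hv (ZFin.add_add_cancel_left _ _) 1
  refine ⟨g, fun v hv => ⟨?_, fun j => ?_⟩⟩
  · rw [hg]
    refine Submodule.sum_mem _ fun i _ => N'.act_mem (rungMap_mem ψ (hmem v hv i)) ?_ _
    rw [add_comm γ, ZFin.add_add_cancel_left]
  · conv_rhs => rw [← N.sum_act_act hc v]
    rw [hg, map_sum, map_sum, map_sum]
    refine Finset.sum_congr rfl fun i _ => ?_
    -- Going from rung `i` to rung `j` through degree `γ` is, up to a polynomial, the direct
    -- passage, with which `ψ` commutes.
    rw [N'.act_act (ZFin.add_cancel_add γ _ _) rfl, N.act_act (ZFin.add_cancel_add γ _ _) rfl,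
      rungMap_act ψ (hmem v hv i)]

/-- The extension of a morphism of ladder parts to one homogeneous piece. -/
noncomputable def pieceMap [IsAlgClosed k] (γ : ZFin × ZFin) : N.carrier →ₗ[k] N'.carrier :=
  (exists_pieceMap ψ γ).choose

theorem pieceMap_mem [IsAlgClosed k] {γ : ZFin × ZFin} {v : N.carrier} (hv : v ∈ N.piece γ) :
    pieceMap ψ γ v ∈ N'.piece γ := ((exists_pieceMap ψ γ).choose_spec v hv).1

theorem act_pieceMap [IsAlgClosed k] {γ : ZFin × ZFin} {v : N.carrier} (hv : v ∈ N.piece γ)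
    (j : ℤ) : N'.act (γ + ladder j) 1 (pieceMap ψ γ v) =
      rungMap ψ j (N.act (γ + ladder j) 1 v) :=
  ((exists_pieceMap ψ γ).choose_spec v hv).2 j

theorem pieceMap_ladder [IsAlgClosed k] {i : ℤ} {v : N.carrier} (hv : v ∈ N.piece (ladder i)) :
    pieceMap ψ (ladder i) v = rungMap ψ i v := by
  have := act_pieceMap ψ hv i
  rwa [ZFin.add_self, act_zero_one, act_zero_one] at this

/-- Both sides are compared after multiplication by `e_{γ + δ + ladder j}`. Its product with `p e_δ`
is a polynomial multiple of `e_{γ + ladder j}`, for which the claim is `act_pieceMap` together with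
linearity over `k[z]`. -/
theorem pieceMap_act [IsAlgClosed k] {γ : ZFin × ZFin} {v : N.carrier} (hv : v ∈ N.piece γ)
    (δ : ZFin × ZFin) (p : k[X]) :
    pieceMap ψ (γ + δ) (N.act δ p v) = N'.act δ p (pieceMap ψ γ v) := by
  refine N'.eq_of_act_ladder (γ + δ) fun j => ?_
  have h : δ + (γ + δ + ladder j) = γ + ladder j := by
    rw [add_comm γ, add_assoc, ZFin.add_add_cancel_left]
  rw [act_pieceMap ψ (N.act_mem hv rfl p), N.act_act h rfl, N'.act_act h rfl]
  generalize hPoly m _ * (p * 1) = q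
  rw [← one_mul q, ← act_zero_act, ← act_zero_act, act_pieceMap ψ hv,
    rungMap_act_zero ψ (N.act_mem hv (ZFin.add_add_cancel_left _ _) 1)]

end Full

instance ladderFunctor_full [IsAlgClosed k] : (ladderFunctor m hm).Full where
  map_surjective {N N'} ψ := by
    obtain ⟨φ, hφ⟩ := N.exists_glue fun γ => pieceMap ψ γ ∘ₗ (N.piece γ).subtype
    have hφ' : ∀ γ, ∀ v ∈ N.piece γ, φ v = pieceMap ψ γ v := fun γ v hv => hφ γ ⟨v, hv⟩
    obtain ⟨χ, hχ⟩ : ∃ χ : N ⟶ N', ∀ v, Hom.lin χ v = φ v := by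
      refine ⟨homOfHomogeneous (dGrading_iSup hm) φ (fun γ v hv => ?_)
        (fun γ δ v r hv hr => ?_), fun v => rfl⟩
      · rw [hφ' γ v hv]; exact pieceMap_mem ψ hv
      · obtain ⟨p, rfl⟩ := mem_dGrading hm hr
        change φ (N.act δ p v) = N'.act δ p (φ v)
        rw [hφ' γ v hv, hφ' (γ + δ) _ (N.act_mem hv rfl p), pieceMap_act ψ hv]
    refine ⟨χ, hom_ext_of_piece fun i F hF => ?_⟩
    obtain ⟨v, rfl⟩ := N.exists_rungElem hF
    refine (ladderFunctor_map_rungElem χ i v).trans (Eq.trans ?_ (lin_rungElem ψ v).symm)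
    congr 1
    refine Subtype.ext ?_
    change Hom.lin χ v = rungMap ψ i v
    rw [hχ, hφ' _ v v.2, pieceMap_ladder ψ v.2]

end GrMod

/-! ### Reconstruction of a graded `D`-module from its ladder part. -/

namespace GrMod

variable {k : Type u} [Field k] {m : k}

/-- The action of the polynomials in `z - j`. -/
noncomputable def tAct (M : GrMod k (GWA.piece (quad m))) (j : ℤ) :
    k[X] →ₗ[k] Module.End k M.carrier where
  -- If `M` is a ladder part, this is how the polynomial `p` of `D` acts on `M_j`, where the `z` of
  -- `A` is the `z` of `D` plus `j`.
  toFun p := M.rightMul (GWA.poly (quad m) (p.comp (X - C (j : k))))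
  map_add' p q := by
    rw [add_comp, map_add]
    exact LinearMap.ext fun v => add_smul _ _ v
  map_smul' c p := by
    rw [smul_comp, map_smul]
    exact LinearMap.ext fun v => smul_assoc c _ v

theorem tAct_apply (M : GrMod k (GWA.piece (quad m))) (j : ℤ) (p : k[X]) :
    M.tAct j p = M.rightMul (GWA.poly (quad m) (p.comp (X - C (j : k)))) := rfl

theorem tAct_one (M : GrMod k (GWA.piece (quad m))) (j : ℤ) (v : M.carrier) :
    M.tAct j 1 v = v := by
  rw [tAct_apply, one_comp, map_one, rightMul_apply, MulOpposite.op_one, one_smul]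

theorem tAct_tAct (M : GrMod k (GWA.piece (quad m))) (j : ℤ) (p q : k[X]) (v : M.carrier) :
    M.tAct j q (M.tAct j p v) = M.tAct j (p * q) v := by
  rw [tAct_apply, tAct_apply, tAct_apply, mul_comp, map_mul, rightMul_mul]

theorem tAct_mem (M : GrMod k (GWA.piece (quad m))) {i : ℤ} {v : M.carrier} (hv : v ∈ M.piece i)
    (j : ℤ) (p : k[X]) : M.tAct j p v ∈ M.piece i :=
  M.rightMul_mem hv (GWA.poly_mem _ _) (add_zero i)

/-- The action of `x`. -/
noncomputable def xAct (M : GrMod k (GWA.piece (quad m))) : Module.End k M.carrier :=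
  M.rightMul (GWA.gen (quad m) .x)

/-- The action of `y`. -/
noncomputable def yAct (M : GrMod k (GWA.piece (quad m))) : Module.End k M.carrier :=
  M.rightMul (GWA.gen (quad m) .y)

theorem xAct_mem (M : GrMod k (GWA.piece (quad m))) {i : ℤ} {v : M.carrier}
    (hv : v ∈ M.piece i) : M.xAct v ∈ M.piece (i + 1) :=
  M.rightMul_mem hv (GWA.gen_mem (quad m) .x) rfl

theorem yAct_mem (M : GrMod k (GWA.piece (quad m))) {i : ℤ} {v : M.carrier}
    (hv : v ∈ M.piece i) : M.yAct v ∈ M.piece (i - 1) :=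
  M.rightMul_mem hv (GWA.gen_mem (quad m) .y) rfl

/-- The translation of `z` by `x` compensates the change of degree: in the normalisation of `tAct`,
polynomials commute with `x`, and likewise with `y`. -/
theorem xAct_tAct (M : GrMod k (GWA.piece (quad m))) (j : ℤ) (p : k[X]) (v : M.carrier) :
    M.xAct (M.tAct j p v) = M.tAct (j + 1) p (M.xAct v) := by
  rw [tAct_apply, tAct_apply, xAct, ← rightMul_mul, ← rightMul_mul, GWA.x_mul_poly, comp_assoc]
  congr 4
  simp

theorem yAct_tAct (M : GrMod k (GWA.piece (quad m))) (j : ℤ) (p : k[X]) (v : M.carrier) :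
    M.yAct (M.tAct (j + 1) p v) = M.tAct j p (M.yAct v) := by
  rw [tAct_apply, tAct_apply, yAct, ← rightMul_mul, ← rightMul_mul, GWA.y_mul_poly, comp_assoc]
  congr 4
  simp only [sub_comp, X_comp, C_comp, Int.cast_add, Int.cast_one, C_add, C_1]
  congr 1
  ring1

theorem yAct_xAct (M : GrMod k (GWA.piece (quad m))) (j : ℤ) (v : M.carrier) :
    M.yAct (M.xAct v) = M.tAct j (hPoly m (rung j)) v := by
  rw [tAct_apply, xAct, yAct, ← rightMul_mul, hPoly_rung, comp_assoc, GWA.x_mul_y]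
  simp [GWA.poly]

theorem xAct_yAct (M : GrMod k (GWA.piece (quad m))) (j : ℤ) (v : M.carrier) :
    M.xAct (M.yAct v) = M.tAct (j + 1) (hPoly m (rung j)) v := by
  rw [tAct_apply, xAct, yAct, ← rightMul_mul, hPoly_rung, comp_assoc, GWA.y_mul_x']
  congr 4
  simp
  ring

/-- The sequences in a graded `A`-module that describe the homogeneous elements of degree `γ` of
the corresponding graded `D`-module. -/
def climbPiece (M : GrMod k (GWA.piece (quad m))) (γ : ZFin × ZFin) :
    Submodule k (ℤ → M.carrier) where
  -- The value `s j` stands for `e_{γ + ladder j} v`. The two equations are the products of `e_{rung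
  -- j}` with `e_{γ + ladder j}` and with `e_{γ + ladder (j + 1)}`.
  carrier := {s | ∀ j, s j ∈ M.piece j ∧
    M.xAct (s j) = M.tAct (j + 1) (hPoly m (ZFin.inter (γ + ladder j) (rung j))) (s (j + 1)) ∧
    M.yAct (s (j + 1)) = M.tAct j (hPoly m (ZFin.inter (γ + ladder (j + 1)) (rung j))) (s j)}
  add_mem' ha hb j := ⟨add_mem (ha j).1 (hb j).1,
    by rw [Pi.add_apply, Pi.add_apply, map_add, map_add, (ha j).2.1, (hb j).2.1],
    by rw [Pi.add_apply, Pi.add_apply, map_add, map_add, (ha j).2.2, (hb j).2.2]⟩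
  zero_mem' j := ⟨zero_mem _, by simp, by simp⟩
  smul_mem' c s hs j := ⟨Submodule.smul_mem _ c (hs j).1,
    by rw [Pi.smul_apply, Pi.smul_apply, map_smul, map_smul, (hs j).2.1],
    by rw [Pi.smul_apply, Pi.smul_apply, map_smul, map_smul, (hs j).2.2]⟩

/-- The action of a homogeneous element of `D` on the values. -/
noncomputable def climbMap (M : GrMod k (GWA.piece (quad m))) (δ : ZFin × ZFin) (p : k[X])
    (γ : ZFin × ZFin) : (ℤ → M.carrier) →ₗ[k] (ℤ → M.carrier) :=
  LinearMap.pi fun j =>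
    -- Here `γ` is the degree of the result: for `v` of degree `γ + δ`, the coefficient is that of
    -- `e_{γ + ladder j} (p e_δ v)` at `e_{γ + δ + ladder j} v`.
    M.tAct j (hPoly m (ZFin.inter δ (γ + ladder j)) * p) ∘ₗ LinearMap.proj j

theorem climbMap_apply (M : GrMod k (GWA.piece (quad m))) (δ : ZFin × ZFin) (p : k[X])
    (γ : ZFin × ZFin) (s : ℤ → M.carrier) (j : ℤ) :
    M.climbMap δ p γ s j = M.tAct j (hPoly m (ZFin.inter δ (γ + ladder j)) * p) (s j) := rfl

/-- Both conditions reduce to the cocycle identity for `δ`, the sum of `γ` with a ladder degree, and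
`rung j`, which expresses associativity in `D`. -/
theorem climbMap_mem (M : GrMod k (GWA.piece (quad m))) (δ : ZFin × ZFin) (p : k[X])
    (γ : ZFin × ZFin) (s : ℤ → M.carrier) (hs : s ∈ M.climbPiece (γ + δ)) :
    M.climbMap δ p γ s ∈ M.climbPiece γ := by
  intro j
  refine ⟨M.tAct_mem (hs j).1 _ _, ?_, ?_⟩
  · rw [climbMap_apply, climbMap_apply, xAct_tAct, (hs j).2.1, tAct_tAct, tAct_tAct]
    have := hPoly_cocycle (m := m) δ (γ + ladder j) (rung j)
    rw [ladder_succ, add_right_comm γ δ, add_comm (γ + ladder j) δ, ← add_assoc γ]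
    congr 2
    linear_combination p * this
  · rw [climbMap_apply, climbMap_apply, yAct_tAct, (hs j).2.2, tAct_tAct, tAct_tAct]
    have := hPoly_cocycle (m := m) δ (γ + ladder (j + 1)) (rung j)
    rw [add_right_comm γ δ, add_comm (γ + ladder (j + 1)) δ]
    rw [add_assoc γ, ladder_succ, ZFin.add_add_cancel, ← ladder_succ] at this
    congr 2
    linear_combination p * this

/-- The action of a homogeneous element of `D` on finitely supported functions. -/
noncomputable def climbAct (M : GrMod k (GWA.piece (quad m))) (δ : ZFin × ZFin) :
    k[X] →ₗ[k] Module.End k (finFun M.climbPiece) where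
  toFun p := finFunMap (Equiv.addRight δ) (M.climbMap δ p) (M.climbMap_mem δ p)
  map_add' p q := LinearMap.ext fun F => finVal_ext fun γ => funext fun j => by
    change M.tAct j (_ * (p + q)) _ = M.tAct j (_ * p) _ + M.tAct j (_ * q) _
    rw [mul_add, map_add]
    rfl
  map_smul' c p := LinearMap.ext fun F => finVal_ext fun γ => funext fun j => by
    change M.tAct j (_ * (c • p)) _ = c • M.tAct j (_ * p) _
    rw [mul_smul_comm, map_smul]
    rfl

theorem climbAct_apply (M : GrMod k (GWA.piece (quad m))) (δ : ZFin × ZFin) (p : k[X])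
    (F : finFun M.climbPiece) (γ : ZFin × ZFin) (j : ℤ) :
    finVal _ γ (M.climbAct δ p F) j =
      M.tAct j (hPoly m (ZFin.inter δ (γ + ladder j)) * p) (finVal _ (γ + δ) F j) := rfl

theorem climbAct_zero_one (M : GrMod k (GWA.piece (quad m))) : M.climbAct 0 1 = 1 := by
  refine LinearMap.ext fun F => finVal_ext fun γ => funext fun j => ?_
  rw [climbAct_apply, inter_zero_left, hPoly_zero, mul_one, tAct_one, add_zero]
  rfl

/-- Value by value this is the cocycle identity for `γ`, `δ` and `ε + ladder j`. -/
theorem climbAct_mul (M : GrMod k (GWA.piece (quad m))) (γ δ : ZFin × ZFin) (p q : k[X]) :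
    M.climbAct δ q * M.climbAct γ p =
      M.climbAct (γ + δ) (hPoly m (ZFin.inter γ δ) * (p * q)) := by
  refine LinearMap.ext fun F => finVal_ext fun ε => funext fun j => ?_
  rw [Module.End.mul_apply, climbAct_apply, climbAct_apply, climbAct_apply, tAct_tAct,
    add_assoc ε δ γ, add_comm δ γ]
  have := hPoly_cocycle (m := m) γ δ (ε + ladder j)
  rw [← add_assoc δ, add_comm δ ε] at this
  congr 2
  linear_combination -(p * q) * this

variable [CharZero k] (hm : m ∉ Set.range (Int.cast : ℤ → k))

/-- The graded `D`-module with a given ladder part. -/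
noncomputable def climbMod (M : GrMod k (GWA.piece (quad m))) : GrMod k (dGrading m hm) :=
  ofRep (dRep hm M.climbAct M.climbAct_zero_one M.climbAct_mul) (finFunPiece M.climbPiece)
    (finFunPiece_indep _) (finFunPiece_iSup _) (by
      intro γ δ F r hF hr
      obtain ⟨p, rfl⟩ := mem_dGrading hm hr
      rw [dRep_dElem]
      refine finFunMap_mem (Equiv.addRight δ) _ (M.climbMap_mem δ p) ?_
      -- The group has exponent two, so translation by `δ` is its own inverse.
      change F ∈ finFunPiece M.climbPiece (γ + δ + δ)
      rwa [ZFin.add_add_cancel])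

/-- The values of an element of `climbMod`. -/
noncomputable def climbVal (M : GrMod k (GWA.piece (quad m))) (γ : ZFin × ZFin) (j : ℤ) :
    (M.climbMod hm).carrier →ₗ[k] M.carrier :=
  LinearMap.proj j ∘ₗ finVal M.climbPiece γ

variable {hm}

theorem climbVal_act (M : GrMod k (GWA.piece (quad m))) (γ δ : ZFin × ZFin) (j : ℤ) (p : k[X])
    (F : (M.climbMod hm).carrier) : M.climbVal hm γ j ((M.climbMod hm).act δ p F) =
      M.tAct j (hPoly m (ZFin.inter δ (γ + ladder j)) * p) (M.climbVal hm (γ + δ) j F) := by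
  refine Eq.trans ?_ (M.climbAct_apply δ p F γ j)
  change finVal M.climbPiece γ (MulOpposite.unop
    (dRep hm M.climbAct M.climbAct_zero_one M.climbAct_mul (dElem hm δ p)) F) j = _
  rw [dRep_dElem]
  rfl

theorem climbVal_mem (M : GrMod k (GWA.piece (quad m))) (γ : ZFin × ZFin) (j : ℤ)
    (F : (M.climbMod hm).carrier) : M.climbVal hm γ j F ∈ M.piece j :=
  (finVal_mem (P := M.climbPiece) F γ j).1

theorem xAct_climbVal (M : GrMod k (GWA.piece (quad m))) (γ : ZFin × ZFin) (j : ℤ)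
    (F : (M.climbMod hm).carrier) : M.xAct (M.climbVal hm γ j F) =
      M.tAct (j + 1) (hPoly m (ZFin.inter (γ + ladder j) (rung j)))
        (M.climbVal hm γ (j + 1) F) :=
  (finVal_mem (P := M.climbPiece) F γ j).2.1

theorem yAct_climbVal (M : GrMod k (GWA.piece (quad m))) (γ : ZFin × ZFin) (j : ℤ)
    (F : (M.climbMod hm).carrier) : M.yAct (M.climbVal hm γ (j + 1) F) =
      M.tAct j (hPoly m (ZFin.inter (γ + ladder (j + 1)) (rung j))) (M.climbVal hm γ j F) :=
  (finVal_mem (P := M.climbPiece) F γ j).2.2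

theorem eq_zero_of_climbVal (M : GrMod k (GWA.piece (quad m))) {γ : ZFin × ZFin}
    {F : (M.climbMod hm).carrier} (hF : F ∈ (M.climbMod hm).piece γ)
    (h : ∀ j, M.climbVal hm γ j F = 0) : F = 0 := by
  refine finVal_ext (P := M.climbPiece) fun δ => ?_
  by_cases hδ : δ = γ
  · subst hδ; exact funext h
  · exact hF δ hδ

theorem exists_climb (M : GrMod k (GWA.piece (quad m))) {γ : ZFin × ZFin} {s : ℤ → M.carrier}
    (hs : s ∈ M.climbPiece γ) :
    ∃ F ∈ (M.climbMod hm).piece γ, ∀ j, M.climbVal hm γ j F = s j :=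
  ⟨finSingle M.climbPiece γ ⟨s, hs⟩, finSingle_mem M.climbPiece γ _, fun j =>
    congrFun (finVal_finSingle (P := M.climbPiece) γ ⟨s, hs⟩) j⟩

/-- An element of ladder degree is determined by one of its values. -/
theorem climbVal_eq_zero (M : GrMod k (GWA.piece (quad m))) (i : ℤ)
    (F : (M.climbMod hm).carrier) (h : M.climbVal hm (ladder i) i F = 0) (j : ℤ) :
    M.climbVal hm (ladder i) j F = 0 := by
  rcases le_total i j with hij | hij
  · induction j, hij using Int.leInduction with
    | base => exact h
    | succ j hij ih =>
      have := M.xAct_climbVal (ladder i) j F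
      -- Away from `i` every rung is new, so the next value is exactly `x` applied to the previous
      -- one; below `i` the same holds with `y`.
      rwa [ih, map_zero, inter_ladder_rung (by omega), hPoly_zero, tAct_one, eq_comm] at this
  · induction j, hij using Int.leInductionDown with
    | base => exact h
    | pred j hij ih =>
      have := M.yAct_climbVal (ladder i) (j - 1) F
      rwa [sub_add_cancel, ih, map_zero, inter_ladder_rung (by omega), hPoly_zero, tAct_one,
        eq_comm] at this

/-- Every homogeneous element of degree `i` is the value at `i` of an element of ladder degree. -/
theorem exists_climbVal (M : GrMod k (GWA.piece (quad m))) {i : ℤ} {v : M.carrier}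
    (hv : v ∈ M.piece i) :
    ∃ F ∈ (M.climbMod hm).piece (ladder i), M.climbVal hm (ladder i) i F = v := by
  -- Truncation makes at least one exponent zero: powers of `x` are applied above `i`, powers of `y`
  -- below.
  let s : ℤ → M.carrier := fun j => (M.xAct ^ (j - i).toNat) ((M.yAct ^ (i - j).toNat) v)
  have hup : ∀ j, i ≤ j → s (j + 1) = M.xAct (s j) := fun j hj => by
    change (M.xAct ^ (j + 1 - i).toNat) ((M.yAct ^ (i - (j + 1)).toNat) v) =
      M.xAct ((M.xAct ^ (j - i).toNat) ((M.yAct ^ (i - j).toNat) v))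
    rw [show (j + 1 - i).toNat = (j - i).toNat + 1 by omega,
      show (i - (j + 1)).toNat = 0 by omega, show (i - j).toNat = 0 by omega, pow_succ']
    rfl
  have hdown : ∀ j, j < i → s j = M.yAct (s (j + 1)) := fun j hj => by
    change (M.xAct ^ (j - i).toNat) ((M.yAct ^ (i - j).toNat) v) =
      M.yAct ((M.xAct ^ (j + 1 - i).toNat) ((M.yAct ^ (i - (j + 1)).toNat) v))
    rw [show (j + 1 - i).toNat = 0 by omega, show (j - i).toNat = 0 by omega,
      show (i - j).toNat = (i - (j + 1)).toNat + 1 by omega, pow_succ']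
    rfl
  have hsi : s i = v := by simp [s]
  have hmem : ∀ j, s j ∈ M.piece j := by
    intro j
    rcases le_total i j with hij | hij
    · induction j, hij using Int.leInduction with
      | base => rwa [hsi]
      | succ j hij ih => rw [hup j hij]; exact M.xAct_mem ih
    · induction j, hij using Int.leInductionDown with
      | base => rwa [hsi]
      | pred j hij ih =>
        rw [hdown (j - 1) (by omega), sub_add_cancel]; exact M.yAct_mem ih
  have hs : s ∈ M.climbPiece (ladder i) := by
    intro j
    refine ⟨hmem j, ?_⟩
    -- Of the two conditions, the one leading away from `i` is the definition of `s`. The one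
    -- leading back recrosses a rung, and its factor `h_{rung j}` is the product of `x` and `y` in
    -- the appropriate order.
    rcases le_or_gt i j with hij | hij
    · rw [inter_ladder_rung (by omega), inter_ladder_rung' (by omega), hPoly_zero, tAct_one,
        hup j hij, ← yAct_xAct]
      exact ⟨rfl, rfl⟩
    · rw [inter_ladder_rung' (by omega), inter_ladder_rung (by omega), hPoly_zero, tAct_one,
        hdown j hij, ← xAct_yAct]
      exact ⟨rfl, rfl⟩
  obtain ⟨F, hF, h⟩ := M.exists_climb (hm := hm) hs
  exact ⟨F, hF, (h i).trans hsi⟩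

/-- The ladder part of `climbMod` is the given module. -/
theorem exists_ladder_iso (M : GrMod k (GWA.piece (quad m))) :
    Nonempty ((ladderFunctor m hm).obj (M.climbMod hm) ≅ M) := by
  -- An element of degree `ladder i` is sent to its value at `i`, where `e_{ladder i + ladder i} =
  -- e_0 = 1`.
  obtain ⟨φ, hφ⟩ := (M.climbMod hm).ladderMod.exists_glue fun i =>
    M.climbVal hm (ladder i) i ∘ₗ (M.climbMod hm).ladderVal i ∘ₗ Submodule.subtype _
  have hφ' : ∀ (i : ℤ) (n : (M.climbMod hm).piece (ladder i)),
      φ ((M.climbMod hm).rungElem i n) = M.climbVal hm (ladder i) i n := by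
    intro i n
    rw [← (M.climbMod hm).ladderVal_rungElem i n]
    exact hφ i ⟨_, (M.climbMod hm).rungElem_mem i n⟩
  obtain ⟨χ, hχ⟩ : ∃ χ : (M.climbMod hm).ladderMod ⟶ M, ∀ F, Hom.lin χ F = φ F := by
    refine ⟨GWA.homOfGen (quad m) φ (fun i F hF => ?_) (fun g i F hF => ?_), fun F => rfl⟩
    · obtain ⟨n, rfl⟩ := (M.climbMod hm).exists_rungElem hF
      rw [hφ']
      exact M.climbVal_mem _ i _
    · obtain ⟨n, rfl⟩ := (M.climbMod hm).exists_rungElem hF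
      rw [hφ']
      cases g
      · rw [rungElem_x, hφ', climbVal_act, ZFin.add_self, inter_zero_right, hPoly_zero,
          mul_one, tAct_one, ladder_succ, ZFin.add_add_cancel]
        -- Both sides equal the value of `n` at `i + 1`: the rung `i` is crossed once, without a
        -- factor.
        have := M.xAct_climbVal (ladder i) i (n : (M.climbMod hm).carrier)
        rw [ZFin.add_self, inter_zero_left, hPoly_zero, tAct_one] at this
        exact this.symm
      · obtain ⟨l, rfl⟩ : ∃ l, i = l + 1 := ⟨i - 1, by ring⟩
        rw [(M.climbMod hm).rungElem_y rfl, hφ', climbVal_act, ZFin.add_self, inter_zero_right,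
          hPoly_zero, mul_one, tAct_one, ← ladder_succ]
        have := M.yAct_climbVal (ladder (l + 1)) l (n : (M.climbMod hm).carrier)
        rw [ZFin.add_self, inter_zero_left, hPoly_zero, tAct_one] at this
        exact this.symm
      · rw [GWA.gen_z_eq, rungElem_poly, hφ', climbVal_act, inter_zero_left, hPoly_zero, one_mul,
          add_zero, tAct_apply]
        simp
  have : IsIso χ := isIso_of_piece χ (fun i F hF h => by
    obtain ⟨n, rfl⟩ := (M.climbMod hm).exists_rungElem hF
    rw [hχ, hφ'] at h
    have : n = 0 := Subtype.ext
      (M.eq_zero_of_climbVal n.2 (M.climbVal_eq_zero i (n : (M.climbMod hm).carrier) h))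
    rw [this, map_zero]) (fun i v hv => by
    obtain ⟨F, hF, h⟩ := M.exists_climbVal (hm := hm) hv
    refine ⟨_, (M.climbMod hm).rungElem_mem i ⟨F, hF⟩, ?_⟩
    rw [hχ, hφ', h])
  let e : (M.climbMod hm).ladderMod ≅ M := asIso χ
  exact ⟨e⟩

end GrMod

theorem GWA.rightMul_mem_of_gen {k : Type u} [Field k] {f : k[X]} (M : GrMod k (GWA.piece f))
    (K : ℤ → Submodule k M.carrier)
    (hK : ∀ (g : GWAGen) (i j : ℤ) (w : M.carrier), w ∈ K i → i + g.deg = j →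
      M.rightMul (GWA.gen f g) w ∈ K j)
    (i j : ℤ) (w : M.carrier) (r : GWA f) (hw : w ∈ K i) (hr : r ∈ GWA.piece f j) :
    M.rightMul r w ∈ K (i + j) :=
  GWA.rightRep_mem f (AlgHom.opComm.symm (Algebra.lsmul k k M.carrier)) K hK i j w r hw hr

/-! ### Finite generation and the equivalence. -/

namespace GrMod

variable {k : Type u} [Field k] [CharZero k] {m : k} {hm : m ∉ Set.range (Int.cast : ℤ → k)}

section Generators

variable (N : GrMod k (dGrading m hm)) (Q : Submodule (GWA (quad m))ᵐᵒᵖ N.ladderMod.carrier)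

/-- The elements of ladder degree that lie in a submodule of the ladder part. -/
noncomputable def rungSubmodule (i : ℤ) : Submodule k N.carrier :=
  ((Q.restrictScalars k).comap (N.rungElem i)).map (N.piece (ladder i)).subtype

variable {N Q}

theorem mem_rungSubmodule {i : ℤ} (v : N.piece (ladder i)) :
    (v : N.carrier) ∈ rungSubmodule N Q i ↔ N.rungElem i v ∈ Q := by
  constructor
  · rintro ⟨w, hw, h⟩
    rwa [← Subtype.ext h]
  · exact fun h => ⟨v, h, rfl⟩

/-- An `A`-submodule of the ladder part is stable under all passages between rungs by elements of
`D`, since these are realised by paths in `A` and polynomials in `z`. -/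
theorem act_mem_rungSubmodule {i : ℤ} {v : N.carrier} (hv : v ∈ rungSubmodule N Q i) (j : ℤ)
    (p : k[X]) : N.act (ladder i + ladder j) p v ∈ rungSubmodule N Q j := by
  obtain ⟨v, hv, rfl⟩ := hv
  obtain ⟨a, -, ha⟩ := exists_path m hm i j
  have hw := N.act_mem v.2 (ZFin.add_add_cancel_left (ladder i) (ladder j)) 1
  have h : N.rungElem j ⟨_, hw⟩ ∈ Q := by
    rw [← ha N v ⟨_, hw⟩ rfl]
    exact Q.smul_mem _ hv
  have h' := Q.smul_mem (MulOpposite.op (GWA.poly (quad m) (p.comp (X - C (j : k))))) h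
  rw [← rightMul_apply, rungElem_poly] at h'
  have hp : (p.comp (X - C (j : k))).comp (X + C (j : k)) = p := by
    rw [comp_assoc]; simp
  have h2 := (mem_rungSubmodule _).2 h'
  change N.act 0 _ (N.act _ 1 _) ∈ _ at h2
  rwa [hp, act_zero_act, one_mul] at h2

theorem act_zero_mem_rungSubmodule {i : ℤ} {v : N.carrier} (hv : v ∈ rungSubmodule N Q i)
    (p : k[X]) : N.act 0 p v ∈ rungSubmodule N Q i := by
  have := act_mem_rungSubmodule hv i p
  rwa [ZFin.add_self] at this

end Generators

/-- For each homogeneous generator `s` of `N`, the finitely many elements `e_{d s + ladder i} s`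
with `i` in the support of a partition of unity suffice. -/
theorem finite_ladderMod [IsAlgClosed k] (N : GrMod k (dGrading m hm))
    (hN : Module.Finite (DRing m hm)ᵐᵒᵖ N.carrier) :
    Module.Finite (GWA (quad m))ᵐᵒᵖ N.ladderMod.carrier := by
  obtain ⟨S, hS, hhom, hspan⟩ := exists_homogeneous_generators hN
  choose! d hd using hhom
  choose t c hc using exists_sum_hPoly_eq_one hm
  have hR : ∀ i, ∃ R : N.carrier →ₗ[k] N.ladderMod.carrier,
      ∀ v : N.piece (ladder i), R v = N.rungElem i v := fun i => by
    obtain ⟨R, hR⟩ := LinearMap.exists_extend (N.rungElem i)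
    exact ⟨R, fun v => LinearMap.congr_fun hR v⟩
  choose R hR using hR
  let E : Set N.ladderMod.carrier :=
    ⋃ s ∈ S, (fun i => R i (N.act (d s + ladder i) 1 s)) '' (t (d s) : Set ℤ)
  have hE : E.Finite := hS.biUnion fun s _ => (t (d s)).finite_toSet.image _
  let Q := Submodule.span (GWA (quad m))ᵐᵒᵖ E
  have hgen : ∀ s ∈ S, ∀ i ∈ t (d s), N.act (d s + ladder i) 1 s ∈ rungSubmodule N Q i := by
    intro s hs i hi
    refine (mem_rungSubmodule ⟨_, N.act_mem (hd s hs) (ZFin.add_add_cancel_left _ _) 1⟩).2 ?_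
    rw [← hR]
    exact Submodule.subset_span (Set.mem_biUnion hs ⟨i, hi, rfl⟩)
  -- `K γ` consists of the vectors of degree `γ` all of whose images in ladder degrees lie in `Q`.
  -- It is stable under `D` and contains `S`, hence is all of `N_γ`; at ladder degrees this yields
  -- `Q = ⊤`.
  let K : ZFin × ZFin → Submodule k N.carrier := fun γ =>
    N.piece γ ⊓ ⨅ i, (rungSubmodule N Q i).comap (N.act (γ + ladder i) 1)
  have hKmem : ∀ γ v, v ∈ K γ ↔ v ∈ N.piece γ ∧
      ∀ i, N.act (γ + ladder i) 1 v ∈ rungSubmodule N Q i := fun γ v => by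
    simp only [K, Submodule.mem_inf, Submodule.mem_iInf, Submodule.mem_comap]
  have key : ∀ γ, ∀ v ∈ N.piece γ, v ∈ K γ := by
    intro γ v hv
    refine N.mem_of_generators (dGrading_iSup hm) K (fun _ => inf_le_left) ?_ (S := S) ?_ hspan hv
    · intro γ δ v r hv hr
      obtain ⟨p, rfl⟩ := mem_dGrading hm hr
      obtain ⟨hv, h⟩ := (hKmem _ _).1 hv
      refine (hKmem _ _).2 ⟨N.act_mem hv rfl p, fun i => ?_⟩
      change N.act _ 1 (N.act δ p v) ∈ _
      rw [N.act_act (ε := γ + ladder i) (by rw [add_comm γ, add_assoc, ZFin.add_add_cancel_left])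
        rfl]
      generalize hPoly m _ * (p * 1) = q
      rw [← one_mul q, ← act_zero_act]
      exact act_zero_mem_rungSubmodule (h i) q
    · intro s hs
      refine ⟨d s, (hKmem _ _).2 ⟨hd s hs, fun j => ?_⟩⟩
      -- Only the indices in `t (d s)` were put into `E`; the image of `s` at any other rung `j` is
      -- a combination of passages from those rungs.
      have h := congrArg (N.act (d s + ladder j) 1) (N.sum_act_act (hc (d s)) s)
      rw [map_sum] at h
      rw [← h]
      refine Submodule.sum_mem _ fun i hi => ?_
      rw [N.act_act (ZFin.add_cancel_add (d s) _ _) rfl]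
      exact act_mem_rungSubmodule (hgen s hs i hi) j _
  have htop : Q = ⊤ := by
    rw [eq_top_iff]
    intro F _
    induction F using N.ladderMod.induction_on with
    | zero => exact zero_mem _
    | add a b ha hb => exact add_mem (ha trivial) (hb trivial)
    | hom i F hF =>
      obtain ⟨v, rfl⟩ := N.exists_rungElem hF
      have := ((hKmem _ _).1 (key _ v v.2)).2 i
      rw [ZFin.add_self, act_zero_one] at this
      exact (mem_rungSubmodule v).1 this
  exact ⟨Submodule.fg_def.2 ⟨E, hE, htop⟩⟩

/-- Since `x`, `y` and `z` act through `D`, homogeneous generators of the ladder part generate all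
ladder degrees over `D`, and these generate `N` by `sum_act_act`. -/
theorem finite_of_ladderMod [IsAlgClosed k] (N : GrMod k (dGrading m hm))
    (hN : Module.Finite (GWA (quad m))ᵐᵒᵖ N.ladderMod.carrier) :
    Module.Finite (DRing m hm)ᵐᵒᵖ N.carrier := by
  obtain ⟨S, hS, hhom, hspan⟩ := exists_homogeneous_generators hN
  choose! d hd using hhom
  let E : Set N.carrier := (fun F => N.ladderVal (d F) F) '' S
  let Q := Submodule.span (DRing m hm)ᵐᵒᵖ E
  have hQ : ∀ γ p, ∀ v ∈ Q, N.act γ p v ∈ Q := fun γ p v hv => Q.smul_mem _ hv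
  let K : ℤ → Submodule k N.ladderMod.carrier := fun i =>
    N.ladderMod.piece i ⊓ (Q.restrictScalars k).comap (N.ladderVal i)
  have key : ∀ i, ∀ F ∈ N.ladderMod.piece i, F ∈ K i := by
    intro i F hF
    refine N.ladderMod.mem_of_generators (GWA.piece_iSup _) K (fun _ => inf_le_left) ?_ (S := S)
      (fun F hF => ⟨d F, hd F hF, Submodule.subset_span ⟨F, hF, rfl⟩⟩) hspan hF
    intro i j F r hF hr
    refine GWA.rightMul_mem_of_gen N.ladderMod K (fun g i j F hF hj => ?_) i j F r hF hr
    subst hj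
    refine ⟨N.ladderMod.rightMul_mem hF.1 (GWA.gen_mem _ g) rfl, ?_⟩
    change N.ladderVal _ _ ∈ Q
    have hF2 : N.ladderVal i F ∈ Q := hF.2
    cases g
    · rw [ladderVal_rightMul_x]
      refine hQ _ _ _ ?_
      simpa [GWAGen.deg] using hF2
    · rw [ladderVal_rightMul_y]
      refine hQ _ _ _ ?_
      simpa [GWAGen.deg] using hF2
    · rw [ladderVal_rightMul_z]
      refine hQ _ _ _ ?_
      simpa [GWAGen.deg] using hF2
  have htop : Q = ⊤ := by
    rw [eq_top_iff]
    intro v _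
    induction v using N.induction_on with
    | zero => exact zero_mem _
    | add a b ha hb => exact add_mem (ha trivial) (hb trivial)
    | hom γ v hv =>
      obtain ⟨s, c, hc⟩ := exists_sum_hPoly_eq_one hm γ
      rw [← N.sum_act_act hc v]
      refine Submodule.sum_mem _ fun i _ => hQ _ _ _ ?_
      have h : N.ladderVal i (N.rungElem i
          ⟨_, N.act_mem hv (ZFin.add_add_cancel_left γ (ladder i)) 1⟩) ∈ Q :=
        (key i _ (N.rungElem_mem i _)).2
      rwa [ladderVal_rungElem] at h
  exact ⟨Submodule.fg_def.2 ⟨E, hS.image _, htop⟩⟩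

/-- The functor that takes a finitely generated graded `D`-module to its ladder part. -/
noncomputable def ladderFunctorFg [IsAlgClosed k] (m : k)
    (hm : m ∉ Set.range (Int.cast : ℤ → k)) :
    gr k (dGrading m hm) ⥤ gr k (GWA.piece (quad m)) :=
  (fg k (GWA.piece (quad m))).lift ((fg k (dGrading m hm)).ι ⋙ ladderFunctor m hm)
    fun N => finite_ladderMod N.obj N.property

instance ladderFunctorFg_additive [IsAlgClosed k] : (ladderFunctorFg m hm).Additive where

instance ladderFunctorFg_linear [IsAlgClosed k] : (ladderFunctorFg m hm).Linear k where

instance ladderFunctorFg_faithful [IsAlgClosed k] : (ladderFunctorFg m hm).Faithful where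
  map_injective h := ObjectProperty.hom_ext _
    ((ladderFunctor m hm).map_injective (congrArg (fun φ => φ.hom) h))

instance ladderFunctorFg_full [IsAlgClosed k] : (ladderFunctorFg m hm).Full where
  map_surjective ψ := by
    obtain ⟨φ, hφ⟩ := (ladderFunctor m hm).map_surjective ψ.hom
    exact ⟨ObjectProperty.homMk φ, ObjectProperty.hom_ext _ hφ⟩

/-- The reconstructed `D`-module is finitely generated because its ladder part is isomorphic to the
finitely generated module `M`. -/
instance ladderFunctorFg_essSurj [IsAlgClosed k] : (ladderFunctorFg m hm).EssSurj where
  mem_essImage M := by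
    obtain ⟨e⟩ := M.obj.exists_ladder_iso (hm := hm)
    have hM : Module.Finite (GWA (quad m))ᵐᵒᵖ M.obj.carrier := M.property
    have h : Module.Finite (GWA (quad m))ᵐᵒᵖ (M.obj.climbMod hm).ladderMod.carrier :=
      Module.Finite.of_surjective (Hom.lin e.inv) fun F =>
        ⟨Hom.lin e.hom F, congrArg (fun φ => Hom.lin φ F) e.hom_inv_id⟩
    exact ⟨⟨M.obj.climbMod hm, finite_of_ladderMod _ h⟩, ⟨ObjectProperty.isoMk _ e⟩⟩

instance ladderFunctorFg_isEquivalence [IsAlgClosed k] :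
    (ladderFunctorFg m hm).IsEquivalence where

end GrMod

theorem mainTheorem2 {k : Type*} [Field k] [IsAlgClosed k] [CharZero k] (m : k)
    (hm : m ∉ Set.range (Int.cast : ℤ → k)) :
    ∃ e : gr k (GWA.piece (quad m)) ≌ gr k (dGrading m hm),
      e.functor.Additive ∧ e.functor.Linear k := by
  let F := (GrMod.ladderFunctorFg m hm).asEquivalence
  have : F.functor.Additive := GrMod.ladderFunctorFg_additive
  have : F.functor.Linear k := GrMod.ladderFunctorFg_linear
  -- The ladder functor runs from `D` to `A`, so the required functor is its inverse, which inherits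
  -- additivity and linearity.
  exact ⟨F.symm, inferInstanceAs F.inverse.Additive, inferInstanceAs (F.inverse.Linear k)⟩
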